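/- **Setting.** Let $\psi:\{-1,1\}^n\to\mathbb R$ have multilinear expansion $\psi(x)=\sum_{S\subseteq[n]}\widehat\psi(S)\,x^S$, where $x^S=\prod_{i\in S}x_i$. Let $\partial_i$ denote the partial derivative of a multilinear polynomial, and write $i\sim j$ if $\partial_i\psi$ depends on $x_j$. Let $k\ge 0$ and $d\ge 1$ be integers, let $\alpha>0$ and $\lambda\in\mathbb R$, and suppose that $\psi$ defines a $(k,d,\alpha,\lambda)$-Markov random field, that is: 1. $\deg\psi\le k$; 2. each $\partial_i\psi$ depends on at most $d$ variables; 3. if $i\sim j$, there is $S\ni i,j$ with $|\widehat\psi(S)|\ge\alpha$ that is a maximal monomial of $\psi$ (i.e. $\widehat\psi(S)\ne0$ and $\widehat\psi(S')=0$ for all $S'\supsetneq S$); 4. $\sum_{S\ni i}|\widehat\psi(S)|\le\lambda$ for every $i\in[n]$. Let $(X^t)_{t\ge0}$ be the continuous-time Glauber dynamics of $\psi$. The update times of the sites $i\in[n]$ are independent Poisson processes $\Pi_i$ of rate $1$ on $[0,\infty)$, independent of the arbitrary, possibly random, initial configuration $X^0$. The value of a site does not change between its updates. When site $i$ updates at time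 $t$, then conditionally on $X^0$, all the update times and the values taken at all earlier updates, $X^t_i=1$ with probability $\sigma(2\partial_i\psi(X^t))$, where $\sigma(z)=1/(1+e^{-z})$ (note that $\partial_i\psi$ does not depend on $x_i$). Put $$q=\frac12\Big(\frac{e^{-2\lambda}}{2d}\Big)^{k-2},\quad L=\frac{\alpha^2q\,e^{-6\lambda}}{64d},\quad r=\Big\lceil\frac{\log(2\max\{1,2(k-2)\})}{L}\Big\rceil,\quad \kappa=\frac{5\alpha^2q}{64}e^{-6\lambda}.$$ Fix $i\ne j$ in $[n]$. For $\ell\ge0$, divide the interval $[(\ell+r-1)L,(\ell+r)L]$ into three consecutive intervals $I^{(\ell)}_{2,1},I^{(\ell)}_{2,2},I^{(\ell)}_{2,3}$ of length $L/3$. Let $\mathcal C^{(\ell)}$ be the event that, in $I^{(\ell)}_{2,1}$, site $i$ updates at least twice and $j$ does not update; in $I^{(\ell)}_{2,2}$, $i$ does not update and $j$ updates at least once; and in $I^{(\ell)}_{2,3}$, $i$ updates at least twice and $j$ does not update. Let $\tau_0=0$ and, for $s\ge0$, $$\tau_{s+1}=\min\{\ell\ge\tau_s+r:\ \mathcal C^{(\ell)}\text{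 occurs}\},$$ which is almost surely finite. When $\mathcal C^{(\ell)}$ occurs, let $Y_1,Y_2$ be the indicators that $X_i=1$ at the first and the second update of $i$ in $I^{(\ell)}_{2,1}$, let $Y_1',Y_2'$ be the same indicators for $I^{(\ell)}_{2,3}$, and set $Z^{(\ell)}=Y_1Y_2-2Y_1Y_1'+Y_1'Y_2'$. **Theorem.** Let $\delta>0$ and let $M$ be the least integer $\ge 0$ with $$M\ge\frac{2000\log(2n^2/\delta)}{\kappa^2}$$ (if $M=0$, which happens only for $\delta\ge 2n^2$, the average below is read as $0$). Then for every pair $i\ne j$ in $[n]$: 1. If $i\sim j$, then $\displaystyle\Pr\Big(\frac1M\sum_{\ell=1}^{M}Z^{(\tau_\ell)}\le\kappa\Big)\le\frac{\delta}{2n^2}.$ 2. If $i\not\sim j$, then $\displaystyle\Pr\Big(\frac1M\sum_{\ell=1}^{M}Z^{(\tau_\ell)}\ge\kappa\Big)\le\frac{\delta}{2n^2}.$ -/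

import Mathlib

open MeasureTheory ProbabilityTheory Filter
open scoped NNReal

namespace MRF

noncomputable section

/-! ### Functions on the hypercube -/

/-- A point of the hypercube `{-1, 1}ⁿ`; `true` encodes `+1` and `false` encodes `-1`. -/
abbrev Config (n : ℕ) : Type := Fin n → Bool

/-- The numerical value `±1` of a spin. -/
def spin (b : Bool) : ℝ := if b then 1 else -1

/-- The monomial `x^S = ∏_{i ∈ S} x_i`. -/
def monomial {n : ℕ} (S : Finset (Fin n)) (x : Config n) : ℝ := ∏ i ∈ S, spin (x i)

/-- The coefficient of `x^S` in the multilinear expansion of `f`, which is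
`2⁻ⁿ ∑_x f(x) x^S`. -/
def coeff {n : ℕ} (f : Config n → ℝ) (S : Finset (Fin n)) : ℝ :=
  (2 ^ n : ℝ)⁻¹ * ∑ x : Config n, f x * monomial S x

/-- The `i`-th partial derivative of the multilinear expansion of `f`. -/
def partialDeriv {n : ℕ} (i : Fin n) (f : Config n → ℝ) (x : Config n) : ℝ :=
  ∑ S : Finset (Fin n) with i ∈ S, coeff f S * monomial (S.erase i) x

open Classical in
/-- The set of variables that appear in the multilinear expansion of `f`. -/
def support {n : ℕ} (f : Config n → ℝ) : Finset (Fin n) :=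
  Finset.univ.filter fun i => ∃ S : Finset (Fin n), i ∈ S ∧ coeff f S ≠ 0

/-- The Fourier `1`-norm. -/
def fourierNormOne {n : ℕ} (f : Config n → ℝ) : ℝ := ∑ S : Finset (Fin n), |coeff f S|

/-- `S` is a maximal monomial of `f`. -/
def IsMaximalMonomial {n : ℕ} (f : Config n → ℝ) (S : Finset (Fin n)) : Prop :=
  coeff f S ≠ 0 ∧ ∀ T : Finset (Fin n), S ⊂ T → coeff f T = 0

/-- `i ∼ j`: the partial derivative `∂_i ψ` depends on `x_j`. -/
def Adj {n : ℕ} (ψ : Config n → ℝ) (i j : Fin n) : Prop := j ∈ support (partialDeriv i ψ)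

/-- The Hamiltonian `ψ` defines a `(k, d, α, λ)`-Markov random field `μ(x) ∝ exp (ψ x)`. -/
structure IsMRF {n : ℕ} (ψ : Config n → ℝ) (k d : ℕ) (α lam : ℝ) : Prop where
  degree_le : ∀ S : Finset (Fin n), coeff ψ S ≠ 0 → S.card ≤ k
  junta : ∀ i : Fin n, (support (partialDeriv i ψ)).card ≤ d
  nontrivial_edges : ∀ i j : Fin n, Adj ψ i j →
    ∃ S : Finset (Fin n), IsMaximalMonomial ψ S ∧ i ∈ S ∧ j ∈ S ∧ α ≤ |coeff ψ S|
  width_le : ∀ i : Fin n, fourierNormOne (partialDeriv i ψ) ≤ lam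

/-! ### Continuous-time Glauber dynamics -/

/-- The number of terms of the sequence of times `t` that lie in `I`. -/
def updateCount (t : ℕ → ℝ) (I : Set ℝ) : ℕ := Set.ncard {m : ℕ | t m ∈ I}

/-- The points `T 0 < T 1 < ⋯` form a Poisson process of rate `1` on the half-line: they are
positive, increase to infinity, and the associated counting process has independent Poisson
increments. -/
structure IsPoissonProcess {Ω : Type*} [MeasurableSpace Ω] (P : Measure Ω)
    (T : ℕ → Ω → ℝ) : Prop where
  measurable : ∀ m, Measurable (T m)
  pos : ∀ᵐ ω ∂P, ∀ m, 0 < T m ω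
  strictMono : ∀ᵐ ω ∂P, StrictMono fun m => T m ω
  tendsto : ∀ᵐ ω ∂P, Tendsto (fun m => T m ω) atTop atTop
  indep_increments :
    HasIndepIncrements (fun (t : ℝ≥0) ω => updateCount (fun m => T m ω) (Set.Icc 0 (t : ℝ))) P
  law_increment : ∀ s t : ℝ≥0, s ≤ t →
    HasLaw (fun ω => updateCount (fun m => T m ω) (Set.Ioc (s : ℝ) t)) (poissonMeasure (t - s)) P

/-- The information available just before the `m`-th update of site `i` is resampled: the initial
configuration, all the update times (the clocks are exogenous), and the values taken at all the
updates that happened strictly earlier. As a site only changes at its own updates, this determines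
the trajectory before the update. -/
abbrev past {n : ℕ} {Ω : Type*} (X : ℝ → Ω → Config n) (T : Fin n → ℕ → Ω → ℝ)
    (i : Fin n) (m : ℕ) : MeasurableSpace Ω :=
  MeasurableSpace.comap (X 0) inferInstance ⊔
  MeasurableSpace.comap (fun ω (j : Fin n) (l : ℕ) => T j l ω) inferInstance ⊔
  MeasurableSpace.comap (fun ω (j : Fin n) (l : ℕ) =>
    if T j l ω < T i m ω then spin (X (T j l ω) ω j) else 0) inferInstance

/-- `(X t)_{t ≥ 0}` is the continuous-time Glauber dynamics of the Hamiltonian `ψ`, and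
`T i 0 < T i 1 < ⋯` are the update times of site `i`. The update times form independent Poisson
processes of rate `1`, independent of the (arbitrary, possibly random) initial configuration; a
site keeps its value between its updates; and when site `i` updates it becomes `+1` with conditional
probability `σ (2 ∂_i ψ)`, evaluated at the current values of the other sites
(`∂_i ψ` does not depend on the `i`-th coordinate). Only times `t ≥ 0` matter. -/
structure IsGlauberDynamics {n : ℕ} {Ω : Type*} [MeasurableSpace Ω] (P : Measure Ω)
    (ψ : Config n → ℝ) (X : ℝ → Ω → Config n) (T : Fin n → ℕ → Ω → ℝ) : Prop where
  measurable : Measurable fun p : ℝ × Ω => X p.1 p.2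
  poisson : ∀ i, IsPoissonProcess P (T i)
  indep_clocks : iIndepFun (fun (i : Fin n) ω (m : ℕ) => T i m ω) P
  indep_init : IndepFun (X 0) (fun ω (i : Fin n) (m : ℕ) => T i m ω) P
  const_between : ∀ᵐ ω ∂P, ∀ (i : Fin n) (s t : ℝ), 0 ≤ s → s ≤ t →
    (∀ m, T i m ω ∉ Set.Ioc s t) → X t ω i = X s ω i
  update_law : ∀ (i : Fin n) (m : ℕ),
    P[Set.indicator {ω | X (T i m ω) ω i = true} (fun _ => (1 : ℝ)) | past X T i m]
      =ᵐ[P] fun ω => Real.sigmoid (2 * partialDeriv i ψ (X (T i m ω) ω))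

/-! ### Windows, stopping times and the statistic -/

/-- The left end point `(ℓ + r - 1) L` of the last length-`L` block of the window
`[ℓ L, (ℓ + r) L]`. -/
def blockStart (L : ℝ) (r l : ℕ) : ℝ := ((l : ℝ) + r - 1) * L

/-- The first third of the last block. -/
def firstThird (L : ℝ) (r l : ℕ) : Set ℝ :=
  Set.Icc (blockStart L r l) (blockStart L r l + L / 3)

/-- The middle third of the last block. -/
def middleThird (L : ℝ) (r l : ℕ) : Set ℝ :=
  Set.Icc (blockStart L r l + L / 3) (blockStart L r l + 2 * L / 3)

/-- The last third of the last block. -/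
def lastThird (L : ℝ) (r l : ℕ) : Set ℝ :=
  Set.Icc (blockStart L r l + 2 * L / 3) (blockStart L r l + L)

/-- The event `𝒞^(ℓ)` for the update times `ti` and `tj` of the sites `i` and `j`: in the first
third `i` updates at least twice and `j` does not, in the middle third `i` does not update and
`j` does, in the last third `i` updates at least twice and `j` does not. -/
def GoodWindow (L : ℝ) (r : ℕ) (ti tj : ℕ → ℝ) (l : ℕ) : Prop :=
  (2 ≤ updateCount ti (firstThird L r l) ∧ ∀ m, tj m ∉ firstThird L r l) ∧
  ((∀ m, ti m ∉ middleThird L r l) ∧ 1 ≤ updateCount tj (middleThird L r l)) ∧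
  (2 ≤ updateCount ti (lastThird L r l) ∧ ∀ m, tj m ∉ lastThird L r l)

/-- The stopping times: `τ_{s+1}` is the first `ℓ ≥ τ_s + r` such that `𝒞^(ℓ)` occurs, where
`τ_0 = 0`. Almost surely the minimum is over a non-empty set. -/
def tau (L : ℝ) (r : ℕ) (ti tj : ℕ → ℝ) : ℕ → ℕ
  | 0 => 0
  | s + 1 => sInf {l : ℕ | tau L r ti tj s + r ≤ l ∧ GoodWindow L r ti tj l}

/-- The indicator that the trajectory `x` of a site with update times `t` has value `+1` at the
`a`-th of its updates in `I`, where `a = 0` is the first one. -/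
def updateIndicator (x : ℝ → Bool) (t : ℕ → ℝ) (I : Set ℝ) (a : ℕ) : ℝ :=
  if x (t (Nat.nth (fun m => t m ∈ I) a)) then 1 else 0

/-- The statistic `Z^(ℓ) = Y₁ Y₂ - 2 Y₁ Y₁' + Y₁' Y₂'` for the trajectory `x` of site `i` with
update times `ti`: `Y₁, Y₂` belong to its first two updates in the first third, and `Y₁', Y₂'` to
its first two updates in the last third. -/
def statZ (L : ℝ) (r : ℕ) (x : ℝ → Bool) (ti : ℕ → ℝ) (l : ℕ) : ℝ :=
  updateIndicator x ti (firstThird L r l) 0 * updateIndicator x ti (firstThird L r l) 1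
    - 2 * updateIndicator x ti (firstThird L r l) 0 * updateIndicator x ti (lastThird L r l) 0
    + updateIndicator x ti (lastThird L r l) 0 * updateIndicator x ti (lastThird L r l) 1

/-! ### Parameters -/

/-- `q = (1/2) (exp (-2λ) / (2d)) ^ (k - 2)`, with an integer exponent. -/
def qParam (k d : ℕ) (lam : ℝ) : ℝ :=
  1 / 2 * (Real.exp (-2 * lam) / (2 * d)) ^ ((k : ℤ) - 2)

/-- The block length `L = α² q exp (-6λ) / (64 d)`. -/
def blockLength (k d : ℕ) (α lam : ℝ) : ℝ :=
  α ^ 2 * qParam k d lam * Real.exp (-6 * lam) / (64 * d)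

/-- The number of blocks `r = ⌈log (2 max {1, 2 (k - 2)}) / L⌉`. -/
def numBlocks (k d : ℕ) (α lam : ℝ) : ℕ :=
  ⌈Real.log (2 * max 1 (2 * ((k : ℝ) - 2))) / blockLength k d α lam⌉₊

/-- The threshold `κ = (5 α² q / 64) exp (-6λ)`. -/
def kappa (k d : ℕ) (α lam : ℝ) : ℝ :=
  5 * α ^ 2 * qParam k d lam / 64 * Real.exp (-6 * lam)

/-- The number of samples `M = 2000 log (2 n² / δ) / κ²`, rounded up to a natural number. -/
def numSamples (n k d : ℕ) (α lam δ : ℝ) : ℕ :=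
  ⌈2000 * Real.log (2 * (n : ℝ) ^ 2 / δ) / kappa k d α lam ^ 2⌉₊

/-- The average `(1/M) ∑_{s=1}^{M} Z^(τ_s)` of the statistic of the pair `(i, j)` for a trajectory
`x` with update times `t`. -/
def averageZ {n : ℕ} (L : ℝ) (r M : ℕ) (x : ℝ → Config n) (t : Fin n → ℕ → ℝ)
    (i j : Fin n) : ℝ :=
  1 / (M : ℝ) * ∑ s ∈ Finset.Icc 1 M,
    statZ L r (fun u => x u i) (t i) (tau L r (t i) (t j) s)

end

end MRF

namespace MRF

noncomputable section

section

/-! ### Fourier analysis on the hypercube -/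

/-! Condition on all the update times. The history is then an inhomogeneous chain with deterministic
update times (`IsGlauberLaw`), and only two questions remain: what mean `Z` has in a good block
beginning at `b`, and how the sum of the `Z` concentrates.

Mean without influence. If no site on which `∂_i ψ` depends updates in the block, all updates of `i`
there are conditionally independent with one common probability `ρ` known at time `b`. Each product
in `Z` has mean `ρ²`, and `1 - 2 + 1 = 0`.

Mean with influence. Suppose that only `i` and `j` move among the sites relevant to either of them.
Let `φ(c)` be the probability of `+1` at `i` when `x_j = c`, the other sites being as at time `b`.
The updates of `i` in the first third have probability `ρ = φ(x_j)`, those in the last third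
`φ(Y_j)`, where `Y_j` is the last value taken by `j` in the middle third. The second update of `i`
in the first third is essential: `j` sees only the last update of `i`, which is not the one recorded
by `Y₁`, so `Y₁` is conditionally independent of `Y_j`. Hence the mean of `Z` is that of `(ρ -
φ(Y_j))²`. As `Y_j` differs from the old value of `j` with probability at least `c = exp(-2λ)/2`,
this is at least `c (φ(1) - φ(-1))²` (`GoodBlock.le_integral_mul_blockStat`).

Large influence. For a maximal monomial `S` containing `i` and `j`, some values on `R = S \ {i, j}`
make `∂_i ψ` change by at least `2α` when `x_j` flips (`exists_flipOn_large_difference`). If in `(b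
- σ, b]` all sites of `R` update and the other relevant ones do not, these values are reached with
probability at least `c^|R|`. The choice `1 - exp(-σ) = 1/d` makes this clock event have probability
at least `d^(-|R|)/3`. Altogether this contributes at least `4κ`. Interfering updates inside a block
cost at most `3 · 2d · L = 6κ/5` if `i ∼ j`, and at most `d L = κ/5` otherwise, so the means are
separated from `κ` by at least `4κ/5`.

Concentration. Given the clocks, a supermartingale argument bounds the exponential moment of the sum
of the `Z` by that of their conditional lower bounds (`integral_exp_neg_mul_sum_le`). These bounds
depend only on the clocks of the sites other than `i` and `j` in windows whose positions depend only
on the clocks of `i` and `j`. With the latter frozen, the windows are deterministic and disjoint,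
the gap `r` leaving room for `σ`, and the bounds are independent
(`IndepPoissonClocks.integral_exp_windowStat_blockTimes_le`). A Chernoff bound with `θ = κ/40`
finishes the proof. -/

lemma spin_mul_self (b : Bool) : spin b * spin b = 1 := by cases b <;> simp [spin]

lemma spin_not (b : Bool) : spin (!b) = -spin b := by cases b <;> simp [spin]

lemma abs_spin (b : Bool) : |spin b| = 1 := by cases b <;> simp [spin]

lemma abs_monomial {n : ℕ} (S : Finset (Fin n)) (x : Config n) : |monomial S x| = 1 := by
  simp [monomial, Finset.abs_prod, abs_spin]

lemma monomial_eq_prod_univ {n : ℕ} (S : Finset (Fin n)) (x : Config n) :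
    monomial S x = ∏ i, if i ∈ S then spin (x i) else 1 := by
  simp [monomial, Finset.prod_ite_mem]

lemma monomial_congr {n : ℕ} {S : Finset (Fin n)} {x y : Config n}
    (h : ∀ i ∈ S, x i = y i) : monomial S x = monomial S y :=
  Finset.prod_congr rfl fun i hi => by rw [h i hi]

lemma sum_monomial_mul {n : ℕ} (S T : Finset (Fin n)) :
    ∑ x : Config n, monomial S x * monomial T x = if S = T then 2 ^ n else 0 := by
  simp_rw [monomial_eq_prod_univ, ← Finset.prod_mul_distrib]
  have h := Finset.prod_univ_sum (fun _ : Fin n => (Finset.univ : Finset Bool))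
    (fun i b => (if i ∈ S then spin b else 1) * (if i ∈ T then spin b else (1 : ℝ)))
  rw [Fintype.piFinset_univ] at h
  rw [← h]
  split_ifs with hST
  · subst hST
    rw [Finset.prod_congr rfl (g := fun _ => (2 : ℝ))]
    · simp
    · intro i _
      by_cases hi : i ∈ S <;> simp [hi, spin]; norm_num
  · obtain ⟨i, hi⟩ : ∃ i, ¬ (i ∈ S ↔ i ∈ T) := by
      by_contra! hc
      exact hST (Finset.ext hc)
    apply Finset.prod_eq_zero (Finset.mem_univ i)
    by_cases h1 : i ∈ S <;> by_cases h2 : i ∈ T <;> simp_all [spin]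

lemma sum_monomial_mul_monomial {n : ℕ} (x y : Config n) :
    ∑ S : Finset (Fin n), monomial S x * monomial S y = if x = y then 2 ^ n else 0 := by
  have h : ∀ S : Finset (Fin n), monomial S x * monomial S y = ∏ i ∈ S, spin (x i) * spin (y i) :=
    fun S => by simp [monomial, Finset.prod_mul_distrib]
  simp_rw [h]
  rw [← Finset.powerset_univ, ← Finset.prod_one_add]
  split_ifs with hxy
  · subst hxy
    simp [spin_mul_self]
    norm_num
  · obtain ⟨i, hi⟩ := Function.ne_iff.1 hxy
    apply Finset.prod_eq_zero (Finset.mem_univ i)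
    cases hx : x i <;> cases hy : y i <;> simp_all [spin]

/-- The multilinear expansion. -/
lemma eq_sum_coeff {n : ℕ} (f : Config n → ℝ) (x : Config n) :
    f x = ∑ S, coeff f S * monomial S x := by
  simp_rw [coeff, Finset.mul_sum, Finset.sum_mul]
  rw [Finset.sum_comm]
  have h : ∀ y : Config n, ∑ S : Finset (Fin n), (2 ^ n : ℝ)⁻¹ * (f y * monomial S y) * monomial S x
      = (2 ^ n : ℝ)⁻¹ * f y * if y = x then 2 ^ n else 0 := fun y => by
    rw [← sum_monomial_mul_monomial, Finset.mul_sum]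
    exact Finset.sum_congr rfl fun S _ => by ring
  rw [Finset.sum_congr rfl fun y _ => h y]
  simp only [mul_ite, mul_zero, Finset.sum_ite_eq', Finset.mem_univ, if_true]
  field_simp

lemma coeff_sum_monomial {n : ℕ} (c : Finset (Fin n) → ℝ) (S : Finset (Fin n)) :
    coeff (fun x => ∑ T, c T * monomial T x) S = c S := by
  simp_rw [coeff, Finset.sum_mul]
  rw [Finset.sum_comm]
  simp_rw [mul_assoc, ← Finset.mul_sum, sum_monomial_mul]
  simp only [mul_ite, mul_zero, Finset.sum_ite_eq', Finset.mem_univ, if_true]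
  field_simp

lemma partialDeriv_eq_sum {n : ℕ} (i : Fin n) (f : Config n → ℝ) (x : Config n) :
    partialDeriv i f x =
      ∑ T, (if i ∈ T then 0 else coeff f (insert i T)) * monomial T x := by
  have h : ∀ T : Finset (Fin n), (if i ∈ T then 0 else coeff f (insert i T)) * monomial T x =
      if i ∉ T then coeff f (insert i T) * monomial T x else 0 := fun T => by
    by_cases hT : i ∈ T <;> simp [hT]
  simp_rw [h]
  rw [← Finset.sum_filter, partialDeriv]
  refine Finset.sum_nbij' (fun S => S.erase i) (fun T => insert i T) ?_ ?_ ?_ ?_ ?_ <;>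
    simp +contextual [Finset.insert_erase]

lemma coeff_partialDeriv {n : ℕ} (i : Fin n) (f : Config n → ℝ) (S : Finset (Fin n)) :
    coeff (partialDeriv i f) S = if i ∈ S then 0 else coeff f (insert i S) := by
  rw [← coeff_sum_monomial (fun T => if i ∈ T then 0 else coeff f (insert i T)) S]
  congr 1
  funext x
  exact partialDeriv_eq_sum i f x

lemma mem_support {n : ℕ} {f : Config n → ℝ} {i : Fin n} :
    i ∈ support f ↔ ∃ S : Finset (Fin n), i ∈ S ∧ coeff f S ≠ 0 := by
  simp [support]

lemma eq_of_eq_on_support {n : ℕ} {f : Config n → ℝ} {x y : Config n}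
    (h : ∀ i ∈ support f, x i = y i) : f x = f y := by
  rw [eq_sum_coeff f x, eq_sum_coeff f y]
  refine Finset.sum_congr rfl fun S _ => ?_
  by_cases hS : coeff f S = 0
  · simp [hS]
  · rw [monomial_congr fun i hi => h i (mem_support.2 ⟨S, hi, hS⟩)]

lemma abs_le_fourierNormOne {n : ℕ} (f : Config n → ℝ) (x : Config n) :
    |f x| ≤ fourierNormOne f := by
  rw [eq_sum_coeff f x]
  refine (Finset.abs_sum_le_sum_abs _ _).trans_eq ?_
  simp [fourierNormOne, abs_mul, abs_monomial]

lemma abs_coeff_le_fourierNormOne {n : ℕ} (f : Config n → ℝ) (S : Finset (Fin n)) :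
    |coeff f S| ≤ fourierNormOne f :=
  Finset.single_le_sum (f := fun S => |coeff f S|) (fun _ _ => abs_nonneg _) (Finset.mem_univ S)

lemma notMem_support_partialDeriv_self {n : ℕ} (i : Fin n) (f : Config n → ℝ) :
    i ∉ support (partialDeriv i f) := by
  rw [mem_support]
  rintro ⟨S, hi, hS⟩
  simp [coeff_partialDeriv, hi] at hS

lemma adj_of_coeff_ne_zero {n : ℕ} {f : Config n → ℝ} {i j : Fin n} (hij : i ≠ j)
    {S : Finset (Fin n)} (hi : i ∈ S) (hj : j ∈ S) (hS : coeff f S ≠ 0) : Adj f i j := by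
  rw [Adj, mem_support]
  refine ⟨S.erase i, by simp [hj, hij.symm], ?_⟩
  simpa [coeff_partialDeriv, Finset.insert_erase hi] using hS

lemma sub_update_eq_sum {n : ℕ} (f : Config n → ℝ) (j : Fin n) (x : Config n) :
    f (Function.update x j true) - f (Function.update x j false) =
      2 * ∑ T with j ∈ T, coeff f T * monomial (T.erase j) x := by
  rw [eq_sum_coeff f (Function.update x j true), eq_sum_coeff f (Function.update x j false),
    ← Finset.sum_sub_distrib, Finset.sum_filter, Finset.mul_sum]
  refine Finset.sum_congr rfl fun T _ => ?_
  split_ifs with hj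
  · have h : ∀ b, monomial T (Function.update x j b) = spin b * monomial (T.erase j) x := fun b => by
      rw [monomial, ← Finset.mul_prod_erase T _ hj, Function.update_self]
      congr 1
      exact monomial_congr fun v hv => Function.update_of_ne (Finset.ne_of_mem_erase hv) _ _
    simp only [h, spin, if_true, Bool.false_eq_true, if_false]
    ring
  · have h : ∀ b, monomial T (Function.update x j b) = monomial T x := fun b =>
      monomial_congr fun v hv => Function.update_of_ne (ne_of_mem_of_not_mem hv hj) _ _
    simp [h]

/-- Flipping the coordinates in `A`. -/
def flipOn {n : ℕ} (A : Finset (Fin n)) (x : Config n) : Config n :=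
  fun v => if v ∈ A then !x v else x v

lemma monomial_flipOn {n : ℕ} (A T : Finset (Fin n)) (x : Config n) :
    monomial T (flipOn A x) = monomial T x * ∏ v ∈ A, if v ∈ T then -1 else 1 := by
  have h : ∏ v ∈ A, (if v ∈ T then (-1 : ℝ) else 1) = ∏ v ∈ T, if v ∈ A then -1 else 1 := by
    rw [Finset.prod_ite_mem, Finset.prod_ite_mem, Finset.inter_comm]
  rw [h, monomial, monomial, ← Finset.prod_mul_distrib]
  refine Finset.prod_congr rfl fun v _ => ?_
  by_cases hv : v ∈ A <;> simp [flipOn, hv, spin_not]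

/-- A top coefficient on `S` forces a large difference in direction `j` after flipping suitable
coordinates of `S`. -/
lemma exists_flipOn_large_difference {n : ℕ} (f : Config n → ℝ) {S : Finset (Fin n)} {j : Fin n}
    (hj : j ∈ S) (htop : ∀ T, S ⊂ T → coeff f T = 0) (z : Config n) :
    ∃ A ⊆ S.erase j, 2 * |coeff f S| ≤ |f (Function.update (flipOn A z) j true) -
      f (Function.update (flipOn A z) j false)| := by
  set R := S.erase j with hR
  -- The alternating sum over flips of subsets of `R` is a mixed discrete derivative along all of
  -- `S`. It kills every monomial not containing `S`, and maximality kills the strict supersets.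
  have key : ∑ A ∈ R.powerset, (-1 : ℝ) ^ A.card * (f (Function.update (flipOn A z) j true) -
      f (Function.update (flipOn A z) j false)) =
      2 * (coeff f S * monomial R z * 2 ^ R.card) := by
    simp_rw [sub_update_eq_sum, monomial_flipOn, Finset.mul_sum]
    rw [Finset.sum_comm, Finset.sum_eq_single S]
    · have h : ∀ A ∈ R.powerset, (-1 : ℝ) ^ A.card * (2 * (coeff f S * (monomial (S.erase j) z *
          ∏ v ∈ A, if v ∈ S.erase j then -1 else 1))) = 2 * (coeff f S * monomial R z) := by
        intro A hA
        rw [Finset.prod_congr rfl (g := fun _ => (-1 : ℝ)), Finset.prod_const]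
        · have : (-1 : ℝ) ^ A.card * (-1 : ℝ) ^ A.card = 1 := by rw [← mul_pow]; simp
          linear_combination (2 * (coeff f S * monomial R z)) * this
        · intro v hv
          rw [if_pos (Finset.mem_powerset.1 hA hv)]
      rw [Finset.sum_congr rfl h]
      simp [Finset.card_powerset]
      ring
    · intro T hT hTS
      have hjT : j ∈ T := by simpa using hT
      by_cases hsub : S ⊆ T
      · rw [htop T (hsub.ssubset_of_ne hTS.symm)]
        simp
      · obtain ⟨v, hvS, hvT⟩ := Finset.not_subset.1 hsub
        have hvR : v ∈ R := Finset.mem_erase.2 ⟨fun h => hvT (h ▸ hjT), hvS⟩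
        -- The signed sum over `A` factors over the sites of `R`. A site `v` outside `T` has `x^T`
        -- unchanged under its flip, so its factor is `1 - 1`.
        have h0 : ∏ v ∈ R, (1 + if v ∈ T.erase j then (1 : ℝ) else -1) = 0 :=
          Finset.prod_eq_zero hvR (by simp [hvT])
        rw [Finset.prod_one_add] at h0
        calc _ = ∑ A ∈ R.powerset, (2 * (coeff f T * monomial (T.erase j) z)) *
              ∏ v ∈ A, (if v ∈ T.erase j then (1 : ℝ) else -1) := by
              refine Finset.sum_congr rfl fun A _ => ?_
              rw [← Finset.prod_const (-1 : ℝ)]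
              have : (∏ v ∈ A, (-1 : ℝ)) * ∏ v ∈ A, (if v ∈ T.erase j then (-1 : ℝ) else 1) =
                  ∏ v ∈ A, (if v ∈ T.erase j then (1 : ℝ) else -1) := by
                rw [← Finset.prod_mul_distrib]
                exact Finset.prod_congr rfl fun v _ => by split_ifs <;> simp
              rw [← this]; ring
          _ = 0 := by rw [← Finset.mul_sum, h0, mul_zero]
    · intro hS
      simp [hj] at hS
  -- The identity says that a signed average of the differences has absolute value `2 |coeff f S|`,
  -- so they cannot all be smaller.
  by_contra! hlt
  have h1 := congrArg abs key
  have h2 : |2 * (coeff f S * monomial R z * 2 ^ R.card)| = 2 ^ R.card * (2 * |coeff f S|) := by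
    simp [abs_mul, abs_monomial]; ring
  have h3 : |∑ A ∈ R.powerset, (-1 : ℝ) ^ A.card * (f (Function.update (flipOn A z) j true) -
      f (Function.update (flipOn A z) j false))| < ∑ A ∈ R.powerset, 2 * |coeff f S| := by
    refine (Finset.abs_sum_le_sum_abs _ _).trans_lt
      (Finset.sum_lt_sum_of_nonempty (Finset.powerset_nonempty R) fun A hA => ?_)
    rw [abs_mul, abs_pow]
    simpa using hlt A (Finset.mem_powerset.1 hA)
  rw [h1, h2, Finset.sum_const, Finset.card_powerset, nsmul_eq_mul] at h3
  push_cast at h3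
  exact lt_irrefl _ h3

/-! ### The logistic function -/

/-- Monotonicity reduces to `z = -B`, where `σ(-B) = σ(B) exp(-B)` and `σ(B) ≥ 1/2`. -/
lemma exp_neg_div_two_le_sigmoid {B z : ℝ} (hB : 0 ≤ B) (hz : |z| ≤ B) :
    Real.exp (-B) / 2 ≤ Real.sigmoid z := by
  have h1 : Real.sigmoid (-B) ≤ Real.sigmoid z := Real.sigmoid_le (abs_le.1 hz).1
  refine le_trans ?_ h1
  rw [← Real.sigmoid_mul_rexp_neg]
  have h2 : (2 : ℝ)⁻¹ ≤ Real.sigmoid B := by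
    rw [← Real.sigmoid_zero]; exact Real.sigmoid_le hB
  have := Real.exp_pos (-B)
  nlinarith

lemma sigmoid_le_one_sub {B z : ℝ} (hB : 0 ≤ B) (hz : |z| ≤ B) :
    Real.sigmoid z ≤ 1 - Real.exp (-B) / 2 := by
  have := exp_neg_div_two_le_sigmoid hB (z := -z) (by simpa using hz)
  rw [Real.sigmoid_neg] at this
  linarith

lemma exp_neg_div_four_le_sigmoid_mul {B z : ℝ} (hz : |z| ≤ B) :
    Real.exp (-B) / 4 ≤ Real.sigmoid z * (1 - Real.sigmoid z) := by
  have h : ∀ w, 0 ≤ w → w ≤ B → Real.exp (-B) / 4 ≤ Real.sigmoid w * (1 - Real.sigmoid w) := by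
    intro w h0 hw
    rw [← Real.sigmoid_neg, ← Real.sigmoid_mul_rexp_neg]
    have h2 : (2 : ℝ)⁻¹ ≤ Real.sigmoid w := by
      rw [← Real.sigmoid_zero]; exact Real.sigmoid_le h0
    have h3 : Real.exp (-B) ≤ Real.exp (-w) := Real.exp_le_exp.2 (by linarith)
    have h4 := Real.exp_pos (-B)
    have h5 : (1 / 4 : ℝ) ≤ Real.sigmoid w * Real.sigmoid w := by nlinarith
    nlinarith
  rcases le_total 0 z with h0 | h0
  · exact h z h0 ((le_abs_self z).trans hz)
  · have := h (-z) (by linarith) ((neg_le_abs z).trans hz)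
    rw [Real.sigmoid_neg] at this
    linarith

/-- Mean value inequality: the derivative `σ(1 - σ)` is at least `exp(-B)/4` on `[-B, B]`. This
turns a change of `∂_i ψ` into a change of update probability. -/
lemma mul_abs_sub_le_abs_sigmoid_sub {B a b : ℝ} (ha : |a| ≤ B) (hb : |b| ≤ B) :
    Real.exp (-B) / 4 * |a - b| ≤ |Real.sigmoid a - Real.sigmoid b| := by
  wlog hab : b ≤ a generalizing a b
  · rw [abs_sub_comm a, abs_sub_comm (Real.sigmoid a)]
    exact this hb ha (le_of_not_ge hab)
  have h := (convex_Icc (-B) B).mul_sub_le_image_sub_of_le_deriv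
    (f := Real.sigmoid) (C := Real.exp (-B) / 4) continuous_sigmoid.continuousOn
    differentiable_sigmoid.differentiableOn (fun x hx => by
      rw [Real.deriv_sigmoid]
      exact exp_neg_div_four_le_sigmoid_mul (abs_le.2 (Set.mem_Icc.1 (interior_subset hx))))
    b (abs_le.1 hb) a (abs_le.1 ha) hab
  rw [abs_of_nonneg (by linarith : 0 ≤ a - b)]
  exact h.trans (le_abs_self _)

end

section

/-! ### Deterministic update times -/

/-- The update times of all sites. -/
abbrev Clocks (n : ℕ) : Type := Fin n → ℕ → ℝ

/-- An initial configuration and the values taken at all the updates. -/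
abbrev History (n : ℕ) : Type := Config n × (Fin n → ℕ → Bool)

/-- The number of update times up to time `u`, for times that increase to infinity. -/
def numUpdates (t : ℕ → ℝ) (u : ℝ) : ℕ := sInf {l | u < t l}

/-- The configuration at time `u`. -/
def state {n : ℕ} (t : Clocks n) (y : History n) (u : ℝ) : Config n := fun j =>
  if numUpdates (t j) u = 0 then y.1 j else y.2 j (numUpdates (t j) u - 1)

/-- Update times that increase to infinity, different for different sites. -/
structure Regular {n : ℕ} (t : Clocks n) : Prop where
  strictMono : ∀ v, StrictMono (t v)
  tendsto : ∀ v, Tendsto (t v) atTop atTop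
  noTies : ∀ v w l m, t v l = t w m → v = w

/-! ### The counting function of a sequence of times -/

section numUpdates

variable {t : ℕ → ℝ} (hm : StrictMono t) (ht : Tendsto t atTop atTop)

include hm ht in
-- The indices of the times up to `u` form an initial segment of `ℕ`. Through this equivalence,
-- statements about update patterns become linear arithmetic on counts.
lemma lt_numUpdates {u : ℝ} {l : ℕ} : l < numUpdates t u ↔ t l ≤ u := by
  have hne : {l | u < t l}.Nonempty := (ht.eventually_gt_atTop u).exists
  constructor
  · intro h
    by_contra! hlt
    exact absurd (Nat.sInf_le (s := {l | u < t l}) hlt) (not_le.2 h)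
  · intro h
    by_contra! hle
    have h1 : u < t (numUpdates t u) := Nat.sInf_mem hne
    exact absurd (h1.trans_le (hm.monotone hle)) (not_lt.2 h)

include hm ht in
lemma numUpdates_le {u : ℝ} {l : ℕ} : numUpdates t u ≤ l ↔ u < t l := by
  rw [← not_lt, lt_numUpdates hm ht, not_le]

include hm ht in
lemma numUpdates_mono : Monotone (numUpdates t) := fun u w huw => by
  rw [numUpdates_le hm ht]
  exact huw.trans_lt ((numUpdates_le hm ht).1 le_rfl)

include hm ht in
include hm ht in
lemma updateCount_Ioc (u w : ℝ) :
    updateCount t (Set.Ioc u w) = numUpdates t w - numUpdates t u := by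
  have : {m | t m ∈ Set.Ioc u w} = Finset.Ico (numUpdates t u) (numUpdates t w) := by
    ext m
    simp [numUpdates_le hm ht, lt_numUpdates hm ht]
  rw [updateCount, this, Set.ncard_coe_finset, Nat.card_Ico]

end numUpdates

variable {n : ℕ} {t : Clocks n}

namespace Regular

variable (h : Regular t)

include h in
lemma lt_numUpdates {v : Fin n} {u : ℝ} {l : ℕ} : l < numUpdates (t v) u ↔ t v l ≤ u :=
  MRF.lt_numUpdates (h.strictMono v) (h.tendsto v)

include h in
lemma numUpdates_le {v : Fin n} {u : ℝ} {l : ℕ} : numUpdates (t v) u ≤ l ↔ u < t v l :=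
  MRF.numUpdates_le (h.strictMono v) (h.tendsto v)

include h in
lemma numUpdates_mono (v : Fin n) : Monotone (numUpdates (t v)) :=
  MRF.numUpdates_mono (h.strictMono v) (h.tendsto v)

include h in
include h in
lemma numUpdates_eq_of_mem {v : Fin n} {a b u : ℝ} (hab : numUpdates (t v) a = numUpdates (t v) b)
    (hau : a ≤ u) (hub : u ≤ b) : numUpdates (t v) u = numUpdates (t v) a :=
  le_antisymm (hab ▸ h.numUpdates_mono v hub) (h.numUpdates_mono v hau)

end Regular

lemma state_congr {y : History n} {u w : ℝ} {v : Fin n}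
    (h : numUpdates (t v) u = numUpdates (t v) w) : state t y u v = state t y w v := by
  simp [state, h]

lemma state_eq_value {y : History n} {u : ℝ} {v : Fin n} {m : ℕ}
    (h : numUpdates (t v) u = m + 1) : state t y u v = y.2 v m := by
  simp [state, h]

/-- `F` depends on the initial configuration and the values at the updates before time `u` only. -/
def Before {β : Type*} (t : Clocks n) (u : ℝ) (F : History n → β) : Prop :=
  ∀ y y' : History n, y.1 = y'.1 → (∀ j l, t j l < u → y.2 j l = y'.2 j l) → F y = F y'

/-! ### Calculus of functions determined before a given time -/

namespace Before

variable {β γ δ : Type*} {u w : ℝ}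

lemma mono {F : History n → β} (h : Before t u F) (huw : u ≤ w) : Before t w F :=
  fun y y' h0 h1 => h y y' h0 fun j l hl => h1 j l (hl.trans_le huw)

lemma const (c : β) : Before t u fun _ => c := fun _ _ _ _ => rfl

lemma comp {F : History n → β} (h : Before t u F) (g : β → γ) : Before t u fun y => g (F y) :=
  fun y y' h0 h1 => congrArg g (h y y' h0 h1)

lemma comp₂ {F : History n → β} {G : History n → γ} (hF : Before t u F) (hG : Before t u G)
    (g : β → γ → δ) : Before t u fun y => g (F y) (G y) :=
  fun y y' h0 h1 => by simp only [hF y y' h0 h1, hG y y' h0 h1]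

lemma mul {F G : History n → ℝ} (hF : Before t u F) (hG : Before t u G) :
    Before t u fun y => F y * G y := hF.comp₂ hG (· * ·)

lemma add {F G : History n → ℝ} (hF : Before t u F) (hG : Before t u G) :
    Before t u fun y => F y + G y := hF.comp₂ hG (· + ·)

lemma sub {F G : History n → ℝ} (hF : Before t u F) (hG : Before t u G) :
    Before t u fun y => F y - G y := hF.comp₂ hG (· - ·)

lemma prod {ι : Type*} {s : Finset ι} {F : ι → History n → ℝ} (hF : ∀ k ∈ s, Before t u (F k)) :
    Before t u fun y => ∏ k ∈ s, F k y :=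
  fun y y' h0 h1 => Finset.prod_congr rfl fun k hk => hF k hk y y' h0 h1

lemma sum {ι : Type*} {s : Finset ι} {F : ι → History n → ℝ} (hF : ∀ k ∈ s, Before t u (F k)) :
    Before t u fun y => ∑ k ∈ s, F k y :=
  fun y y' h0 h1 => Finset.sum_congr rfl fun k hk => hF k hk y y' h0 h1

lemma value {v : Fin n} {m : ℕ} (h : t v m < u) : Before t u fun y => y.2 v m :=
  fun _ _ _ h1 => h1 v m h

lemma state (ht : Regular t) (hwu : w < u) : Before t u fun y => MRF.state t y w := by
  intro y y' h0 h1
  funext v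
  unfold MRF.state
  beta_reduce
  split_ifs with hv
  · rw [h0]
  · exact h1 v _ ((ht.lt_numUpdates.1 (Nat.sub_one_lt hv)).trans_lt hwu)

end Before

/-- The configuration with the values at the updates from time `u` on forgotten. -/
def truncate (t : Clocks n) (u : ℝ) (y : History n) : History n :=
  (y.1, fun j l => if t j l < u then y.2 j l else false)

lemma Before.truncate_eq {β : Type*} {u : ℝ} {F : History n → β} (h : Before t u F)
    (y : History n) : F (truncate t u y) = F y :=
  h _ _ rfl fun j l hl => by simp [truncate, hl]

/-- Only finitely many updates precede `u`. Functions determined before `u` therefore take finitely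
many values, which yields their measurability and integrability without further hypotheses. -/
lemma finite_range_truncate (ht : Regular t) (u : ℝ) : (Set.range (truncate t u)).Finite := by
  have hb : ∀ j l, t j l < u → l < numUpdates (t j) u := fun j l h => ht.lt_numUpdates.2 h.le
  let g : Config n × ((j : Fin n) → Fin (numUpdates (t j) u) → Bool) → History n := fun p =>
    (p.1, fun j l => if h : t j l < u then p.2 j ⟨l, hb j l h⟩ else false)
  refine (Set.finite_range g).subset ?_
  rintro _ ⟨y, rfl⟩
  refine ⟨(y.1, fun j l => y.2 j l), ?_⟩
  simp [g, truncate]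

lemma measurable_truncate (u : ℝ) : Measurable (truncate t u) := by
  refine measurable_fst.prodMk ?_
  refine measurable_pi_lambda _ fun j => measurable_pi_lambda _ fun l => ?_
  split_ifs
  · fun_prop
  · exact measurable_const

lemma Before.measurable {u : ℝ} {F : History n → ℝ} (ht : Regular t) (h : Before t u F) :
    Measurable F := by
  have hF : F = F ∘ truncate t u := funext fun y => (h.truncate_eq y).symm
  intro s _
  have : F ⁻¹' s = ⋃ c ∈ (Set.range (truncate t u)) ∩ F ⁻¹' s, truncate t u ⁻¹' {c} := by
    ext y
    simp only [Set.mem_preimage, Set.mem_iUnion, Set.mem_inter_iff, Set.mem_singleton_iff,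
      exists_prop]
    constructor
    · intro hy
      exact ⟨_, ⟨⟨y, rfl⟩, by rwa [h.truncate_eq]⟩, rfl⟩
    · rintro ⟨c, ⟨_, hc⟩, rfl⟩
      rwa [h.truncate_eq] at hc
  rw [this]
  exact ((finite_range_truncate ht u).inter_of_left _).measurableSet_biUnion fun c _ =>
    measurable_truncate u (measurableSet_singleton c)

lemma Before.integrable {u : ℝ} {F : History n → ℝ} (ht : Regular t) (h : Before t u F)
    (μ : Measure (History n)) [IsFiniteMeasure μ] : Integrable F μ := by
  obtain ⟨C, hC⟩ := ((finite_range_truncate ht u).image fun y => ‖F y‖).bddAbove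
  refine Integrable.of_bound (h.measurable ht).aestronglyMeasurable C (ae_of_all _ fun y => ?_)
  rw [← h.truncate_eq y]
  exact hC ⟨_, ⟨y, rfl⟩, rfl⟩

/-! ### The law of the values at the updates for deterministic update times -/

/-- The conditional probability that site `i` takes the value `+1` at an update at time `u`. -/
def updateProb (ψ : Config n → ℝ) (t : Clocks n) (i : Fin n) (u : ℝ) (y : History n) : ℝ :=
  Real.sigmoid (2 * partialDeriv i ψ (state t y u))

/-- Indicator of the value `+1`. -/
def ind (b : Bool) : ℝ := if b then 1 else 0

/-- Under `μ`, the values at the updates are those of the Glauber dynamics with deterministic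
update times `t`. -/
def IsGlauberLaw (ψ : Config n → ℝ) (t : Clocks n) (μ : Measure (History n)) : Prop :=
  ∀ (i : Fin n) (m : ℕ) (F : History n → ℝ), Before t (t i m) F →
    ∫ y, F y * ind (y.2 i m) ∂μ = ∫ y, F y * updateProb ψ t i (t i m) y ∂μ

variable {ψ : Config n → ℝ} {μ : Measure (History n)}

lemma ind_nonneg (b : Bool) : 0 ≤ ind b := by cases b <;> simp [ind]

lemma ind_le_one (b : Bool) : ind b ≤ 1 := by cases b <;> simp [ind]

lemma updateProb_congr {i : Fin n} {u : ℝ} {y : History n} {x : Config n}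
    (h : ∀ v ∈ support (partialDeriv i ψ), state t y u v = x v) :
    updateProb ψ t i u y = Real.sigmoid (2 * partialDeriv i ψ x) := by
  rw [updateProb, eq_of_eq_on_support h]

/-- `state` at an update time already contains the new value of `i`. The probability is nevertheless
determined strictly before, since `∂_i ψ` ignores `x_i` and no other site updates simultaneously. -/
lemma before_updateProb (ht : Regular t) (ψ : Config n → ℝ) (i : Fin n) (m : ℕ) :
    Before t (t i m) (updateProb ψ t i (t i m)) := by
  intro y y' h0 h1
  refine updateProb_congr fun v hv => ?_
  have hvi : v ≠ i := fun h => notMem_support_partialDeriv_self i ψ (h ▸ hv)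
  unfold state
  split_ifs with hv0
  · rw [h0]
  · exact h1 v _ ((ht.lt_numUpdates.1 (Nat.sub_one_lt hv0)).lt_of_ne
      fun h => hvi (ht.noTies _ _ _ _ h))

/-- A function of one bit is affine in its indicator, so the defining identity of `IsGlauberLaw`
averages out any dependence on the value just drawn. -/
lemma IsGlauberLaw.integral_update [IsFiniteMeasure μ] (ht : Regular t) (h : IsGlauberLaw ψ t μ)
    {i : Fin n} {m : ℕ} {G : History n → Bool → ℝ} (hG : ∀ b, Before t (t i m) fun y => G y b) :
    ∫ y, G y (y.2 i m) ∂μ = ∫ y, (updateProb ψ t i (t i m) y * G y true +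
      (1 - updateProb ψ t i (t i m) y) * G y false) ∂μ := by
  have h1 : ∀ y, G y (y.2 i m) = G y false + (G y true - G y false) * ind (y.2 i m) := fun y => by
    cases y.2 i m <;> simp [ind]
  have h2 : ∀ y, updateProb ψ t i (t i m) y * G y true +
      (1 - updateProb ψ t i (t i m) y) * G y false =
      G y false + (G y true - G y false) * updateProb ψ t i (t i m) y := fun y => by ring
  have hd := (hG true).sub (hG false)
  have hm : t i m < t i (m + 1) := ht.strictMono i (Nat.lt_succ_self m)
  have hi1 : Before t (t i (m + 1)) fun y => (G y true - G y false) * ind (y.2 i m) :=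
    (hd.mono hm.le).mul ((Before.value hm).comp ind)
  simp_rw [h1, h2]
  rw [integral_add ((hG false).integrable ht μ) (hi1.integrable ht μ),
    integral_add ((hG false).integrable ht μ)
      ((hd.mul (before_updateProb ht ψ i m)).integrable ht μ), h i m _ hd]

/-- Any prescribed values at finitely many updates have probability at least `c` each. -/
lemma IsGlauberLaw.pow_mul_integral_le [IsFiniteMeasure μ] (ht : Regular t)
    (h : IsGlauberLaw ψ t μ) {c : ℝ} (hc : 0 ≤ c)
    (hlo : ∀ i x, c ≤ Real.sigmoid (2 * partialDeriv i ψ x))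
    (hhi : ∀ i x, Real.sigmoid (2 * partialDeriv i ψ x) ≤ 1 - c)
    (m : Fin n → ℕ) (x : History n → Config n) (Q : Finset (Fin n)) {H : History n → ℝ}
    (hH0 : ∀ y, 0 ≤ H y) (hH : ∀ r ∈ Q, Before t (t r (m r)) H)
    (hx : ∀ r ∈ Q, Before t (t r (m r)) x) :
    c ^ Q.card * ∫ y, H y ∂μ ≤
      ∫ y, H y * ∏ r ∈ Q, (if y.2 r (m r) = x y r then 1 else 0) ∂μ := by
  -- The latest update is removed first: the rest of the product is determined before it, so
  -- averaging over its value costs one factor `c`.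
  induction Q using Finset.induction_on_max_value (fun r => t r (m r)) with
  | empty => simp
  | insert r Q hr hmax ih =>
    have hlt : ∀ v ∈ Q, t v (m v) < t r (m r) := fun v hv =>
      (hmax v hv).lt_of_ne fun he => hr (ht.noTies _ _ _ _ he ▸ hv)
    have hxr := hx r (Finset.mem_insert_self r Q)
    set K : History n → ℝ := fun y => H y * ∏ v ∈ Q, (if y.2 v (m v) = x y v then 1 else 0) with hK
    have hKb : Before t (t r (m r)) K :=
      (hH r (Finset.mem_insert_self r Q)).mul (Before.prod fun v hv =>
        (Before.value (hlt v hv)).comp₂ hxr fun b z => if b = z v then (1 : ℝ) else 0)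
    have hK0 : ∀ y, 0 ≤ K y := fun y =>
      mul_nonneg (hH0 y) (Finset.prod_nonneg fun v _ => by split_ifs <;> norm_num)
    have ih' := ih (fun v hv => hH v (Finset.mem_insert_of_mem hv))
      (fun v hv => hx v (Finset.mem_insert_of_mem hv))
    have hG : ∀ b, Before t (t r (m r)) fun y => K y * (if b = x y r then (1 : ℝ) else 0) := fun b =>
      hKb.mul (hxr.comp fun z => if b = z r then (1 : ℝ) else 0)
    have hp := before_updateProb ht ψ r (m r)
    calc c ^ (insert r Q).card * ∫ y, H y ∂μ = c * (c ^ Q.card * ∫ y, H y ∂μ) := by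
          rw [Finset.card_insert_of_notMem hr]; ring
      _ ≤ c * ∫ y, K y ∂μ := mul_le_mul_of_nonneg_left ih' hc
      _ = ∫ y, c * K y ∂μ := (integral_const_mul _ _).symm
      _ ≤ ∫ y, (updateProb ψ t r (t r (m r)) y * (K y * (if true = x y r then (1 : ℝ) else 0)) +
            (1 - updateProb ψ t r (t r (m r)) y) *
              (K y * (if false = x y r then (1 : ℝ) else 0))) ∂μ := by
          refine integral_mono (((Before.const c).mul hKb).integrable ht μ)
            (((hp.mul (hG true)).add
              (((Before.const 1).sub hp).mul (hG false))).integrable ht μ) fun y => ?_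
          have h1 := hlo r (state t y (t r (m r)))
          have h2 := hhi r (state t y (t r (m r)))
          have h3 := hK0 y
          simp only [updateProb]
          cases x y r <;> simp <;> nlinarith
      _ = ∫ y, K y * (if y.2 r (m r) = x y r then (1 : ℝ) else 0) ∂μ :=
          (h.integral_update ht (G := fun y b => K y * (if b = x y r then (1 : ℝ) else 0)) hG).symm
      _ = _ := by
          refine integral_congr_ae (ae_of_all _ fun y => ?_)
          simp only [hK, Finset.prod_insert hr]
          ring

/-- Two updates of `i` whose probabilities are determined before the first one. -/
lemma IsGlauberLaw.integral_mul_ind_mul_ind [IsFiniteMeasure μ] (ht : Regular t)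
    (h : IsGlauberLaw ψ t μ) {i : Fin n} {m m' : ℕ} (hmm : m < m') {H ρ : History n → ℝ}
    (hH : Before t (t i m) H) (hρ : Before t (t i m) ρ)
    (hρ' : ∀ y, updateProb ψ t i (t i m') y = ρ y) :
    ∫ y, H y * (ind (y.2 i m) * ind (y.2 i m')) ∂μ =
      ∫ y, H y * (updateProb ψ t i (t i m) y * ρ y) ∂μ := by
  have hlt : t i m < t i m' := ht.strictMono i hmm
  -- The later indicator is averaged first. Its probability `ρ` is known before the earlier update,
  -- so it can then serve as part of the weight there.
  have h1 := h i m' (fun y => H y * ind (y.2 i m)) ((hH.mono hlt.le).mul ((Before.value hlt).comp ind))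
  have h2 := h i m (fun y => H y * ρ y) (hH.mul hρ)
  simp only [hρ', mul_assoc, mul_comm] at h1 h2 ⊢
  simp only [mul_left_comm] at h1 h2 ⊢
  rw [h1, h2]

end

section

/-! ### One block -/

/-- The update pattern of `i` and `j` in the block `(b, b + L]`. -/
structure GoodBlock (ti tj : ℕ → ℝ) (L b : ℝ) : Prop where
  first_i : numUpdates ti b + 2 ≤ numUpdates ti (b + L / 3)
  middle_i : numUpdates ti (b + L / 3) = numUpdates ti (b + 2 * L / 3)
  last_i : numUpdates ti (b + 2 * L / 3) + 2 ≤ numUpdates ti (b + L)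
  first_j : numUpdates tj b = numUpdates tj (b + L / 3)
  middle_j : numUpdates tj (b + L / 3) < numUpdates tj (b + 2 * L / 3)
  last_j : numUpdates tj (b + 2 * L / 3) = numUpdates tj (b + L)

/-- The statistic for the values `v` of a site, with pairs of updates starting at `a` and `a'`. -/
def pairStat (v : ℕ → Bool) (a a' : ℕ) : ℝ :=
  ind (v a) * ind (v (a + 1)) - 2 * ind (v a) * ind (v a') + ind (v a') * ind (v (a' + 1))

lemma pairStat_le_one (v : ℕ → Bool) (a a' : ℕ) : pairStat v a a' ≤ 1 := by
  unfold pairStat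
  cases v a <;> cases v (a + 1) <;> cases v a' <;> cases v (a' + 1) <;> simp [ind]
  all_goals norm_num

lemma neg_two_le_pairStat (v : ℕ → Bool) (a a' : ℕ) : -2 ≤ pairStat v a a' := by
  unfold pairStat
  cases v a <;> cases v (a + 1) <;> cases v a' <;> cases v (a' + 1) <;> simp [ind]
  all_goals norm_num

variable {n : ℕ} {t : Clocks n} {ψ : Config n → ℝ} {μ : Measure (History n)} [IsFiniteMeasure μ]

/-- `F` depends on the initial configuration and the values at the updates up to time `u` only. -/
def UpTo {β : Type*} (t : Clocks n) (u : ℝ) (F : History n → β) : Prop := ∀ w, u < w → Before t w F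

omit [IsFiniteMeasure μ] in
lemma UpTo.mono {β : Type*} {u w : ℝ} {F : History n → β} (h : UpTo t u F) (huw : u ≤ w) :
    UpTo t w F := fun v hv => h v (huw.trans_lt hv)

omit [IsFiniteMeasure μ] in
lemma UpTo.integrable {u : ℝ} {F : History n → ℝ} (ht : Regular t) (h : UpTo t u F)
    (μ : Measure (History n)) [IsFiniteMeasure μ] : Integrable F μ :=
  (h (u + 1) (by linarith)).integrable ht μ

/-- The statistic of site `i` in the block `(b, b + L]`. -/
def blockStat (t : Clocks n) (i : Fin n) (L b : ℝ) (y : History n) : ℝ :=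
  pairStat (y.2 i) (numUpdates (t i) b) (numUpdates (t i) (b + 2 * L / 3))

lemma GoodBlock.upTo_blockStat (ht : Regular t) {i j : Fin n} {L b : ℝ} (hL : 0 < L)
    (h : GoodBlock (t i) (t j) L b) : UpTo t (b + L) (blockStat t i L b) := by
  intro w hw
  have h1 : numUpdates (t i) (b + L / 3) ≤ numUpdates (t i) (b + L) :=
    ht.numUpdates_mono i (by linarith)
  have hv : ∀ m, m < numUpdates (t i) (b + L) → Before t w fun y => ind (y.2 i m) := fun m hm =>
    (Before.value ((ht.lt_numUpdates.1 hm).trans_lt hw)).comp ind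
  have ha := hv (numUpdates (t i) b) (by have := h.first_i; omega)
  have ha1 := hv (numUpdates (t i) b + 1) (by have := h.first_i; omega)
  have hb := hv (numUpdates (t i) (b + 2 * L / 3)) (by have := h.last_i; omega)
  have hb1 := hv (numUpdates (t i) (b + 2 * L / 3) + 1) (by have := h.last_i; omega)
  exact ((ha.mul ha1).sub (((Before.const 2).mul ha).mul hb)).add (hb.mul hb1)

/-- The expectation of the statistic from those of the three products. -/
lemma integral_mul_pairStat {H : History n → ℝ} {i : Fin n} {a a' : ℕ} {E₁ E₂ E₃ : History n → ℝ}
    (ht : Regular t) (hH : ∃ u, Before t u H)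
    (hE₁ : Integrable E₁ μ) (hE₂ : Integrable E₂ μ) (hE₃ : Integrable E₃ μ)
    (h₁ : ∫ y, H y * (ind (y.2 i a) * ind (y.2 i (a + 1))) ∂μ = ∫ y, E₁ y ∂μ)
    (h₂ : ∫ y, H y * (ind (y.2 i a) * ind (y.2 i a')) ∂μ = ∫ y, E₂ y ∂μ)
    (h₃ : ∫ y, H y * (ind (y.2 i a') * ind (y.2 i (a' + 1))) ∂μ = ∫ y, E₃ y ∂μ) :
    ∫ y, H y * pairStat (y.2 i) a a' ∂μ = ∫ y, (E₁ y - 2 * E₂ y + E₃ y) ∂μ := by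
  obtain ⟨u, hu⟩ := hH
  have hint : ∀ m m', Integrable (fun y => H y * (ind (y.2 i m) * ind (y.2 i m'))) μ := by
    intro m m'
    have h1 : t i m < max u (max (t i m) (t i m') + 1) := by
      have := le_max_left (t i m) (t i m')
      have := le_max_right u (max (t i m) (t i m') + 1)
      linarith
    have h2 : t i m' < max u (max (t i m) (t i m') + 1) := by
      have := le_max_right (t i m) (t i m')
      have := le_max_right u (max (t i m) (t i m') + 1)
      linarith
    exact ((hu.mono (le_max_left _ _)).mul (((Before.value h1).comp ind).mul
      ((Before.value h2).comp ind))).integrable ht μ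
  have h : ∀ y, H y * pairStat (y.2 i) a a' = H y * (ind (y.2 i a) * ind (y.2 i (a + 1))) -
      2 * (H y * (ind (y.2 i a) * ind (y.2 i a'))) +
      H y * (ind (y.2 i a') * ind (y.2 i (a' + 1))) := fun y => by
    unfold pairStat; ring
  have comb : ∀ A B C : History n → ℝ, Integrable A μ → Integrable B μ → Integrable C μ →
      ∫ y, (A y - 2 * B y + C y) ∂μ = ∫ y, A y ∂μ - 2 * ∫ y, B y ∂μ + ∫ y, C y ∂μ := by
    intro A B C hA hB hC
    rw [integral_add (f := fun y => A y - 2 * B y) (hA.sub (hB.const_mul 2)) hC,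
      integral_sub hA (hB.const_mul 2), integral_const_mul]
  simp_rw [h]
  rw [comb _ _ _ (hint _ _) (hint _ _) (hint _ _), h₁, h₂, h₃, comb _ _ _ hE₁ hE₂ hE₃]

/-- If no site on which `∂_i ψ` depends updates in the block, the statistic is unbiased. -/
lemma GoodBlock.integral_mul_blockStat_eq_zero (ht : Regular t) (hμ : IsGlauberLaw ψ t μ)
    {i j : Fin n} {L b : ℝ} (h : GoodBlock (t i) (t j) L b)
    (hU : ∀ v ∈ support (partialDeriv i ψ), numUpdates (t v) b = numUpdates (t v) (b + L))
    {H : History n → ℝ} (hH : UpTo t b H) :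
    ∫ y, H y * blockStat t i L b y ∂μ = 0 := by
  set a := numUpdates (t i) b
  set a' := numUpdates (t i) (b + 2 * L / 3) with ha'
  set ρ : History n → ℝ := updateProb ψ t i b with hρ
  have hm : ∀ m, a ≤ m → m ≤ a' + 1 → b < t i m ∧ ∀ y, updateProb ψ t i (t i m) y = ρ y := by
    intro m h1 h2
    have hbm : b < t i m := ht.numUpdates_le.1 h1
    have hmL : t i m ≤ b + L := ht.lt_numUpdates.1 (by have := h.last_i; omega)
    exact ⟨hbm, fun y => updateProb_congr fun v hv =>
      state_congr (ht.numUpdates_eq_of_mem (hU v hv) hbm.le hmL)⟩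
  have haa' : a + 2 ≤ a' := by have := h.first_i; have := h.middle_i; omega
  have hρb : UpTo t b ρ := fun w hw =>
    (Before.state ht hw).comp fun x => Real.sigmoid (2 * partialDeriv i ψ x)
  -- Since the probability stays at `ρ`, any two distinct updates of `i` among those considered have
  -- product of conditional mean `ρ²`. The coefficients `1, -2, 1` then cancel.
  have key : ∀ m m', a ≤ m → m < m' → m' ≤ a' + 1 →
      ∫ y, H y * (ind (y.2 i m) * ind (y.2 i m')) ∂μ = ∫ y, H y * (ρ y * ρ y) ∂μ := by
    intro m m' h1 h2 h3
    have hb := (hm m h1 (by omega)).1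
    rw [hμ.integral_mul_ind_mul_ind ht h2 (hH _ hb) (hρb _ hb) (hm m' (by omega) h3).2]
    simp_rw [(hm m h1 (by omega)).2]
  have hint : Integrable (fun y => H y * (ρ y * ρ y)) μ :=
    (((hH (b + 1) (by linarith)).mul ((hρb _ (by linarith)).mul (hρb _ (by linarith))))).integrable
      ht μ
  change ∫ y, H y * pairStat (y.2 i) a a' ∂μ = 0
  rw [integral_mul_pairStat ht ⟨b + 1, hH _ (by linarith)⟩ hint hint hint
    (key a (a + 1) le_rfl (by omega) (by omega)) (key a a' le_rfl (by omega) (by omega))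
    (key a' (a' + 1) (by omega) (by omega) le_rfl)]
  rw [integral_eq_zero_of_ae (ae_of_all _ fun y => ?_)]
  simp only [Pi.zero_apply]
  ring

/-- The probability of `+1` at site `i` for the configuration `x` with `x_j` replaced by `c`. -/
def flipProb (ψ : Config n → ℝ) (i j : Fin n) (x : Config n) (c : Bool) : ℝ :=
  Real.sigmoid (2 * partialDeriv i ψ (Function.update x j c))

/-- If no site other than `i` and `j` on which `∂_i ψ` or `∂_j ψ` depends updates in the block, the
bias of the statistic is at least a multiple of the squared influence of `j` on `i`. -/
lemma GoodBlock.le_integral_mul_blockStat (ht : Regular t) (hμ : IsGlauberLaw ψ t μ)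
    {c : ℝ} (hlo : ∀ i x, c ≤ Real.sigmoid (2 * partialDeriv i ψ x))
    (hhi : ∀ i x, Real.sigmoid (2 * partialDeriv i ψ x) ≤ 1 - c)
    {i j : Fin n} {L b : ℝ} (hL : 0 < L) (h : GoodBlock (t i) (t j) L b)
    (hU : ∀ v ∈ support (partialDeriv i ψ), v ≠ j →
      numUpdates (t v) b = numUpdates (t v) (b + L))
    (hUj : ∀ v ∈ support (partialDeriv j ψ), v ≠ i →
      numUpdates (t v) b = numUpdates (t v) (b + L))
    {H : History n → ℝ} (hH0 : ∀ y, 0 ≤ H y) (hH : UpTo t b H) :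
    c * ∫ y, H y * (flipProb ψ i j (state t y b) true - flipProb ψ i j (state t y b) false) ^ 2 ∂μ ≤
      ∫ y, H y * blockStat t i L b y ∂μ := by
  set a := numUpdates (t i) b with ha
  set a' := numUpdates (t i) (b + 2 * L / 3) with ha'
  have haa' : a + 2 ≤ a' := by have := h.first_i; have := h.middle_i; omega
  -- `k` is the last update of `i` in the first third. Two updates there give `a < k`, so `k` is not
  -- the update recorded by `Y₁`.
  obtain ⟨k, hk⟩ : ∃ k, a' = k + 1 := ⟨a' - 1, by omega⟩
  -- `e` is the last update of `j` in the middle third, the one seen by `i` in the last third.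
  obtain ⟨e, he⟩ : ∃ e, numUpdates (t j) (b + 2 * L / 3) = e + 1 :=
    ⟨numUpdates (t j) (b + 2 * L / 3) - 1, by have := h.middle_j; omega⟩
  have hbe : b + L / 3 < t j e := ht.numUpdates_le.1 (by have := h.middle_j; omega)
  have heb : t j e ≤ b + 2 * L / 3 := ht.lt_numUpdates.1 (by omega)
  have hbt : ∀ m, a ≤ m → b < t i m := fun m hm => ht.numUpdates_le.1 hm
  have htb : ∀ m, m < a' → t i m ≤ b + L / 3 := fun m hm =>
    ht.lt_numUpdates.1 (by have := h.middle_i; omega)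
  have hbt' : ∀ m, a' ≤ m → b + 2 * L / 3 < t i m := fun m hm => ht.numUpdates_le.1 hm
  have htb' : ∀ m, m ≤ a' + 1 → t i m ≤ b + L := fun m hm =>
    ht.lt_numUpdates.1 (by have := h.last_i; omega)
  set ρ : History n → ℝ := updateProb ψ t i b with hρ
  set φ : History n → Bool → ℝ := fun y x => flipProb ψ i j (state t y b) x with hφ
  set η : History n → Bool → ℝ := fun y x => flipProb ψ j i (state t y b) x with hη
  have hρb : UpTo t b ρ := fun w hw =>
    (Before.state ht hw).comp fun x => Real.sigmoid (2 * partialDeriv i ψ x)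
  have hφb : ∀ x, UpTo t b fun y => φ y x := fun x w hw =>
    (Before.state ht hw).comp fun z => flipProb ψ i j z x
  have hηb : ∀ x, UpTo t b fun y => η y x := fun x w hw =>
    (Before.state ht hw).comp fun z => flipProb ψ j i z x
  have hp1 : ∀ m, a ≤ m → m < a' → ∀ y, updateProb ψ t i (t i m) y = ρ y := by
    intro m h1 h2 y
    refine updateProb_congr fun v hv => state_congr ?_
    by_cases hvj : v = j
    · subst hvj
      exact ht.numUpdates_eq_of_mem h.first_j (hbt m h1).le (htb m h2)
    · exact ht.numUpdates_eq_of_mem (hU v hv hvj) (hbt m h1).le (htb' m (by omega))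
  have hp2 : ∀ m, a' ≤ m → m ≤ a' + 1 → ∀ y, updateProb ψ t i (t i m) y = φ y (y.2 j e) := by
    intro m h1 h2 y
    refine updateProb_congr fun v hv => ?_
    by_cases hvj : v = j
    · subst hvj
      rw [Function.update_self]
      refine state_eq_value ?_
      rw [ht.numUpdates_eq_of_mem h.last_j (hbt' m h1).le (htb' m h2), he]
    · rw [Function.update_of_ne hvj]
      exact state_congr (ht.numUpdates_eq_of_mem (hU v hv hvj) (hbt m (by omega)).le (htb' m h2))
  -- `j` may depend on `i`, but only through the value at update `k`, as `i` is silent in the middle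
  -- third.
  have hpj : ∀ y, updateProb ψ t j (t j e) y = η y (y.2 i k) := by
    intro y
    refine updateProb_congr fun v hv => ?_
    by_cases hvi : v = i
    · subst hvi
      rw [Function.update_self]
      refine state_eq_value ?_
      rw [ht.numUpdates_eq_of_mem h.middle_i hbe.le heb, h.middle_i, ← ha', hk]
    · rw [Function.update_of_ne hvi]
      exact state_congr (ht.numUpdates_eq_of_mem (hUj v hv hvi) (by linarith) (by linarith))
  have hke : t i k < t j e := (htb k (by omega)).trans_lt hbe
  have hak : t i a < t i k := ht.strictMono i (by omega)
  have heL : t j e < t i a' := heb.trans_lt (hbt' a' le_rfl)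
  have hφe : Before t (t i a') fun y => φ y (y.2 j e) := fun y y' h0 h1 => by
    have h2 : (fun x => φ y x) = fun x => φ y' x :=
      funext fun x => hφb x _ ((hbt a le_rfl).trans (hak.trans (hke.trans heL))) y y' h0 h1
    have h3 := Before.value heL y y' h0 h1
    simp only at h3
    change φ y (y.2 j e) = φ y' (y'.2 j e)
    rw [h3]
    exact congrFun h2 _
  -- averaging over the last update of `j` and the last update of `i` before it
  set Ψ : History n → Bool → ℝ := fun y x => η y x * φ y true + (1 - η y x) * φ y false with hΨ
  set Ξ : History n → ℝ := fun y => ρ y * Ψ y true + (1 - ρ y) * Ψ y false with hΞ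
  have hΨb : ∀ x, UpTo t b fun y => Ψ y x := fun x w hw =>
    ((hηb x w hw).mul (hφb true w hw)).add
      (((Before.const 1).sub (hηb x w hw)).mul (hφb false w hw))
  have hΞb : UpTo t b Ξ := fun w hw =>
    ((hρb w hw).mul (hΨb true w hw)).add
      (((Before.const 1).sub (hρb w hw)).mul (hΨb false w hw))
  -- Averaging successively over updates `e` and `k` replaces `φ y (y.2 j e)` by `Ξ`, which is known
  -- at time `b`. This is the conditional independence from the earlier update `a`.
  have average : ∀ F : History n → ℝ, Before t (t i k) F →
      ∫ y, F y * φ y (y.2 j e) ∂μ = ∫ y, F y * Ξ y ∂μ := by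
    intro F hF
    rw [hμ.integral_update ht (i := j) (m := e) (G := fun y x => F y * φ y x)
      (fun x => (hF.mono hke.le).mul (hφb x _ ((hbt k (by omega)).trans hke)))]
    have h1 : ∀ y, updateProb ψ t j (t j e) y * (F y * φ y true) +
        (1 - updateProb ψ t j (t j e) y) * (F y * φ y false) = F y * Ψ y (y.2 i k) := fun y => by
      rw [hpj y]; simp only [hΨ]; ring
    simp_rw [h1]
    rw [hμ.integral_update ht (i := i) (m := k) (G := fun y x => F y * Ψ y x)
      (fun x => hF.mul (hΨb x _ (hbt k (by omega))))]
    refine integral_congr_ae (ae_of_all _ fun y => ?_)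
    simp only [hp1 k (by omega) (by omega), hΞ]
    ring
  have hHa := hH _ (hbt a le_rfl)
  have hYa : Before t (t i k) fun y => H y * ind (y.2 i a) :=
    (hHa.mono hak.le).mul ((Before.value hak).comp ind)
  have hρa := hρb _ (hbt a le_rfl)
  have e1 : ∫ y, H y * (ind (y.2 i a) * ind (y.2 i (a + 1))) ∂μ = ∫ y, H y * (ρ y * ρ y) ∂μ := by
    rw [hμ.integral_mul_ind_mul_ind ht (Nat.lt_succ_self a) hHa hρa
      (hp1 (a + 1) (by omega) (by omega))]
    simp_rw [hp1 a le_rfl (by omega)]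
  have e3 : ∫ y, H y * (ind (y.2 i a') * ind (y.2 i (a' + 1))) ∂μ =
      ∫ y, H y * (φ y (y.2 j e) * φ y (y.2 j e)) ∂μ := by
    rw [hμ.integral_mul_ind_mul_ind ht (Nat.lt_succ_self a') (hH _ (hbt a' (by omega))) hφe
      (hp2 (a' + 1) (by omega) (by omega))]
    simp_rw [hp2 a' le_rfl (by omega)]
  -- `average` is used twice: forward with `Y₁` in the weight, which can then be averaged to `ρ`
  -- because `Ξ` is known at `b`, and backward with `ρ` in the weight to restore `φ y (y.2 j e)`.
  have e2 : ∫ y, H y * (ind (y.2 i a) * ind (y.2 i a')) ∂μ =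
      ∫ y, H y * (ρ y * φ y (y.2 j e)) ∂μ := by
    have h1 := hμ i a' (fun y => H y * ind (y.2 i a)) (hYa.mono (hke.trans heL).le)
    simp_rw [hp2 a' le_rfl (by omega)] at h1
    rw [average _ hYa] at h1
    have h2 := hμ i a (fun y => H y * Ξ y) (hHa.mul (hΞb _ (hbt a le_rfl)))
    simp_rw [hp1 a le_rfl (by omega)] at h2
    have h3 := average (fun y => H y * ρ y) ((hHa.mul hρa).mono hak.le)
    calc _ = ∫ y, H y * ind (y.2 i a) * ind (y.2 i a') ∂μ := by simp_rw [mul_assoc]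
      _ = ∫ y, H y * Ξ y * ind (y.2 i a) ∂μ := by rw [h1]; simp_rw [mul_right_comm]
      _ = ∫ y, H y * ρ y * Ξ y ∂μ := by rw [h2]; simp_rw [mul_right_comm]
      _ = _ := by rw [← h3]; simp_rw [mul_assoc]
  have hHa' := hH _ (hbt a' (by omega))
  have hρa' := hρb _ (hbt a' (by omega))
  have hZ : ∫ y, H y * pairStat (y.2 i) a a' ∂μ = ∫ y, H y * (ρ y - φ y (y.2 j e)) ^ 2 ∂μ := by
    rw [integral_mul_pairStat ht ⟨_, hHa⟩ ((hHa.mul (hρa.mul hρa)).integrable ht μ)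
      ((hHa'.mul (hρa'.mul hφe)).integrable ht μ)
      ((hHa'.mul (hφe.mul hφe)).integrable ht μ) e1 e2 e3]
    refine integral_congr_ae (ae_of_all _ fun y => ?_)
    simp only
    ring
  change _ ≤ ∫ y, H y * pairStat (y.2 i) a a' ∂μ
  have hbe' : b < t j e := by linarith
  have hsq : ∀ x, Before t (t j e) fun y => H y * (ρ y - φ y x) ^ 2 := fun x =>
    (hH _ hbe').mul (((hρb _ hbe').sub (hφb x _ hbe')).comp (· ^ 2))
  have hpe := before_updateProb ht ψ j e
  rw [hZ, hμ.integral_update ht (i := j) (m := e) (G := fun y x => H y * (ρ y - φ y x) ^ 2) hsq,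
    ← integral_const_mul]
  refine integral_mono
    (((Before.const c).mul ((hH _ hbe').mul (((hφb true _ hbe').sub
      (hφb false _ hbe')).comp (· ^ 2)))).integrable ht μ)
    (((hpe.mul (hsq true)).add (((Before.const 1).sub hpe).mul (hsq false))).integrable ht μ)
    fun y => ?_
  have h1 := hlo j (state t y (t j e))
  have h2 := hhi j (state t y (t j e))
  -- One of the two squares vanishes, namely that for the old value of `j`. The opposite value is
  -- drawn with probability at least `c`.
  have hρφ : ρ y = φ y (state t y b j) := by
    simp only [hρ, hφ, updateProb, flipProb, Function.update_eq_self]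
  have h0 := mul_nonneg (hH0 y) (sq_nonneg (φ y true - φ y false))
  simp only [hρφ]
  change c * (H y * (φ y true - φ y false) ^ 2) ≤ _
  cases state t y b j
  · simp only [sub_self, updateProb]
    nlinarith
  · simp only [sub_self, updateProb]
    nlinarith

/-- If the sites of `R` update in `(u, b]` and no other site on which `∂_i ψ` depends does, then the
influence of `j` on `i` at time `b` is large with a probability bounded below. -/
lemma IsGlauberLaw.pow_mul_integral_le_of_large (ht : Regular t) (hμ : IsGlauberLaw ψ t μ)
    {c : ℝ} (hc : 0 ≤ c) (hlo : ∀ i x, c ≤ Real.sigmoid (2 * partialDeriv i ψ x))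
    (hhi : ∀ i x, Real.sigmoid (2 * partialDeriv i ψ x) ≤ 1 - c)
    {f : Config n → ℝ} {j : Fin n} {R : Finset (Fin n)} {B u b : ℝ}
    (hR : ∀ z, ∃ A ⊆ R, B ≤ |f (Function.update (flipOn A z) j true) -
      f (Function.update (flipOn A z) j false)|)
    (hW : ∀ r ∈ R, numUpdates (t r) u < numUpdates (t r) b)
    (hW' : ∀ v ∈ support f, v ≠ j → v ∉ R → numUpdates (t v) u = numUpdates (t v) b)
    {H : History n → ℝ} (hH0 : ∀ y, 0 ≤ H y) (hH : UpTo t u H) (hub : u ≤ b) :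
    c ^ R.card * ∫ y, H y ∂μ ≤
      ∫ y, H y * (if B ≤ |f (Function.update (state t y b) j true) -
        f (Function.update (state t y b) j false)| then 1 else 0) ∂μ := by
  choose A hAR hA using hR
  -- The last update of `r` before `b`. It falls in the window, so prescribing its value prescribes
  -- the state of `r` at `b`.
  set m : Fin n → ℕ := fun r => numUpdates (t r) b - 1
  have hm : ∀ r ∈ R, u < t r (m r) := fun r hr => ht.numUpdates_le.1 (by
    have := hW r hr; simp only [m]; omega)
  have hm' : ∀ r ∈ R, t r (m r) ≤ b := fun r hr => ht.lt_numUpdates.1 (by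
    have := hW r hr; simp only [m]; omega)
  set x : History n → Config n := fun y => flipOn (A (state t y u)) (state t y u) with hx
  have hxb : UpTo t u x := fun w hw => (Before.state ht hw).comp fun z => flipOn (A z) z
  refine (hμ.pow_mul_integral_le ht hc hlo hhi m x R hH0 (fun r hr => hH _ (hm r hr))
    fun r hr => hxb _ (hm r hr)).trans ?_
  have hb1 : b < b + 1 := by linarith
  refine integral_mono
    (((hH (b + 1) (by linarith)).mul (Before.prod fun r hr => (Before.value
      ((hm' r hr).trans_lt hb1)).comp₂ (hxb (b + 1) (by linarith))
        fun v z => if v = z r then (1 : ℝ) else 0)).integrable ht μ)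
    (((hH (b + 1) (by linarith)).mul ((Before.state ht hb1).comp
      fun z => if B ≤ |f (Function.update z j true) - f (Function.update z j false)| then
        (1 : ℝ) else 0)).integrable ht μ) fun y => mul_le_mul_of_nonneg_left ?_ (hH0 y)
  by_cases hall : ∀ r ∈ R, y.2 r (m r) = x y r
  · have hs : ∀ q, f (Function.update (state t y b) j q) = f (Function.update (x y) j q) := by
      refine fun q => eq_of_eq_on_support fun v hv => ?_
      by_cases hvj : v = j
      · subst hvj; simp
      rw [Function.update_of_ne hvj, Function.update_of_ne hvj]
      by_cases hvR : v ∈ R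
      · rw [← hall v hvR]
        refine state_eq_value ?_
        have := hW v hvR
        simp only [m]; omega
      · simp only [hx, flipOn]
        rw [if_neg fun h => hvR (hAR _ h)]
        exact (state_congr (hW' v hv hvj hvR)).symm
    rw [hs, hs, if_pos (hA (state t y u))]
    exact Finset.prod_le_one (fun _ _ => by split_ifs <;> norm_num)
      fun _ _ => by split_ifs <;> norm_num
  · push Not at hall
    obtain ⟨r, hr, hne⟩ := hall
    rw [Finset.prod_eq_zero hr (by simp [hne])]
    split_ifs <;> norm_num

/-! ### Several blocks -/

/-- This is `|exp x - 1 - x| ≤ x²` for `|x| ≤ 1`, with `z² ≤ 4`. -/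
lemma exp_neg_mul_le {θ z : ℝ} (hθ : 0 ≤ θ) (hθ' : 2 * θ ≤ 1) (hz : |z| ≤ 2) :
    Real.exp (-θ * z) ≤ 1 - θ * z + 4 * θ ^ 2 := by
  have h1 : |-θ * z| ≤ 1 := by
    rw [abs_mul, abs_neg, abs_of_nonneg hθ]
    nlinarith
  have h2 := (abs_le.1 (Real.abs_exp_sub_one_sub_id_le h1)).2
  have h3 : z ^ 2 ≤ 4 := by
    have := sq_abs z ▸ pow_le_pow_left₀ (abs_nonneg z) hz 2
    linarith
  nlinarith [sq_nonneg θ]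

/-- The exponential moment of a sum of bounded statistics with conditional means at least `g s`. -/
lemma integral_exp_neg_mul_sum_le [IsProbabilityMeasure μ] (ht : Regular t) {θ : ℝ} (hθ : 0 ≤ θ)
    (hθ' : 2 * θ ≤ 1) {Z : ℕ → History n → ℝ} {w : ℕ → ℝ} {g : ℕ → ℝ} (hw : Monotone w)
    (hZ : ∀ s y, |Z s y| ≤ 2) (hZw : ∀ s, UpTo t (w (s + 1)) (Z s))
    (hg : ∀ s (H : History n → ℝ), (∀ y, 0 ≤ H y) → UpTo t (w s) H →
      g s * ∫ y, H y ∂μ ≤ ∫ y, H y * Z s y ∂μ) (M : ℕ) :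
    ∫ y, Real.exp (-θ * ∑ s ∈ Finset.range M, Z s y) ∂μ ≤
      Real.exp (-θ * ∑ s ∈ Finset.range M, g s + 4 * M * θ ^ 2) := by
  induction M with
  | zero => simp
  | succ M ih =>
    set H : History n → ℝ := fun y => Real.exp (-θ * ∑ s ∈ Finset.range M, Z s y) with hH
    have hH0 : ∀ y, 0 ≤ H y := fun y => (Real.exp_pos _).le
    -- The earlier statistics are settled by time `w M`, so their exponential weight is itself
    -- admissible as a test function for the next conditional mean.
    have hHw : UpTo t (w M) H := fun u hu =>
      (Before.sum fun s hs => hZw s u ((hw (Finset.mem_range.1 hs)).trans_lt hu)).comp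
        fun x => Real.exp (-θ * x)
    have h1 : w M < max (w M) (w (M + 1)) + 1 := by linarith [le_max_left (w M) (w (M + 1))]
    have h2 : w (M + 1) < max (w M) (w (M + 1)) + 1 := by
      linarith [le_max_right (w M) (w (M + 1))]
    have hHb := hHw _ h1
    have hZb := hZw M _ h2
    have hI := hHb.integrable ht μ
    have hIZ := (hHb.mul hZb).integrable ht μ
    calc ∫ y, Real.exp (-θ * ∑ s ∈ Finset.range (M + 1), Z s y) ∂μ
        = ∫ y, H y * Real.exp (-θ * Z M y) ∂μ := by
          refine integral_congr_ae (ae_of_all _ fun y => ?_)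
          simp only [hH]
          rw [← Real.exp_add, Finset.sum_range_succ]
          ring_nf
      _ ≤ ∫ y, ((1 + 4 * θ ^ 2) * H y - θ * (H y * Z M y)) ∂μ := by
          refine integral_mono ((hHb.mul (hZb.comp fun x => Real.exp (-θ * x))).integrable ht μ)
            ((hI.const_mul _).sub (hIZ.const_mul _)) fun y => ?_
          have := mul_le_mul_of_nonneg_left (exp_neg_mul_le hθ hθ' (hZ M y)) (hH0 y)
          simp only
          linarith
      _ = (1 + 4 * θ ^ 2) * ∫ y, H y ∂μ - θ * ∫ y, H y * Z M y ∂μ := by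
          rw [integral_sub (hI.const_mul _) (hIZ.const_mul _), integral_const_mul,
            integral_const_mul]
      _ ≤ (-θ * g M + 4 * θ ^ 2 + 1) * ∫ y, H y ∂μ := by
          have := mul_le_mul_of_nonneg_left (hg M H hH0 hHw) hθ
          linarith
      _ ≤ Real.exp (-θ * g M + 4 * θ ^ 2) *
            Real.exp (-θ * ∑ s ∈ Finset.range M, g s + 4 * M * θ ^ 2) := by
          refine mul_le_mul (Real.add_one_le_exp _) ih (integral_nonneg hH0) (Real.exp_pos _).le
      _ = _ := by
          rw [← Real.exp_add, Finset.sum_range_succ]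
          push_cast
          ring_nf

end

section

/-! ### Measurability in the update times -/

lemma measurable_sInf_nat {α : Type*} [MeasurableSpace α] {p : α → ℕ → Prop}
    (hp : ∀ l, MeasurableSet {a | p a l}) : Measurable fun a => sInf {l | p a l} := by
  refine measurable_to_countable' fun k => ?_
  -- The second piece accounts for the convention `sInf ∅ = 0`.
  have : (fun a => sInf {l | p a l}) ⁻¹' {k} =
      ({a | p a k} ∩ ⋂ l ∈ Set.Iio k, {a | p a l}ᶜ) ∪ ({a | k = 0} ∩ ⋂ l, {a | p a l}ᶜ) := by
    ext a
    simp only [Set.mem_preimage, Set.mem_singleton_iff, Set.mem_union, Set.mem_inter_iff,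
      Set.mem_ofPred_eq, Set.mem_iInter, Set.mem_compl_iff, Set.mem_Iio]
    constructor
    · rintro rfl
      by_cases hne : {l | p a l}.Nonempty
      · exact Or.inl ⟨Nat.sInf_mem hne, fun l hl => Nat.notMem_of_lt_sInf hl⟩
      · rw [Set.not_nonempty_iff_eq_empty] at hne
        refine Or.inr ⟨by rw [hne, Nat.sInf_empty], fun l hl => ?_⟩
        have : l ∈ {l | p a l} := hl
        rw [hne] at this
        exact this
    · rintro (⟨h1, h2⟩ | ⟨rfl, h2⟩)
      · refine le_antisymm (Nat.sInf_le h1) ?_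
        by_contra! hlt
        exact h2 _ hlt (Nat.sInf_mem ⟨k, h1⟩)
      · have : {l | p a l} = ∅ := Set.eq_empty_of_forall_notMem h2
        rw [this, Nat.sInf_empty]
  rw [this]
  refine MeasurableSet.union ((hp k).inter ?_) ((MeasurableSet.const _).inter ?_)
  · exact MeasurableSet.biInter (Set.to_countable _) fun l _ => (hp l).compl
  · exact MeasurableSet.iInter fun l => (hp l).compl

variable {n : ℕ}

lemma measurable_numUpdates {α : Type*} [MeasurableSpace α] {t : α → ℕ → ℝ} {u : α → ℝ}
    (ht : Measurable t) (hu : Measurable u) : Measurable fun a => numUpdates (t a) (u a) :=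
  measurable_sInf_nat fun _ => measurableSet_lt hu (ht.eval)

lemma measurable_apply_nat {α β : Type*} [MeasurableSpace α] [MeasurableSpace β] {v : α → ℕ → β}
    {k : α → ℕ} (hv : Measurable v) (hk : Measurable k) : Measurable fun a => v a (k a) := by
  have h : Measurable fun q : ℕ × (ℕ → β) => q.2 q.1 :=
    measurable_from_prod_countable_right fun l => measurable_pi_apply l
  exact h.comp (hk.prodMk hv)

lemma measurable_state {α : Type*} [MeasurableSpace α] {t : α → Clocks n} {y : α → History n}
    {u : α → ℝ} (ht : Measurable t) (hy : Measurable y) (hu : Measurable u) :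
    Measurable fun a => state (t a) (y a) (u a) := by
  refine measurable_pi_lambda _ fun j => ?_
  have hN : Measurable fun a => numUpdates (t a j) (u a) := measurable_numUpdates ht.eval hu
  refine Measurable.ite (hN (measurableSet_singleton 0)) hy.fst.eval ?_
  exact measurable_apply_nat (v := fun a => (y a).2 j) hy.snd.eval
    ((Measurable.of_discrete (f := fun k : ℕ => k - 1)).comp hN)

lemma measurable_updateProb {α : Type*} [MeasurableSpace α] (ψ : Config n → ℝ) (i : Fin n)
    {t : α → Clocks n} {y : α → History n}
    {u : α → ℝ} (ht : Measurable t) (hy : Measurable y) (hu : Measurable u) :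
    Measurable fun a => updateProb ψ (t a) i (u a) (y a) :=
  (Measurable.of_discrete (f := fun x => Real.sigmoid (2 * partialDeriv i ψ x))).comp
    (measurable_state ht hy hu)

lemma measurable_ind : Measurable ind := Measurable.of_discrete

/-! ### Cylinder events in the past of an update -/

/-- The histories that start at `a` and have the values `+1` exactly at the updates in `B`, among
the updates before time `u`. -/
def cylinder (t : Clocks n) (u : ℝ) (a : Config n) (B : Finset (Fin n × ℕ)) : Set (History n) :=
  {y | y.1 = a ∧ ∀ j l, t j l < u → (y.2 j l = true ↔ (j, l) ∈ B)}

lemma measurableSet_cylinder {α : Type*} [MeasurableSpace α] {t : α → Clocks n} {y : α → History n}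
    {u : α → ℝ} (ht : Measurable t) (hy : Measurable y) (hu : Measurable u)
    (a : Config n) (B : Finset (Fin n × ℕ)) :
    MeasurableSet {x | y x ∈ cylinder (t x) (u x) a B} := by
  have : {x | y x ∈ cylinder (t x) (u x) a B} = {x | (y x).1 = a} ∩
      ⋂ j, ⋂ l, ({x | t x j l < u x}ᶜ ∪ {x | (y x).2 j l = true ↔ (j, l) ∈ B}) := by
    ext x
    simp [cylinder, imp_iff_not_or]
  rw [this]
  refine (measurableSet_eq_fun hy.fst measurable_const).inter
    (MeasurableSet.iInter fun j => MeasurableSet.iInter fun l => ?_)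
  refine (measurableSet_lt ht.eval.eval hu).compl.union ?_
  have h : Measurable fun x => (y x).2 j l := hy.snd.eval.eval
  by_cases hB : (j, l) ∈ B
  · simp only [hB, iff_true]
    exact h (measurableSet_singleton true)
  · simp only [hB, iff_false, Bool.not_eq_true]
    exact h (measurableSet_singleton false)

variable {t : Clocks n}

lemma abs_ind_sub_sigmoid_le (b : Bool) (x : ℝ) : |ind b - Real.sigmoid x| ≤ 1 := by
  have h1 := Real.sigmoid_pos x
  have h2 := Real.sigmoid_lt_one x
  cases b <;> simp only [ind, abs_le] <;> constructor <;> simp <;> linarith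

/-- It suffices to check the conditional law of the updates on cylinder events. -/
lemma isGlauberLaw_of_cylinder (ht : Regular t) {ψ : Config n → ℝ} {μ : Measure (History n)}
    [IsFiniteMeasure μ]
    (h : ∀ (i : Fin n) (m : ℕ) (a : Config n) (B : Finset (Fin n × ℕ)),
      ∫ y in cylinder t (t i m) a B, (ind (y.2 i m) - updateProb ψ t i (t i m) y) ∂μ = 0) :
    IsGlauberLaw ψ t μ := by
  classical
  intro i m F hF
  set Δ : History n → ℝ := fun y => ind (y.2 i m) - updateProb ψ t i (t i m) y with hΔ
  have hval : Measurable fun y : History n => ind (y.2 i m) :=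
    measurable_ind.comp measurable_snd.eval.eval
  have hprob : Measurable fun y : History n => updateProb ψ t i (t i m) y :=
    measurable_updateProb ψ i measurable_const measurable_id measurable_const
  have hΔm : Measurable Δ := hval.sub hprob
  have hΔi : Integrable Δ μ := Integrable.of_bound hΔm.aestronglyMeasurable 1
    (ae_of_all _ fun y => abs_ind_sub_sigmoid_le _ _)
  have hlt : t i m < t i (m + 1) := ht.strictMono i (Nat.lt_succ_self m)
  have hI1 : Integrable (fun y => F y * ind (y.2 i m)) μ :=
    ((hF.mono hlt.le).mul ((Before.value hlt).comp ind)).integrable ht μ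
  have hI2 := (hF.mul (before_updateProb ht ψ i m)).integrable ht μ
  rw [← sub_eq_zero, ← integral_sub hI1 hI2]
  have hcyl : ∀ a B, MeasurableSet (cylinder t (t i m) a B) := fun a B =>
    measurableSet_cylinder measurable_const measurable_id measurable_const a B
  -- A crude common bound on the indices of past updates, which makes the set of past updates a
  -- `Finset`.
  set K := ∑ j, numUpdates (t j) (t i m) with hK
  set past : Finset (Fin n × ℕ) :=
    (Finset.univ ×ˢ Finset.range K).filter fun p => t p.1 p.2 < t i m with hpast
  have hmem : ∀ j l, (j, l) ∈ past ↔ t j l < t i m := by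
    intro j l
    simp only [hpast, Finset.mem_filter, Finset.mem_product, Finset.mem_univ, true_and,
      Finset.mem_range, and_iff_right_iff_imp]
    intro hl
    exact (ht.lt_numUpdates.2 hl.le).trans_le (Finset.single_le_sum
      (f := fun j => numUpdates (t j) (t i m)) (fun _ _ => Nat.zero_le _) (Finset.mem_univ j))
  set rep : Config n × Finset (Fin n × ℕ) → History n := fun p =>
    (p.1, fun j l => decide ((j, l) ∈ p.2)) with hrep
  -- Each history lies in exactly one of these cylinders, and `F` is constant on it. Thus `F` is a
  -- finite combination of cylinder indicators.
  have key : ∀ y, F y * ind (y.2 i m) - F y * updateProb ψ t i (t i m) y =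
      ∑ p ∈ Finset.univ ×ˢ past.powerset,
        F (rep p) * (cylinder t (t i m) p.1 p.2).indicator Δ y := by
    intro y
    set p₀ : Config n × Finset (Fin n × ℕ) := (y.1, past.filter fun q => y.2 q.1 q.2 = true)
    have hp₀ : y ∈ cylinder t (t i m) p₀.1 p₀.2 :=
      ⟨rfl, fun j l hl => by simp [p₀, hmem, hl]⟩
    rw [Finset.sum_eq_single p₀]
    · rw [Set.indicator_of_mem hp₀, ← hF y (rep p₀) rfl fun j l hl => ?_]
      · simp only [hΔ]; ring
      · simp [hrep, p₀, hmem, hl]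
    · rintro ⟨a, B⟩ hp hne
      rw [Set.indicator_of_notMem, mul_zero]
      rintro ⟨h1, h2⟩
      refine hne (Prod.ext h1.symm ?_)
      have hB : B ⊆ past := Finset.mem_powerset.1 (Finset.mem_product.1 hp).2
      ext ⟨j, l⟩
      simp only [p₀, Finset.mem_filter]
      constructor
      · intro hjl
        exact ⟨hB hjl, (h2 j l ((hmem j l).1 (hB hjl))).2 hjl⟩
      · rintro ⟨hjl, hy⟩
        exact (h2 j l ((hmem j l).1 hjl)).1 hy
    · intro hp
      exact absurd (Finset.mem_product.2 ⟨Finset.mem_univ _,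
        Finset.mem_powerset.2 (Finset.filter_subset _ _)⟩) hp
  simp_rw [key]
  rw [integral_finsetSum _ fun p _ => (hΔi.indicator (hcyl _ _)).const_mul _]
  refine Finset.sum_eq_zero fun p _ => ?_
  rw [integral_const_mul, integral_indicator (hcyl _ _), h, mul_zero]

/-! ### The conditional law of the history given the update times -/

section

variable {Ω : Type*} [MeasurableSpace Ω] {P : Measure Ω} [IsProbabilityMeasure P]
  {ψ : Config n → ℝ} {X : ℝ → Ω → Config n} {T : Fin n → ℕ → Ω → ℝ}

/-- The update times of the sample point `ω`. -/
def clocks (T : Fin n → ℕ → Ω → ℝ) (ω : Ω) : Clocks n := fun v m => T v m ω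

/-- The initial configuration and the values at the updates, of the sample point `ω`. -/
def history (X : ℝ → Ω → Config n) (T : Fin n → ℕ → Ω → ℝ) (ω : Ω) : History n :=
  (X 0 ω, fun v m => X (T v m ω) ω v)

omit [IsProbabilityMeasure P] in
lemma IsGlauberDynamics.measurable_clocks (hX : IsGlauberDynamics P ψ X T) :
    Measurable (clocks T) :=
  measurable_pi_lambda _ fun v => measurable_pi_lambda _ fun m => (hX.poisson v).measurable m

omit [IsProbabilityMeasure P] in
lemma IsGlauberDynamics.measurable_value (hX : IsGlauberDynamics P ψ X T) (v : Fin n) (m : ℕ) :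
    Measurable fun ω => X (T v m ω) ω v :=
  (hX.measurable.comp (((hX.poisson v).measurable m).prodMk measurable_id)).eval

omit [IsProbabilityMeasure P] in
lemma IsGlauberDynamics.measurable_init (hX : IsGlauberDynamics P ψ X T) : Measurable (X 0) :=
  hX.measurable.comp (measurable_const.prodMk measurable_id)

omit [IsProbabilityMeasure P] in
lemma IsGlauberDynamics.measurable_history (hX : IsGlauberDynamics P ψ X T) :
    Measurable (history X T) :=
  hX.measurable_init.prodMk
    (measurable_pi_lambda _ fun v => measurable_pi_lambda _ fun m => hX.measurable_value v m)

omit [IsProbabilityMeasure P] in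
lemma IsGlauberDynamics.past_le (hX : IsGlauberDynamics P ψ X T) (i : Fin n) (m : ℕ) :
    past X T i m ≤ ‹MeasurableSpace Ω› := by
  refine sup_le (sup_le hX.measurable_init.comap_le hX.measurable_clocks.comap_le) ?_
  refine Measurable.comap_le (measurable_pi_lambda _ fun v => measurable_pi_lambda _ fun l => ?_)
  exact Measurable.ite (measurableSet_lt ((hX.poisson v).measurable l)
    ((hX.poisson i).measurable m))
    ((Measurable.of_discrete (f := spin)).comp (hX.measurable_value v l)) measurable_const

omit [MeasurableSpace Ω] in
lemma measurable_clocks_past (i : Fin n) (m : ℕ) :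
    Measurable[past X T i m] (clocks T) :=
  (comap_measurable (clocks T)).mono (le_sup_right.trans le_sup_left) le_rfl

omit [MeasurableSpace Ω] in
lemma measurableSet_past_cylinder (i : Fin n) (m : ℕ) (a : Config n) (B : Finset (Fin n × ℕ)) :
    MeasurableSet[past X T i m]
      {ω | history X T ω ∈ cylinder (clocks T ω) (T i m ω) a B} := by
  let _ := past X T i m
  have hcl : Measurable (clocks T) := measurable_clocks_past i m
  have hT : ∀ v l, Measurable (T v l) := fun v l => hcl.eval.eval
  have h0 : Measurable (X 0) := (comap_measurable (X 0)).mono (le_sup_left.trans le_sup_left) le_rfl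
  have hv : Measurable fun ω (j : Fin n) (l : ℕ) =>
      if T j l ω < T i m ω then spin (X (T j l ω) ω j) else 0 :=
    (comap_measurable _).mono le_sup_right le_rfl
  -- The value `+1` is read off from the masked spin. The filler `0` is never consulted, because
  -- cylinders constrain only earlier updates.
  have : {ω | history X T ω ∈ cylinder (clocks T ω) (T i m ω) a B} = {ω | X 0 ω = a} ∩
      ⋂ j, ⋂ l, ({ω | T j l ω < T i m ω}ᶜ ∪
        {ω | (if T j l ω < T i m ω then spin (X (T j l ω) ω j) else 0) = 1 ↔ (j, l) ∈ B}) := by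
    ext ω
    simp only [cylinder, history, clocks, Set.mem_ofPred_eq, Set.mem_inter_iff, Set.mem_iInter,
      Set.mem_union, Set.mem_compl_iff, ← imp_iff_not_or]
    refine and_congr_right fun _ => forall_congr' fun j => forall_congr' fun l =>
      forall_congr' fun hl => ?_
    rw [if_pos hl]
    cases X (T j l ω) ω j <;> simp [spin]
    norm_num
  rw [this]
  refine (h0 (measurableSet_singleton a)).inter
    (MeasurableSet.iInter fun j => MeasurableSet.iInter fun l => ?_)
  refine (measurableSet_lt (hT j l) (hT i m)).compl.union ?_
  have h1 := (hv.eval (a := j)).eval (a := l) (measurableSet_singleton (1 : ℝ))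
  by_cases hB : (j, l) ∈ B
  · simp only [hB, iff_true]
    exact h1
  · simp only [hB, iff_false]
    exact h1.compl

omit [IsProbabilityMeasure P] in
/-- Almost surely the trajectory at the updates is given by the history. -/
lemma IsGlauberDynamics.state_eq (hX : IsGlauberDynamics P ψ X T)
    (hreg : ∀ᵐ ω ∂P, Regular (clocks T ω)) :
    ∀ᵐ ω ∂P, ∀ i m, X (T i m ω) ω = state (clocks T ω) (history X T ω) (T i m ω) := by
  have hpos : ∀ᵐ ω ∂P, ∀ i m, 0 < T i m ω := ae_all_iff.2 fun i => (hX.poisson i).pos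
  filter_upwards [hX.const_between, hreg, hpos] with ω hω hr hp i m
  funext j
  unfold state
  split_ifs with h0
  · refine hω j 0 _ le_rfl (hp i m).le fun l hl => ?_
    have h1 : ¬ l < numUpdates (clocks T ω j) (T i m ω) := by omega
    exact h1 (hr.lt_numUpdates.2 hl.2)
  · set k := numUpdates (clocks T ω j) (T i m ω) - 1 with hk
    have hkt : T j k ω ≤ T i m ω := hr.lt_numUpdates.1 (Nat.sub_one_lt h0)
    refine hω j _ _ (hp j k).le hkt fun l hl => ?_
    have h1 : l < numUpdates (clocks T ω j) (T i m ω) := hr.lt_numUpdates.2 hl.2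
    have h2 : k < l := (hr.strictMono j).lt_iff_lt.1 hl.1
    omega

/-- The cylinder event and the clock event `S` both belong to `past`, so this is `update_law`
integrated over their intersection. The freedom in `S` allows localisation to almost every
realisation of the clocks. -/
lemma IsGlauberDynamics.integral_cylinder (hX : IsGlauberDynamics P ψ X T)
    (hreg : ∀ᵐ ω ∂P, Regular (clocks T ω)) (i : Fin n) (m : ℕ) (a : Config n)
    (B : Finset (Fin n × ℕ)) {S : Set (Clocks n)} (hS : MeasurableSet S) :
    ∫ ω in clocks T ⁻¹' S ∩ {ω | history X T ω ∈ cylinder (clocks T ω) (T i m ω) a B},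
      (ind ((history X T ω).2 i m) -
        updateProb ψ (clocks T ω) i (T i m ω) (history X T ω)) ∂P = 0 := by
  set E := clocks T ⁻¹' S ∩ {ω | history X T ω ∈ cylinder (clocks T ω) (T i m ω) a B} with hE
  have hm := hX.past_le i m
  have hEm : MeasurableSet[past X T i m] E :=
    MeasurableSet.inter (measurable_clocks_past (X := X) (T := T) i m hS)
      (measurableSet_past_cylinder i m a B)
  have hval : Measurable fun ω => ind ((history X T ω).2 i m) :=
    measurable_ind.comp (hX.measurable_value i m)
  have hi1 : Integrable (fun ω => ind ((history X T ω).2 i m)) P :=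
    Integrable.of_bound hval.aestronglyMeasurable 1 (ae_of_all _ fun ω => by
      rw [Real.norm_eq_abs, abs_of_nonneg (ind_nonneg _)]
      exact ind_le_one _)
  have hind : (fun ω => ind ((history X T ω).2 i m)) =
      Set.indicator {ω | X (T i m ω) ω i = true} (fun _ => (1 : ℝ)) := by
    funext ω
    by_cases hx : X (T i m ω) ω i = true
    · rw [Set.indicator_of_mem (s := {ω | X (T i m ω) ω i = true}) hx]
      simp [ind, history, hx]
    · rw [Set.indicator_of_notMem (s := {ω | X (T i m ω) ω i = true}) hx]
      simp [ind, history, hx]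
  have hprob : P[fun ω => ind ((history X T ω).2 i m) | past X T i m] =ᵐ[P]
      fun ω => updateProb ψ (clocks T ω) i (T i m ω) (history X T ω) := by
    rw [hind]
    refine (hX.update_law i m).trans ?_
    filter_upwards [hX.state_eq hreg] with ω hω
    rw [hω i m, updateProb]
  have hi2 : Integrable (fun ω => updateProb ψ (clocks T ω) i (T i m ω) (history X T ω)) P :=
    integrable_condExp.congr hprob
  rw [integral_sub hi1.integrableOn hi2.integrableOn, sub_eq_zero,
    ← setIntegral_condExp hm hi1 hEm]
  exact setIntegral_congr_ae (hm _ hEm) (hprob.mono fun ω h _ => h)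

/-- Conditionally on the update times, the history follows the Glauber dynamics. -/
lemma IsGlauberDynamics.ae_isGlauberLaw_condDistrib (hX : IsGlauberDynamics P ψ X T)
    (hreg : ∀ᵐ ω ∂P, Regular (clocks T ω)) :
    ∀ᵐ t ∂P.map (clocks T), Regular t →
      IsGlauberLaw ψ t (condDistrib (history X T) (clocks T) P t) := by
  have hmC := hX.measurable_clocks
  have hmH := hX.measurable_history
  have : IsProbabilityMeasure (P.map (clocks T)) := Measure.isProbabilityMeasure_map hmC.aemeasurable
  -- The labels `(i, m, a, B)` form a countable set not depending on the clocks, so one null set of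
  -- clocks will serve for all of them.
  have key : ∀ (i : Fin n) (m : ℕ) (a : Config n) (B : Finset (Fin n × ℕ)),
      ∀ᵐ t ∂P.map (clocks T), ∫ y in cylinder t (t i m) a B,
        (ind (y.2 i m) - updateProb ψ t i (t i m) y)
          ∂(condDistrib (history X T) (clocks T) P t) = 0 := by
    intro i m a B
    set C : Set (Clocks n × History n) := {p | p.2 ∈ cylinder p.1 (p.1 i m) a B} with hC
    have hCm : MeasurableSet C := measurableSet_cylinder measurable_fst measurable_snd
      measurable_fst.eval.eval a B
    set Δ : Clocks n × History n → ℝ := fun p => ind (p.2.2 i m) - updateProb ψ p.1 i (p.1 i m) p.2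
    have hΔm : Measurable Δ := (measurable_ind.comp measurable_snd.snd.eval.eval).sub
      (measurable_updateProb ψ i measurable_fst measurable_snd measurable_fst.eval.eval)
    have hCΔ : Measurable (C.indicator Δ) := hΔm.indicator hCm
    have hbd : ∀ p, ‖C.indicator Δ p‖ ≤ 1 := fun p =>
      (norm_indicator_le_norm_self _ _).trans (abs_ind_sub_sigmoid_le _ _)
    have hint : Integrable (C.indicator Δ)
        ((P.map (clocks T)) ⊗ₘ condDistrib (history X T) (clocks T) P) :=
      Integrable.of_bound hCΔ.aestronglyMeasurable 1 (ae_of_all _ hbd)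
    -- The integral of the conditional expectation over every measurable set of clocks is zero, by
    -- disintegration and `integral_cylinder`.
    have hz : (fun t => ∫ y, C.indicator Δ (t, y) ∂(condDistrib (history X T) (clocks T) P t))
        =ᵐ[P.map (clocks T)] 0 := by
      refine ae_eq_zero_of_forall_setIntegral_eq_of_sigmaFinite
        (fun _ _ _ => Integrable.integrableOn ?_) fun S hS _ => ?_
      · refine Integrable.of_bound
          hCΔ.stronglyMeasurable.integral_condDistrib.aestronglyMeasurable 1 (ae_of_all _ fun t => ?_)
        refine (norm_integral_le_of_norm_le_const (ae_of_all _ fun y => hbd (t, y))).trans_eq ?_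
        simp
      have h1 := Measure.setIntegral_compProd hS MeasurableSet.univ
        (hint.integrableOn (s := S ×ˢ Set.univ))
      simp only [Measure.restrict_univ] at h1
      rw [← h1, compProd_map_condDistrib hmH.aemeasurable,
        setIntegral_map (hS.prod MeasurableSet.univ) hCΔ.aestronglyMeasurable
          (hmC.prodMk hmH).aemeasurable]
      have h2 := hX.integral_cylinder hreg i m a B hS
      have hE : MeasurableSet {ω | history X T ω ∈ cylinder (clocks T ω) (T i m ω) a B} :=
        hX.past_le i m _ (measurableSet_past_cylinder i m a B)
      rw [← setIntegral_indicator hE] at h2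
      convert! h2 using 2
      rw [Set.mk_preimage_prod, Set.preimage_univ, Set.inter_univ]
    filter_upwards [hz] with t ht
    rw [← integral_indicator]
    · exact ht
    · exact measurableSet_cylinder measurable_const measurable_id measurable_const a B
  have := ae_all_iff.2 fun i => ae_all_iff.2 fun m => ae_all_iff.2 fun a => ae_all_iff.2 fun B =>
    key i m a B
  filter_upwards [this] with t ht hr
  exact isGlauberLaw_of_cylinder hr ht

end

end

section

/-! ### Poisson clocks -/

lemma poissonMeasure_real_zero (c : ℝ≥0) : (poissonMeasure c).real {0} = Real.exp (-c) := by
  simp [poissonMeasure_real_singleton]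

lemma poissonMeasure_real_one_le (c : ℝ≥0) :
    (poissonMeasure c).real {k | 1 ≤ k} = 1 - Real.exp (-c) := by
  have : {k : ℕ | 1 ≤ k} = {0}ᶜ := by
    ext k
    simp [Nat.one_le_iff_ne_zero]
  rw [this, probReal_compl_eq_one_sub (measurableSet_singleton 0), poissonMeasure_real_zero]

/-- Grouping an independent family indexed by pairs by the first index. -/
lemma iIndepFun_curry {Ω ι κ β : Type*} [MeasurableSpace Ω] [MeasurableSpace β] {P : Measure Ω}
    {f : ι × κ → Ω → β} (hf : ∀ p, Measurable (f p)) (h : iIndepFun f P) :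
    iIndepFun (fun i ω k => f (i, k) ω) P := by
  have := h.isProbabilityMeasure
  have hs : iIndepFun (fun (p : (_ : ι) × κ) ω => f (p.1, p.2) ω) P :=
    h.precomp (g := fun p : (_ : ι) × κ => (p.1, p.2)) (Equiv.sigmaEquivProd ι κ).injective
  have hr : ∀ i, iIndepFun (fun k ω => f (i, k) ω) P := fun i =>
    h.precomp (g := fun k => (i, k)) (Prod.mk_right_injective i)
  have hp : ∀ i k, IsProbabilityMeasure (P.map (f (i, k))) :=
    fun i k => Measure.isProbabilityMeasure_map (hf _).aemeasurable
  rw [iIndepFun_iff_map_fun_eq_infinitePi_map (by fun_prop)] at hs ⊢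
  have hc : (fun ω i k => f (i, k) ω) =
      MeasurableEquiv.piCurry (fun (_ : ι) (_ : κ) => β) ∘
        fun ω (p : (_ : ι) × κ) => f (p.1, p.2) ω := by
    ext; simp [Sigma.curry]
  rw [hc, ← Measure.map_map (by fun_prop) (by fun_prop), hs,
    Measure.infinitePi_map_piCurry (fun i k => P.map (f (i, k)))]
  congr 1
  funext i
  rw [← (iIndepFun_iff_map_fun_eq_infinitePi_map (by fun_prop)).1 (hr i)]

variable {n : ℕ}

/-- The number of updates in `(a, b]` of a site with update times `t`. -/
def increment (t : ℕ → ℝ) (a b : ℝ) : ℕ := numUpdates t b - numUpdates t a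

lemma measurable_increment {α : Type*} [MeasurableSpace α] {t : α → ℕ → ℝ} {a b : α → ℝ}
    (ht : Measurable t) (ha : Measurable a) (hb : Measurable b) :
    Measurable fun x => increment (t x) (a x) (b x) :=
  (measurable_numUpdates ht hb).sub (measurable_numUpdates ht ha)

variable {Ω : Type*} [MeasurableSpace Ω] {P : Measure Ω}

/-! ### A single Poisson clock -/

section single

variable {T : ℕ → Ω → ℝ}

lemma IsPoissonProcess.measurable_times (hT : IsPoissonProcess P T) :
    Measurable fun ω m => T m ω := measurable_pi_lambda _ hT.measurable

lemma IsPoissonProcess.measurable_increment (hT : IsPoissonProcess P T) (a b : ℝ) :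
    Measurable fun ω => increment (fun m => T m ω) a b :=
  MRF.measurable_increment hT.measurable_times measurable_const measurable_const

lemma IsPoissonProcess.hasLaw_increment (hT : IsPoissonProcess P T) {a b : ℝ≥0} (hab : a ≤ b) :
    HasLaw (fun ω => increment (fun m => T m ω) a b) (poissonMeasure (b - a)) P := by
  refine (hT.law_increment a b hab).congr ?_
  filter_upwards [hT.strictMono, hT.tendsto] with ω h1 h2
  exact (updateCount_Ioc h1 h2 _ _).symm

lemma IsPoissonProcess.measureReal_increment_eq (hT : IsPoissonProcess P T) {a b : ℝ}
    (ha : 0 ≤ a) (hab : a ≤ b) (s : Set ℕ) :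
    P.real {ω | increment (fun m => T m ω) a b ∈ s} =
      (poissonMeasure (b - a).toNNReal).real s := by
  lift a to ℝ≥0 using ha
  lift b to ℝ≥0 using a.2.trans hab
  have h := hT.hasLaw_increment (NNReal.coe_le_coe.1 hab)
  rw [← NNReal.coe_sub (NNReal.coe_le_coe.1 hab), Real.toNNReal_coe, ← h.map_eq,
    map_measureReal_apply (hT.measurable_increment a b) (MeasurableSet.of_discrete)]
  rfl

lemma IsPoissonProcess.measureReal_increment_eq_zero (hT : IsPoissonProcess P T) {a b : ℝ}
    (ha : 0 ≤ a) (hab : a ≤ b) :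
    P.real {ω | increment (fun m => T m ω) a b = 0} = Real.exp (-(b - a)) := by
  have := hT.measureReal_increment_eq ha hab {0}
  rw [poissonMeasure_real_zero, Real.coe_toNNReal _ (sub_nonneg.2 hab)] at this
  exact this

lemma IsPoissonProcess.measureReal_one_le_increment (hT : IsPoissonProcess P T) {a b : ℝ}
    (ha : 0 ≤ a) (hab : a ≤ b) :
    P.real {ω | 1 ≤ increment (fun m => T m ω) a b} = 1 - Real.exp (-(b - a)) := by
  have := hT.measureReal_increment_eq ha hab {k | 1 ≤ k}
  rw [poissonMeasure_real_one_le, Real.coe_toNNReal _ (sub_nonneg.2 hab)] at this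
  exact this

/-- The process counts updates in `[0, u]`. Positivity of the times removes the point `0`, so its
increments are those of `numUpdates`. -/
lemma IsPoissonProcess.iIndepFun_increment (hT : IsPoissonProcess P T) {a : ℕ → ℝ}
    (ha0 : ∀ p, 0 ≤ a p) (ha : Monotone a) :
    iIndepFun (fun p ω => increment (fun m => T m ω) (a p) (a (p + 1))) P := by
  have h := hT.indep_increments.nat (t := fun p => (⟨a p, ha0 p⟩ : ℝ≥0)) fun p q hpq => ha hpq
  refine (iIndepFun_congr fun p => ?_).1 h
  filter_upwards [hT.strictMono, hT.tendsto, hT.pos] with ω h1 h2 h3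
  have hc : ∀ u : ℝ, updateCount (fun m => T m ω) (Set.Icc 0 u) = numUpdates (fun m => T m ω) u := by
    intro u
    have h4 : {m | T m ω ∈ Set.Icc 0 u} = {m | T m ω ∈ Set.Ioc 0 u} := by
      ext m
      simp [h3 m, (h3 m).le]
    have h5 : numUpdates (fun m => T m ω) 0 = 0 := by
      rw [← Nat.le_zero, numUpdates_le h1 h2]
      exact h3 0
    have h6 := updateCount_Ioc h1 h2 0 u
    rw [h5, Nat.sub_zero] at h6
    rw [← h6, updateCount, h4, updateCount]
  simp only [hc, increment]
  rfl

/-- An update at time `a > 0` forces an update in `(a - ε, a]`, which has probability `1 - exp(-ε) ≤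
ε`. -/
lemma IsPoissonProcess.measure_eq [IsProbabilityMeasure P] (hT : IsPoissonProcess P T)
    (m : ℕ) (a : ℝ) : P {ω | T m ω = a} = 0 := by
  by_cases ha : 0 < a
  · have key : ∀ ε, 0 < ε → ε ≤ a → P.real {ω | T m ω = a} ≤ ε := by
      intro ε h0 hε
      have h1 := hT.measureReal_one_le_increment (a := a - ε) (b := a) (by linarith) (by linarith)
      have h2 : P.real {ω | T m ω = a} ≤ P.real {ω | 1 ≤ increment (fun m => T m ω) (a - ε) a} := by
        refine ENNReal.toReal_mono (measure_ne_top _ _) (measure_mono_ae ?_)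
        filter_upwards [hT.strictMono, hT.tendsto] with ω h3 h4 h5
        have h5 : T m ω = a := h5
        have h6 : m < numUpdates (fun m => T m ω) a := (lt_numUpdates h3 h4).2 h5.le
        have h7 : numUpdates (fun m => T m ω) (a - ε) ≤ m :=
          (numUpdates_le h3 h4).2 (by simp only [h5]; linarith)
        change 1 ≤ numUpdates _ a - numUpdates _ (a - ε)
        omega
      have h3 := Real.add_one_le_exp (-(a - (a - ε)))
      linarith
    have h0 : P.real {ω | T m ω = a} ≤ 0 := by
      refine le_of_forall_pos_le_add fun ε hε => ?_
      have h1 := key (min ε a) (lt_min hε ha) (min_le_right _ _)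
      have h2 := min_le_left ε a
      linarith
    rw [← measureReal_eq_zero_iff]
    exact le_antisymm h0 measureReal_nonneg
  · refine measure_mono_null (t := {ω | ¬ ∀ m, 0 < T m ω}) (fun ω hω h => ?_) hT.pos
    have hω : T m ω = a := hω
    exact ha (hω ▸ h m)

end single

variable [IsProbabilityMeasure P] {T : Fin n → ℕ → Ω → ℝ}

/-- The update times are independent Poisson processes. -/
structure IndepPoissonClocks (P : Measure Ω) (T : Fin n → ℕ → Ω → ℝ) : Prop where
  poisson : ∀ v, IsPoissonProcess P (T v)
  indep : iIndepFun (fun (v : Fin n) ω (m : ℕ) => T v m ω) P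

/-! ### Independent Poisson clocks -/

namespace IndepPoissonClocks

variable (hT : IndepPoissonClocks P T)

include hT

/-- Ties between distinct sites are null by Fubini: the times are independent, and those of one site
have no atoms. -/
lemma ae_regular : ∀ᵐ ω ∂P, Regular (clocks T ω) := by
  have h1 : ∀ᵐ ω ∂P, ∀ v, StrictMono fun m => T v m ω :=
    ae_all_iff.2 fun v => (hT.poisson v).strictMono
  have h2 : ∀ᵐ ω ∂P, ∀ v, Tendsto (fun m => T v m ω) atTop atTop :=
    ae_all_iff.2 fun v => (hT.poisson v).tendsto
  have h3 : ∀ v w l m, ∀ᵐ ω ∂P, T v l ω = T w m ω → v = w := by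
    intro v w l m
    by_cases hvw : v = w
    · exact ae_of_all _ fun ω _ => hvw
    have hi : IndepFun (T v l) (T w m) P :=
      (hT.indep.indepFun hvw).comp (measurable_pi_apply l) (measurable_pi_apply m)
    have hv := (hT.poisson v).measurable l
    have hw := (hT.poisson w).measurable m
    have hd : MeasurableSet {p : ℝ × ℝ | p.1 = p.2} :=
      measurableSet_eq_fun measurable_fst measurable_snd
    have h4 : P {ω | T v l ω = T w m ω} = 0 := by
      have h5 : P {ω | T v l ω = T w m ω} =
          P.map (fun ω => (T v l ω, T w m ω)) {p : ℝ × ℝ | p.1 = p.2} := by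
        rw [Measure.map_apply (hv.prodMk hw) hd]
        rfl
      rw [h5, (indepFun_iff_map_prod_eq_prod_map_map hv.aemeasurable hw.aemeasurable).1 hi,
        Measure.measure_prod_null hd]
      refine ae_of_all _ fun x => ?_
      beta_reduce
      rw [Measure.map_apply hw (measurable_prodMk_left hd)]
      have h6 : T w m ⁻¹' (Prod.mk x ⁻¹' {p : ℝ × ℝ | p.1 = p.2}) = {ω | T w m ω = x} := by
        ext ω
        exact eq_comm
      rw [h6]
      exact (hT.poisson w).measure_eq m x
    have h7 : ∀ᵐ ω ∂P, ¬ T v l ω = T w m ω := by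
      rw [ae_iff]
      simpa using h4
    filter_upwards [h7] with ω h h'
    exact absurd h' h
  have h4 : ∀ᵐ ω ∂P, ∀ v w l m, T v l ω = T w m ω → v = w :=
    ae_all_iff.2 fun v => ae_all_iff.2 fun w => ae_all_iff.2 fun l => ae_all_iff.2 fun m =>
      h3 v w l m
  filter_upwards [h1, h2, h4] with ω h1 h2 h4
  exact ⟨h1, h2, h4⟩

lemma ae_avoids (a : ℕ → ℝ) : ∀ᵐ ω ∂P, ∀ v m p, clocks T ω v m ≠ a p :=
  ae_all_iff.2 fun v => ae_all_iff.2 fun m => ae_all_iff.2 fun p => by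
    rw [ae_iff]
    simpa [clocks] using (hT.poisson v).measure_eq m (a p)

omit [IsProbabilityMeasure P] in
lemma iIndepFun_increment {a : ℕ → ℝ} (ha0 : ∀ p, 0 ≤ a p) (ha : Monotone a) :
    iIndepFun (fun (q : Fin n × ℕ) ω => increment (clocks T ω q.1) (a q.2) (a (q.2 + 1))) P := by
  refine iIndepFun_uncurry' (X := fun v p ω => increment (clocks T ω v) (a p) (a (p + 1)))
    (fun v p => (hT.poisson v).measurable_increment _ _) ?_
    fun v => (hT.poisson v).iIndepFun_increment ha0 ha
  exact hT.indep.comp (fun v (τ : ℕ → ℝ) p => increment τ (a p) (a (p + 1))) fun v =>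
    measurable_pi_lambda _ fun p =>
      MRF.measurable_increment measurable_id measurable_const measurable_const

omit [IsProbabilityMeasure P] in
lemma measurable_clocks : Measurable (clocks T) :=
  measurable_pi_lambda _ fun v => measurable_pi_lambda _ fun m => (hT.poisson v).measurable m

/-- Infinitely many blocks of the grid with mesh `L` are good. -/
lemma ae_frequently_goodBlock {L : ℝ} (hL : 0 < L) {i j : Fin n} (hij : i ≠ j) :
    ∀ᵐ ω ∂P, ∃ᶠ q : ℕ in atTop, GoodBlock (clocks T ω i) (clocks T ω j) L (q * L) := by
  set a : ℕ → ℝ := fun p => p * (L / 3) with ha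
  have ha0 : ∀ p, 0 ≤ a p := fun p => by positivity
  have ham : Monotone a := fun p q hpq => by
    simp only [ha]; gcongr
  set N : ℕ × (Fin n × Fin 3) → Ω → ℕ := fun q ω =>
    increment (clocks T ω q.2.1) (a (3 * q.1 + q.2.2)) (a (3 * q.1 + q.2.2 + 1)) with hN
  have hNm : ∀ q, Measurable (N q) := fun q => (hT.poisson q.2.1).measurable_increment _ _
  have hNi : iIndepFun N P := (hT.iIndepFun_increment ha0 ham).precomp
    (g := fun q : ℕ × (Fin n × Fin 3) => (q.2.1, 3 * q.1 + q.2.2)) (by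
      rintro ⟨q, v, c⟩ ⟨q', v', c'⟩ h
      simp only [Prod.mk.injEq] at h
      have h1 := c.2
      have h2 := c'.2
      have h3 : q = q' := by omega
      have h4 : c = c' := Fin.ext (by omega)
      simp [h.1, h3, h4])
  -- Exact update counts that imply a good block. Also silencing all other sites is harmless, since
  -- only positive probability is needed.
  set pattern : Fin n × Fin 3 → ℕ := fun p =>
    if p.1 = i then ![2, 0, 2] p.2 else if p.1 = j then ![0, 1, 0] p.2 else 0 with hpat
  set E : ℕ → Set Ω := fun q => (fun ω k => N (q, k) ω) ⁻¹' {pattern} with hE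
  have hEm : ∀ q, MeasurableSet (E q) := fun q =>
    (measurable_pi_lambda _ fun k => hNm _) (measurableSet_singleton _)
  have hEi : iIndepSet E P := by
    rw [iIndepSet_iff_meas_biInter hEm]
    intro s
    exact (iIndepFun_curry hNm hNi).measure_inter_preimage_eq_mul s
      fun _ _ => measurableSet_singleton _
  set c : ENNReal := ∏ k : Fin n × Fin 3, poissonMeasure (L / 3).toNNReal {pattern k} with hc
  have hc0 : c ≠ 0 := by
    rw [hc, Finset.prod_ne_zero_iff]
    intro k _ h
    have h1 := poissonMeasure_real_singleton_pos (r := (L / 3).toNNReal) (pattern k)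
      (by simpa using hL)
    rw [measureReal_def, h] at h1
    simp at h1
  have hEP : ∀ q, P (E q) = c := by
    intro q
    have h1 : E q = ⋂ k : Fin n × Fin 3, N (q, k) ⁻¹' {pattern k} := by
      ext ω
      simp [hE, funext_iff]
    have h2 : iIndepFun (fun k => N (q, k)) P :=
      hNi.precomp (g := fun k => (q, k)) (Prod.mk_right_injective q)
    rw [h1]
    have h3 := h2.measure_inter_preimage_eq_mul Finset.univ (sets := fun k => {pattern k})
      fun k _ => measurableSet_singleton _
    simp only [Finset.mem_univ, Set.iInter_true] at h3
    rw [h3]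
    refine Finset.prod_congr rfl fun k _ => ?_
    have h4 := (hT.poisson k.1).measureReal_increment_eq (ha0 (3 * q + k.2))
      (ham (Nat.le_succ (3 * q + k.2))) {pattern k}
    have h5 : a (3 * q + k.2 + 1) - a (3 * q + k.2) = L / 3 := by
      simp only [ha]; push_cast; ring
    rw [h5] at h4
    exact (measureReal_eq_measureReal_iff).1 h4
  -- Second Borel–Cantelli lemma: the events concern disjoint blocks and have the same positive
  -- probability.
  have hlim := measure_limsup_eq_one hEm hEi (by simp [hEP, ENNReal.tsum_const_eq_top_of_ne_zero hc0])
  have hlim' : ∀ᵐ ω ∂P, ω ∈ limsup E atTop := by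
    rw [← prob_compl_eq_zero_iff (MeasurableSet.measurableSet_limsup hEm)] at hlim
    exact hlim
  filter_upwards [hlim', hT.ae_regular] with ω hω hr
  rw [mem_limsup_iff_frequently_mem] at hω
  refine hω.mono fun q hq => ?_
  have h1 : ∀ v b, N (q, v, b) ω = pattern (v, b) := fun v b => congrFun hq (v, b)
  have e0 : a (3 * q) = q * L := by simp only [ha]; push_cast; ring
  have e1 : a (3 * q + 1) = q * L + L / 3 := by simp only [ha]; push_cast; ring
  have e2 : a (3 * q + 2) = q * L + 2 * L / 3 := by simp only [ha]; push_cast; ring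
  have e3 : a (3 * q + 3) = q * L + L := by simp only [ha]; push_cast; ring
  have hmono := fun v => hr.numUpdates_mono v
  have m01 := fun v => hmono v (by linarith : q * L ≤ q * L + L / 3)
  have m12 := fun v => hmono v (by linarith : q * L + L / 3 ≤ q * L + 2 * L / 3)
  have m23 := fun v => hmono v (by linarith : q * L + 2 * L / 3 ≤ q * L + L)
  have i0 := h1 i 0
  have i1 := h1 i 1
  have i2 := h1 i 2
  have j0 := h1 j 0
  have j1 := h1 j 1
  have j2 := h1 j 2
  simp only [hN, increment, hpat, Fin.isValue, Fin.coe_ofNat_eq_mod, Nat.zero_mod, Nat.one_mod,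
    Nat.reduceMod, add_zero, Nat.add_assoc, Nat.reduceAdd, e0, e1, e2, e3, if_true,
    if_neg hij.symm, Matrix.cons_val] at i0 i1 i2 j0 j1 j2
  have mi := m01 i
  have mi' := m12 i
  have mi'' := m23 i
  have mj := m01 j
  have mj' := m12 j
  have mj'' := m23 j
  constructor <;> omega

end IndepPoissonClocks

end

section

/-! ### The sequence of good blocks -/

/-- The indices of the good blocks, forced to be at distance at least `r`. -/
def blockTimes (L : ℝ) (r : ℕ) (ti tj : ℕ → ℝ) : ℕ → ℕ
  | 0 => 0
  | s + 1 => max (blockTimes L r ti tj s + r)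
      (sInf {l : ℕ | blockTimes L r ti tj s + r ≤ l ∧ GoodBlock ti tj L (blockStart L r l)})

/-- The `max` makes the spacing hold for all clocks, even where no good block is left and `sInf ∅ =
0`. It can thus be used for every frozen value of the clocks of `i` and `j`. -/
lemma blockTimes_add_le (L : ℝ) (r : ℕ) (ti tj : ℕ → ℝ) (s : ℕ) :
    blockTimes L r ti tj s + r ≤ blockTimes L r ti tj (s + 1) := le_max_left _ _

lemma measurableSet_goodBlock {α : Type*} [MeasurableSpace α] {ti tj : α → ℕ → ℝ}
    (hi : Measurable ti) (hj : Measurable tj) (L b : ℝ) :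
    MeasurableSet {a | GoodBlock (ti a) (tj a) L b} := by
  have Ni : ∀ u, Measurable fun a => numUpdates (ti a) u := fun u =>
    measurable_numUpdates hi measurable_const
  have Nj : ∀ u, Measurable fun a => numUpdates (tj a) u := fun u =>
    measurable_numUpdates hj measurable_const
  have : {a | GoodBlock (ti a) (tj a) L b} =
      {a | numUpdates (ti a) b + 2 ≤ numUpdates (ti a) (b + L / 3)} ∩
      {a | numUpdates (ti a) (b + L / 3) = numUpdates (ti a) (b + 2 * L / 3)} ∩
      {a | numUpdates (ti a) (b + 2 * L / 3) + 2 ≤ numUpdates (ti a) (b + L)} ∩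
      {a | numUpdates (tj a) b = numUpdates (tj a) (b + L / 3)} ∩
      {a | numUpdates (tj a) (b + L / 3) < numUpdates (tj a) (b + 2 * L / 3)} ∩
      {a | numUpdates (tj a) (b + 2 * L / 3) = numUpdates (tj a) (b + L)} := by
    ext a
    simp only [Set.mem_inter_iff, Set.mem_ofPred_eq]
    exact ⟨fun ⟨h1, h2, h3, h4, h5, h6⟩ => ⟨⟨⟨⟨⟨h1, h2⟩, h3⟩, h4⟩, h5⟩, h6⟩,
      fun ⟨⟨⟨⟨⟨h1, h2⟩, h3⟩, h4⟩, h5⟩, h6⟩ => ⟨h1, h2, h3, h4, h5, h6⟩⟩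
  rw [this]
  exact ((((((measurableSet_le ((Ni _).add_const 2) (Ni _)).inter
    (measurableSet_eq_fun (Ni _) (Ni _))).inter
    (measurableSet_le ((Ni _).add_const 2) (Ni _))).inter
    (measurableSet_eq_fun (Nj _) (Nj _))).inter
    (measurableSet_lt (Nj _) (Nj _))).inter (measurableSet_eq_fun (Nj _) (Nj _)))

lemma measurable_blockTimes {α : Type*} [MeasurableSpace α] {ti tj : α → ℕ → ℝ}
    (hi : Measurable ti) (hj : Measurable tj) (L : ℝ) (r s : ℕ) :
    Measurable fun a => blockTimes L r (ti a) (tj a) s := by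
  induction s with
  | zero => exact measurable_const
  | succ s ih =>
    refine (ih.add_const r).max (measurable_sInf_nat fun l => ?_)
    exact (measurableSet_le (ih.add_const r) measurable_const).inter
      (measurableSet_goodBlock hi hj L _)

lemma updateCount_Icc {t : ℕ → ℝ} (hm : StrictMono t) (ht : Tendsto t atTop atTop) {u w : ℝ}
    (hu : ∀ m, t m ≠ u) : updateCount t (Set.Icc u w) = increment t u w := by
  have : {m | t m ∈ Set.Icc u w} = {m | t m ∈ Set.Ioc u w} := by
    ext m
    simp only [Set.mem_ofPred_eq, Set.mem_Icc, Set.mem_Ioc, lt_iff_le_and_ne, and_assoc]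
    exact ⟨fun h => ⟨h.1, (hu m).symm, h.2⟩, fun h => ⟨h.1, h.2.2⟩⟩
  rw [increment, ← updateCount_Ioc hm ht, updateCount, updateCount, this]

lemma forall_notMem_Icc_iff {t : ℕ → ℝ} (hm : StrictMono t) (ht : Tendsto t atTop atTop) {u w : ℝ}
    (huw : u ≤ w) (hu : ∀ m, t m ≠ u) :
    (∀ m, t m ∉ Set.Icc u w) ↔ numUpdates t u = numUpdates t w := by
  have hmono := numUpdates_mono hm ht huw
  constructor
  · intro h
    by_contra hne
    have hlt : numUpdates t u < numUpdates t w := lt_of_le_of_ne hmono hne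
    exact h (numUpdates t u)
      ⟨((numUpdates_le hm ht).1 le_rfl).le, (lt_numUpdates hm ht).1 hlt⟩
  · rintro h m ⟨h1, h2⟩
    have h3 := (lt_numUpdates hm ht).2 h2
    rw [← h, lt_numUpdates hm ht] at h3
    exact hu m (le_antisymm h3 h1)

lemma blockStart_eq {L : ℝ} {r : ℕ} (hr : 1 ≤ r) (l : ℕ) :
    blockStart L r l = ((l + r - 1 : ℕ) : ℝ) * L := by
  rw [blockStart, Nat.cast_sub (by omega)]
  push_cast
  ring

variable {n : ℕ}

/-- The closed thirds of `GoodWindow` and the half-open ones of `GoodBlock` differ only at grid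
points, which no update time hits. The condition `1 ≤ r` makes `l + r - 1` a genuine natural number.
-/
lemma goodWindow_iff {t : Clocks n} (ht : Regular t) {L : ℝ} (hL : 0 < L) {r : ℕ} (hr : 1 ≤ r)
    (hgrid : ∀ v m (p : ℕ), t v m ≠ p * (L / 3)) (i j : Fin n) (l : ℕ) :
    GoodWindow L r (t i) (t j) l ↔ GoodBlock (t i) (t j) L (blockStart L r l) := by
  set b := blockStart L r l with hb
  have hb' : b = ((l + r - 1 : ℕ) : ℝ) * L := blockStart_eq hr l
  have h0 : ∀ v m, t v m ≠ b := fun v m h =>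
    hgrid v m (3 * (l + r - 1)) (by rw [h, hb']; push_cast; ring)
  have h1 : ∀ v m, t v m ≠ b + L / 3 := fun v m h =>
    hgrid v m (3 * (l + r - 1) + 1) (by rw [h, hb']; push_cast; ring)
  have h2 : ∀ v m, t v m ≠ b + 2 * L / 3 := fun v m h =>
    hgrid v m (3 * (l + r - 1) + 2) (by rw [h, hb']; push_cast; ring)
  have e1 := updateCount_Icc (ht.strictMono i) (ht.tendsto i) (h0 i) (w := b + L / 3)
  have e2 := updateCount_Icc (ht.strictMono j) (ht.tendsto j) (h1 j) (w := b + 2 * L / 3)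
  have e3 := updateCount_Icc (ht.strictMono i) (ht.tendsto i) (h2 i) (w := b + L)
  have f1 := forall_notMem_Icc_iff (ht.strictMono j) (ht.tendsto j)
    (by linarith : b ≤ b + L / 3) (h0 j)
  have f2 := forall_notMem_Icc_iff (ht.strictMono i) (ht.tendsto i)
    (by linarith : b + L / 3 ≤ b + 2 * L / 3) (h1 i)
  have f3 := forall_notMem_Icc_iff (ht.strictMono j) (ht.tendsto j)
    (by linarith : b + 2 * L / 3 ≤ b + L) (h2 j)
  rw [GoodWindow, firstThird, middleThird, lastThird, ← hb, e1, e2, e3, f1, f2, f3]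
  have m1 := ht.numUpdates_mono i (by linarith : b ≤ b + L / 3)
  have m2 := ht.numUpdates_mono j (by linarith : b + L / 3 ≤ b + 2 * L / 3)
  have m3 := ht.numUpdates_mono i (by linarith : b + 2 * L / 3 ≤ b + L)
  simp only [increment]
  constructor
  · rintro ⟨⟨g1, g2⟩, ⟨g3, g4⟩, g5, g6⟩
    exact ⟨by omega, g3, by omega, g2, by omega, g6⟩
  · rintro ⟨g1, g2, g3, g4, g5, g6⟩
    exact ⟨⟨by omega, g4⟩, ⟨g2, by omega⟩, by omega, g6⟩

/-- Update times that are generic with respect to the blocks of length `L`, with infinitely many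
good blocks for `i` and `j`. -/
structure Generic (L : ℝ) (i j : Fin n) (t : Clocks n) : Prop extends Regular t where
  avoids : ∀ v m (p : ℕ), t v m ≠ p * (L / 3)
  frequently_good : ∃ᶠ q : ℕ in atTop, GoodBlock (t i) (t j) L (q * L)

namespace Generic

variable {L : ℝ} {i j : Fin n} {t : Clocks n} (h : Generic L i j t) {r : ℕ} (hr : 1 ≤ r)

include h hr

lemma exists_goodBlock (a : ℕ) : ∃ l, a ≤ l ∧ GoodBlock (t i) (t j) L (blockStart L r l) := by
  obtain ⟨q, hq, hg⟩ := (frequently_atTop.1 h.frequently_good) (a + r)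
  refine ⟨q + 1 - r, by omega, ?_⟩
  rw [blockStart_eq hr]
  have : q + 1 - r + r - 1 = q := by omega
  rwa [this]

lemma blockTimes_succ (s : ℕ) :
    blockTimes L r (t i) (t j) (s + 1) = sInf {l : ℕ | blockTimes L r (t i) (t j) s + r ≤ l ∧
      GoodBlock (t i) (t j) L (blockStart L r l)} :=
  max_eq_right (Nat.sInf_mem (s := {l : ℕ | blockTimes L r (t i) (t j) s + r ≤ l ∧
    GoodBlock (t i) (t j) L (blockStart L r l)}) (h.exists_goodBlock hr _)).1

lemma goodBlock_blockTimes (s : ℕ) :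
    GoodBlock (t i) (t j) L (blockStart L r (blockTimes L r (t i) (t j) (s + 1))) := by
  rw [h.blockTimes_succ hr]
  exact (Nat.sInf_mem (s := {l : ℕ | blockTimes L r (t i) (t j) s + r ≤ l ∧
    GoodBlock (t i) (t j) L (blockStart L r l)}) (h.exists_goodBlock hr _)).2

lemma tau_eq_blockTimes (hL : 0 < L) (s : ℕ) :
    tau L r (t i) (t j) s = blockTimes L r (t i) (t j) s := by
  induction s with
  | zero => rfl
  | succ s ih =>
    rw [h.blockTimes_succ hr, tau, ih]
    simp only [goodWindow_iff h.toRegular hL hr h.avoids]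

/-- The statistic in a good window in terms of the first updates in the first and last third. -/
lemma statZ_eq_blockStat (X : ℝ → Config n) (y : History n)
    (hy : ∀ m, X (t i m) i = y.2 i m) {l : ℕ}
    (hg : GoodBlock (t i) (t j) L (blockStart L r l)) :
    statZ L r (fun u => X u i) (t i) l = blockStat t i L (blockStart L r l) y := by
  set b := blockStart L r l with hb
  have hb' : b = ((l + r - 1 : ℕ) : ℝ) * L := blockStart_eq hr l
  have h0 : ∀ m, t i m ≠ b := fun m hm =>
    h.avoids i m (3 * (l + r - 1)) (by rw [hm, hb']; push_cast; ring)
  have h2 : ∀ m, t i m ≠ b + 2 * L / 3 := fun m hm =>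
    h.avoids i m (3 * (l + r - 1) + 2) (by rw [hm, hb']; push_cast; ring)
  -- The indices of the updates in `[u, w]` form an interval beginning at `numUpdates (t i) u`, so
  -- `Nat.nth` enumerates it in order.
  have key : ∀ u w : ℝ, (∀ m, t i m ≠ u) → numUpdates (t i) u + 2 ≤ numUpdates (t i) w →
      Nat.nth (fun m => t i m ∈ Set.Icc u w) 0 = numUpdates (t i) u ∧
      Nat.nth (fun m => t i m ∈ Set.Icc u w) 1 = numUpdates (t i) u + 1 := by
    classical
    intro u w hu huw
    set a := numUpdates (t i) u
    have hmem : ∀ m, t i m ∈ Set.Icc u w ↔ a ≤ m ∧ m < numUpdates (t i) w := by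
      intro m
      rw [h.toRegular.numUpdates_le, h.toRegular.lt_numUpdates, Set.mem_Icc]
      exact and_congr_left fun _ => ⟨fun h1 => lt_of_le_of_ne h1 (hu m).symm, le_of_lt⟩
    have hc0 : Nat.count (fun m => t i m ∈ Set.Icc u w) a = 0 := by
      rw [Nat.count_eq_card_filter_range, Finset.card_eq_zero, Finset.filter_eq_empty_iff]
      intro m hm hm'
      have := ((hmem m).1 hm').1
      have := Finset.mem_range.1 hm
      omega
    have hc1 : Nat.count (fun m => t i m ∈ Set.Icc u w) (a + 1) = 1 := by
      rw [Nat.count_succ, hc0, if_pos ((hmem a).2 ⟨le_rfl, by omega⟩)]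
    have hn0 := Nat.nth_count (p := fun m => t i m ∈ Set.Icc u w)
      ((hmem a).2 ⟨le_rfl, by omega⟩)
    have hn1 := Nat.nth_count (p := fun m => t i m ∈ Set.Icc u w)
      ((hmem (a + 1)).2 ⟨by omega, by omega⟩)
    rw [hc0] at hn0
    rw [hc1] at hn1
    exact ⟨hn0, hn1⟩
  obtain ⟨k0, k1⟩ := key b (b + L / 3) h0 hg.first_i
  obtain ⟨k2, k3⟩ := key (b + 2 * L / 3) (b + L) h2 hg.last_i
  simp only [statZ, updateIndicator, firstThird, lastThird, ← hb, k0, k1, k2, k3, hy, blockStat,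
    pairStat, ind]

end Generic

/-! ### Exponential moments of functions of the clocks of the other sites -/

/-- A function `G` of the numbers of updates of the sites other than `i` and `j` in `(b - σ, b]` and
in `(b, b + L]`. -/
def windowStat {i j : Fin n} (G : ((({i, j}ᶜ : Finset (Fin n))) → ℕ) →
    ((({i, j}ᶜ : Finset (Fin n))) → ℕ) → ℝ) (σ L : ℝ)
    (w : (({i, j}ᶜ : Finset (Fin n))) → ℕ → ℝ) (b : ℝ) : ℝ :=
  G (fun v => increment (w v) (b - σ) b) (fun v => increment (w v) b (b + L))

section

variable {i j : Fin n} {G : ((({i, j}ᶜ : Finset (Fin n))) → ℕ) →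
    ((({i, j}ᶜ : Finset (Fin n))) → ℕ) → ℝ} {σ L : ℝ}

lemma measurable_windowStat {α : Type*} [MeasurableSpace α]
    {w : α → (({i, j}ᶜ : Finset (Fin n))) → ℕ → ℝ} {b : α → ℝ}
    (hw : Measurable w) (hb : Measurable b) :
    Measurable fun a => windowStat G σ L (w a) (b a) := by
  have h : Measurable fun q : ((({i, j}ᶜ : Finset (Fin n))) → ℕ) ×
    ((({i, j}ᶜ : Finset (Fin n))) → ℕ) => G q.1 q.2 := Measurable.of_discrete
  refine h.comp (Measurable.prodMk ?_ ?_)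
  · exact measurable_pi_lambda _ fun _ => measurable_increment hw.eval (hb.sub_const σ) hb
  · exact measurable_pi_lambda _ fun _ => measurable_increment hw.eval hb (hb.add_const L)

/-- The end points of disjoint windows. -/
def windowGrid (σ L : ℝ) (b : ℕ → ℝ) (p : ℕ) : ℝ :=
  if p % 3 = 0 then b (p / 3) - σ else if p % 3 = 1 then b (p / 3) else b (p / 3) + L

lemma windowGrid_mono {b : ℕ → ℝ} (hσ : 0 ≤ σ) (hL : 0 ≤ L)
    (hb : ∀ s, b s + L ≤ b (s + 1) - σ) : Monotone (windowGrid σ L b) := by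
  refine monotone_nat_of_le_succ fun p => ?_
  obtain ⟨s, c, hc, rfl⟩ : ∃ s c, c < 3 ∧ p = 3 * s + c :=
    ⟨p / 3, p % 3, Nat.mod_lt _ (by norm_num), (Nat.div_add_mod p 3).symm⟩
  have h1 : ∀ s, (3 * s) / 3 = s ∧ (3 * s + 1) / 3 = s ∧ (3 * s + 2) / 3 = s ∧
      (3 * s + 3) / 3 = s + 1 ∧ (3 * s) % 3 = 0 ∧ (3 * s + 1) % 3 = 1 ∧ (3 * s + 2) % 3 = 2 ∧
      (3 * s + 3) % 3 = 0 := fun s => by omega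
  obtain ⟨a1, a2, a3, a4, a5, a6, a7, a8⟩ := h1 s
  interval_cases c
  · simp only [windowGrid, add_zero, a1, a2, a5, a6]; norm_num; exact hσ
  · simp only [windowGrid, Nat.add_assoc, Nat.reduceAdd, a2, a3, a6, a7]; norm_num; exact hL
  · simp only [windowGrid, Nat.add_assoc, Nat.reduceAdd, a3, a4, a7, a8]; norm_num; exact hb s

lemma exp_neg_mul_le_of_abs_le_three {θ z : ℝ} (hθ : 0 ≤ θ) (hθ' : 3 * θ ≤ 1) (hz : |z| ≤ 3) :
    Real.exp (-θ * z) ≤ 1 - θ * z + 9 * θ ^ 2 := by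
  have h1 : |-θ * z| ≤ 1 := by
    rw [abs_mul, abs_neg, abs_of_nonneg hθ]
    nlinarith
  have h2 := (abs_le.1 (Real.abs_exp_sub_one_sub_id_le h1)).2
  have h3 : z ^ 2 ≤ 9 := by
    have := sq_abs z ▸ pow_le_pow_left₀ (abs_nonneg z) hz 2
    linarith
  nlinarith [sq_nonneg θ]

variable {Ω : Type*} [MeasurableSpace Ω] {P : Measure Ω} [IsProbabilityMeasure P]
  {T : Fin n → ℕ → Ω → ℝ}

lemma integrable_exp_of_abs_le {α : Type*} [MeasurableSpace α] {ν : Measure α} [IsFiniteMeasure ν]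
    {f : α → ℝ} (hf : Measurable f) {C : ℝ} (hC : ∀ a, |f a| ≤ C) :
    Integrable (fun a => Real.exp (f a)) ν := by
  refine Integrable.of_bound hf.exp.aestronglyMeasurable (Real.exp C) (ae_of_all _ fun a => ?_)
  rw [Real.norm_eq_abs, Real.abs_exp]
  exact Real.exp_le_exp.2 ((le_abs_self _).trans (hC a))

lemma abs_neg_mul_sum_le {θ : ℝ} (hθ : 0 ≤ θ) {f : ℕ → ℝ} {C : ℝ} (hf : ∀ s, |f s| ≤ C) (M : ℕ) :
    |-θ * ∑ s ∈ Finset.range M, f s| ≤ θ * (M * C) := by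
  rw [abs_mul, abs_neg, abs_of_nonneg hθ]
  refine mul_le_mul_of_nonneg_left ((Finset.abs_sum_le_sum_abs _ _).trans ?_) hθ
  refine (Finset.sum_le_sum fun s _ => hf s).trans_eq ?_
  simp

/-- The update times of the sites other than `i` and `j`. -/
def otherClocks (T : Fin n → ℕ → Ω → ℝ) (i j : Fin n) (ω : Ω) :
    (({i, j}ᶜ : Finset (Fin n))) → ℕ → ℝ := fun v => clocks T ω v

omit [IsProbabilityMeasure P] in
lemma IndepPoissonClocks.measurable_otherClocks (hT : IndepPoissonClocks P T) (i j : Fin n) :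
    Measurable (otherClocks T i j) :=
  measurable_pi_lambda _ fun _ => hT.measurable_clocks.eval

/-- Exponential moment over deterministic disjoint windows. -/
lemma IndepPoissonClocks.integral_exp_windowStat_le (hT : IndepPoissonClocks P T)
    (hG : ∀ x x', |G x x'| ≤ 3) {θ m : ℝ} (hθ : 0 ≤ θ) (hθ' : 3 * θ ≤ 1)
    (hσ : 0 ≤ σ) (hL : 0 ≤ L) {b : ℕ → ℝ} (hb0 : σ ≤ b 0) (hb : ∀ s, b s + L ≤ b (s + 1) - σ)
    (hm : ∀ s, m ≤ ∫ ω, windowStat G σ L (otherClocks T i j ω) (b s) ∂P) (M : ℕ) :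
    ∫ ω, Real.exp (-θ * ∑ s ∈ Finset.range M,
      windowStat G σ L (otherClocks T i j ω) (b s)) ∂P ≤
      Real.exp (M * (-θ * m + 9 * θ ^ 2)) := by
  set a := windowGrid σ L b with ha
  have ham : Monotone a := windowGrid_mono hσ hL hb
  have ha0 : ∀ p, 0 ≤ a p := fun p => by
    refine le_trans ?_ (ham (Nat.zero_le p))
    simp [ha, windowGrid, hb0]
  -- Cells `3s` and `3s + 1` of the grid are the two parts of window `s`. Cell `3s + 2` is the gap
  -- to the next window and is dropped.
  set N : ℕ × ((({i, j}ᶜ : Finset (Fin n))) × Fin 2) → Ω → ℕ := fun q ω =>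
    increment (clocks T ω q.2.1) (a (3 * q.1 + q.2.2)) (a (3 * q.1 + q.2.2 + 1)) with hN
  have hNm : ∀ q, Measurable (N q) := fun q => (hT.poisson q.2.1).measurable_increment _ _
  have hNi : iIndepFun N P := (hT.iIndepFun_increment ha0 ham).precomp
    (g := fun q : ℕ × ((({i, j}ᶜ : Finset (Fin n))) × Fin 2) => ((q.2.1 : Fin n), 3 * q.1 + q.2.2))
    (by
      rintro ⟨q, v, c⟩ ⟨q', v', c'⟩ h
      simp only [Prod.mk.injEq] at h
      have h1 := c.2
      have h2 := c'.2
      have h3 : q = q' := by omega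
      have h4 : c = c' := Fin.ext (by omega)
      simp [Subtype.ext h.1, h3, h4])
  have hind : iIndepFun (fun s ω => windowStat G σ L (otherClocks T i j ω) (b s)) P := by
    have h1 := (iIndepFun_curry hNm hNi).comp
      (fun _ (k : (({i, j}ᶜ : Finset (Fin n))) × Fin 2 → ℕ) =>
        G (fun v => k (v, 0)) (fun v => k (v, 1))) fun _ => Measurable.of_discrete
    refine (iIndepFun_congr fun s => ae_of_all _ fun ω => ?_).1 h1
    have e0 : a (3 * s) = b s - σ := by simp [ha, windowGrid]
    have e1 : a (3 * s + 1) = b s := by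
      have h1 : (3 * s + 1) % 3 = 1 := by omega
      have h2 : (3 * s + 1) / 3 = s := by omega
      simp [ha, windowGrid, h1, h2]
    have e2 : a (3 * s + 1 + 1) = b s + L := by
      have h1 : (3 * s + 1 + 1) % 3 = 2 := by omega
      have h2 : (3 * s + 1 + 1) / 3 = s := by omega
      simp [ha, windowGrid, h1, h2]
    simp [hN, windowStat, otherClocks, e0, e1, e2]
  have hmeas : ∀ s, Measurable fun ω => windowStat G σ L (otherClocks T i j ω) (b s) := fun s =>
    measurable_windowStat (hT.measurable_otherClocks i j) measurable_const
  have hmgf := hind.mgf_sum hmeas (Finset.range M) (t := -θ)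
  simp only [mgf, Finset.sum_apply] at hmgf
  rw [hmgf]
  have hone : ∀ s, ∫ ω, Real.exp (-θ * windowStat G σ L (otherClocks T i j ω) (b s)) ∂P ≤
      Real.exp (-θ * m + 9 * θ ^ 2) := by
    intro s
    have hi : Integrable (fun ω => windowStat G σ L (otherClocks T i j ω) (b s)) P :=
      Integrable.of_bound (hmeas s).aestronglyMeasurable 3 (ae_of_all _ fun ω => hG _ _)
    calc _ ≤ ∫ ω, ((1 + 9 * θ ^ 2) - θ * windowStat G σ L (otherClocks T i j ω) (b s)) ∂P := by
          refine integral_mono (integrable_exp_of_abs_le ((hmeas s).const_mul _) (C := θ * 3)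
            fun ω => ?_) ((integrable_const _).sub (hi.const_mul _)) fun ω => ?_
          · rw [abs_mul, abs_neg, abs_of_nonneg hθ]
            exact mul_le_mul_of_nonneg_left (hG _ _) hθ
          · have := exp_neg_mul_le_of_abs_le_three hθ hθ'
              (hG (fun v => increment (otherClocks T i j ω v) (b s - σ) (b s))
                (fun v => increment (otherClocks T i j ω v) (b s) (b s + L)))
            simp only [windowStat]
            linarith
      _ = (1 + 9 * θ ^ 2) - θ * ∫ ω, windowStat G σ L (otherClocks T i j ω) (b s) ∂P := by
          rw [integral_sub (integrable_const _) (hi.const_mul _), integral_const_mul]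
          simp
      _ ≤ (-θ * m + 9 * θ ^ 2) + 1 := by
          have := mul_le_mul_of_nonneg_left (hm s) hθ
          linarith
      _ ≤ _ := Real.add_one_le_exp _
  calc _ ≤ ∏ s ∈ Finset.range M, Real.exp (-θ * m + 9 * θ ^ 2) :=
        Finset.prod_le_prod (fun s _ => integral_nonneg fun ω => (Real.exp_pos _).le)
          fun s _ => hone s
    _ = _ := by rw [Finset.prod_const, Finset.card_range, ← Real.exp_nat_mul]

/-- Exponential moment over the windows that end at the good blocks for `i` and `j`. -/
lemma IndepPoissonClocks.integral_exp_windowStat_blockTimes_le (hT : IndepPoissonClocks P T)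
    (hG : ∀ x x', |G x x'| ≤ 3) {θ m : ℝ} (hθ : 0 ≤ θ) (hθ' : 3 * θ ≤ 1)
    (hσ : 0 ≤ σ) (hL : 0 ≤ L) {r : ℕ} (hσr : σ ≤ ((r : ℝ) - 1) * L)
    (hm : ∀ b, σ ≤ b → m ≤ ∫ ω, windowStat G σ L (otherClocks T i j ω) b ∂P) (M : ℕ) :
    ∫ ω, Real.exp (-θ * ∑ s ∈ Finset.range M, windowStat G σ L (otherClocks T i j ω)
      (blockStart L r (blockTimes L r (clocks T ω i) (clocks T ω j) (s + 1)))) ∂P ≤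
      Real.exp (M * (-θ * m + 9 * θ ^ 2)) := by
  have hiS : i ∈ ({i, j} : Finset (Fin n)) := by simp
  have hjS : j ∈ ({i, j} : Finset (Fin n)) := by simp
  set A : Ω → (({i, j} : Finset (Fin n)) → ℕ → ℝ) := fun ω v => clocks T ω v
  set B : Ω → (({i, j}ᶜ : Finset (Fin n)) → ℕ → ℝ) := otherClocks T i j
  have hA : Measurable A := measurable_pi_lambda _ fun v => hT.measurable_clocks.eval
  have hB : Measurable B := hT.measurable_otherClocks i j
  have hAB : IndepFun A B P := hT.indep.indepFun_finset {i, j} {i, j}ᶜ disjoint_compl_right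
    fun v => (hT.poisson v).measurable_times
  set F : (({i, j} : Finset (Fin n)) → ℕ → ℝ) × (({i, j}ᶜ : Finset (Fin n)) → ℕ → ℝ) → ℝ := fun p =>
    -θ * ∑ s ∈ Finset.range M, windowStat G σ L p.2
      (blockStart L r (blockTimes L r (p.1 ⟨i, hiS⟩) (p.1 ⟨j, hjS⟩) (s + 1))) with hF
  have hFm : Measurable F := by
    refine (Finset.measurable_sum _ fun s _ => measurable_windowStat measurable_snd ?_).const_mul _
    exact (Measurable.of_discrete (f := blockStart L r)).comp
      (measurable_blockTimes measurable_fst.eval measurable_fst.eval L r (s + 1))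
  have hFb : ∀ p, |F p| ≤ θ * (M * 3) := fun p => abs_neg_mul_sum_le hθ (fun s => hG _ _) M
  have h1 : ∫ ω, Real.exp (F (A ω, B ω)) ∂P =
      ∫ p, Real.exp (F p) ∂((P.map A).prod (P.map B)) := by
    rw [← (indepFun_iff_map_prod_eq_prod_map_map hA.aemeasurable hB.aemeasurable).1 hAB,
      integral_map (hA.prodMk hB).aemeasurable hFm.exp.aestronglyMeasurable]
  change ∫ ω, Real.exp (F (A ω, B ω)) ∂P ≤ _
  have : IsProbabilityMeasure (P.map A) := Measure.isProbabilityMeasure_map hA.aemeasurable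
  have : IsProbabilityMeasure (P.map B) := Measure.isProbabilityMeasure_map hB.aemeasurable
  rw [h1, integral_prod _ (integrable_exp_of_abs_le hFm hFb)]
  -- With the clocks `u` of `i` and `j` frozen, the positions of the windows are deterministic,
  -- while the other clocks keep their law by independence.
  have h2 : ∀ u, ∫ w, Real.exp (F (u, w)) ∂(P.map B) ≤ Real.exp (M * (-θ * m + 9 * θ ^ 2)) := by
    intro u
    rw [integral_map (f := fun w => Real.exp (F (u, w))) hB.aemeasurable
      (hFm.comp measurable_prodMk_left).exp.aestronglyMeasurable]
    set ℓ := blockTimes L r (u ⟨i, hiS⟩) (u ⟨j, hjS⟩) with hℓ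
    have hstep : ∀ s, (ℓ s : ℝ) + r ≤ ℓ (s + 1) := fun s => by
      exact_mod_cast blockTimes_add_le L r _ _ s
    have hb : ∀ s, σ ≤ blockStart L r (ℓ s) := fun s => by
      rw [blockStart]
      have : (0 : ℝ) ≤ ℓ s * L := by positivity
      linarith
    refine hT.integral_exp_windowStat_le hG hθ hθ' hσ hL (b := fun s => blockStart L r (ℓ (s + 1)))
      (hb 1) (fun s => ?_) (fun s => hm _ (hb _)) M
    have := mul_le_mul_of_nonneg_right (hstep (s + 1)) hL
    simp only [blockStart]
    linarith
  have hint : Integrable (fun u => ∫ w, Real.exp (F (u, w)) ∂(P.map B)) (P.map A) :=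
    (integrable_exp_of_abs_le hFm hFb).integral_prod_left
  refine (integral_mono hint (integrable_const _) h2).trans_eq ?_
  simp

end

end

section

/-! ### A Chernoff bound for the average of the statistic -/

variable {n : ℕ}

lemma IsGlauberDynamics.indepPoissonClocks {Ω : Type*} [MeasurableSpace Ω] {P : Measure Ω}
    {ψ : Config n → ℝ} {X : ℝ → Ω → Config n} {T : Fin n → ℕ → Ω → ℝ}
    (hX : IsGlauberDynamics P ψ X T) : IndepPoissonClocks P T :=
  ⟨hX.poisson, hX.indep_clocks⟩

lemma IndepPoissonClocks.ae_generic {Ω : Type*} [MeasurableSpace Ω] {P : Measure Ω}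
    [IsProbabilityMeasure P] {T : Fin n → ℕ → Ω → ℝ} (hT : IndepPoissonClocks P T) {L : ℝ}
    (hL : 0 < L) {i j : Fin n} (hij : i ≠ j) : ∀ᵐ ω ∂P, Generic L i j (clocks T ω) := by
  filter_upwards [hT.ae_regular, hT.ae_avoids fun p => p * (L / 3),
    hT.ae_frequently_goodBlock hL hij] with ω h1 h2 h3
  exact ⟨h1, h2, h3⟩

lemma abs_blockStat_le (t : Clocks n) (i : Fin n) (L b : ℝ) (y : History n) :
    |blockStat t i L b y| ≤ 2 :=
  abs_le.2 ⟨neg_two_le_pairStat _ _ _, (pairStat_le_one _ _ _).trans one_le_two⟩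

lemma measurable_blockStat {α : Type*} [MeasurableSpace α] {t : α → Clocks n} {y : α → History n}
    {b : α → ℝ} (ht : Measurable t) (hy : Measurable y) (hb : Measurable b) (i : Fin n) (L : ℝ) :
    Measurable fun a => blockStat (t a) i L (b a) (y a) := by
  have hv : ∀ k : α → ℕ, Measurable k → Measurable fun a => ind ((y a).2 i (k a)) := fun k hk =>
    measurable_ind.comp (measurable_apply_nat hy.snd.eval hk)
  have h1 : Measurable fun a => numUpdates (t a i) (b a) := measurable_numUpdates ht.eval hb
  have h2 : Measurable fun a => numUpdates (t a i) (b a + 2 * L / 3) :=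
    measurable_numUpdates ht.eval (hb.add_const _)
  exact (((hv _ h1).mul (hv _ (h1.add_const 1))).sub (((hv _ h1).const_mul 2).mul (hv _ h2))).add
    ((hv _ h2).mul (hv _ (h2.add_const 1)))

/-- The sum of the statistics over the first `M` good blocks. -/
def blockSum (L : ℝ) (r : ℕ) (i j : Fin n) (M : ℕ) (t : Clocks n) (y : History n) : ℝ :=
  ∑ s ∈ Finset.range M, blockStat t i L (blockStart L r (blockTimes L r (t i) (t j) (s + 1))) y

lemma measurable_blockSum (L : ℝ) (r : ℕ) (i j : Fin n) (M : ℕ) :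
    Measurable fun p : Clocks n × History n => blockSum L r i j M p.1 p.2 :=
  Finset.measurable_sum _ fun s _ => measurable_blockStat measurable_fst measurable_snd
    ((Measurable.of_discrete (f := blockStart L r)).comp
      (measurable_blockTimes measurable_fst.eval measurable_fst.eval L r (s + 1))) i L

lemma abs_neg_mul_blockSum_le {ε θ : ℝ} (hε : |ε| ≤ 1) (hθ : 0 ≤ θ) {L : ℝ} {r : ℕ} {i j : Fin n}
    (M : ℕ) (t : Clocks n) (y : History n) :
    |-θ * (ε * blockSum L r i j M t y)| ≤ θ * (M * 2) := by
  rw [blockSum, Finset.mul_sum]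
  refine abs_neg_mul_sum_le hθ (fun s => ?_) M
  rw [abs_mul]
  have := abs_blockStat_le t i L (blockStart L r (blockTimes L r (t i) (t j) (s + 1))) y
  have := abs_nonneg (blockStat t i L (blockStart L r (blockTimes L r (t i) (t j) (s + 1))) y)
  nlinarith

/-- The times of sites other than `i` and `j`. -/
def restrictClocks (i j : Fin n) (t : Clocks n) : (({i, j}ᶜ : Finset (Fin n))) → ℕ → ℝ :=
  fun v => t v

/-- The conditional mean of `ε Z` in a good block at `b` is at least the value of `windowStat`. -/
def HasBlockBias (ψ : Config n → ℝ) (i j : Fin n) (L σ ε : ℝ)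
    (G : ((({i, j}ᶜ : Finset (Fin n))) → ℕ) → ((({i, j}ᶜ : Finset (Fin n))) → ℕ) → ℝ) : Prop :=
  ∀ (t : Clocks n) (μ : Measure (History n)) [IsProbabilityMeasure μ], Regular t →
    IsGlauberLaw ψ t μ → ∀ b, GoodBlock (t i) (t j) L b → ∀ H : History n → ℝ, (∀ y, 0 ≤ H y) →
    UpTo t (b - σ) H →
      windowStat G σ L (restrictClocks i j t) b * ∫ y, H y ∂μ ≤
        ∫ y, H y * (ε * blockStat t i L b y) ∂μ

section

variable {Ω : Type*} [MeasurableSpace Ω] {P : Measure Ω} [IsProbabilityMeasure P]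
  {ψ : Config n → ℝ} {X : ℝ → Ω → Config n} {T : Fin n → ℕ → Ω → ℝ}
  {i j : Fin n} {G : ((({i, j}ᶜ : Finset (Fin n))) → ℕ) →
    ((({i, j}ᶜ : Finset (Fin n))) → ℕ) → ℝ} {σ L ε θ m : ℝ} {r : ℕ}

/-- The exponential moment for given update times. -/
lemma Generic.integral_exp_blockSum_le {t : Clocks n} {μ : Measure (History n)}
    [IsProbabilityMeasure μ] (ht : Generic L i j t) (hμ : IsGlauberLaw ψ t μ)
    (hL : 0 < L) (hr : 1 ≤ r) (hσr : σ ≤ ((r : ℝ) - 1) * L) (hε : |ε| ≤ 1) (hθ : 0 ≤ θ)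
    (hθ' : 2 * θ ≤ 1) (hG : HasBlockBias ψ i j L σ ε G) (M : ℕ) :
    ∫ y, Real.exp (-θ * (ε * blockSum L r i j M t y)) ∂μ ≤
      Real.exp (-θ * ∑ s ∈ Finset.range M, windowStat G σ L (restrictClocks i j t)
        (blockStart L r (blockTimes L r (t i) (t j) (s + 1))) + 4 * M * θ ^ 2) := by
  set ℓ := blockTimes L r (t i) (t j) with hℓ
  have hstep : ∀ s, (ℓ s : ℝ) + r ≤ ℓ (s + 1) := fun s => by
    exact_mod_cast blockTimes_add_le L r _ _ s
  have hend : ∀ s, blockStart L r (ℓ s) + L ≤ ℓ (s + 1) * L := fun s => by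
    have := mul_le_mul_of_nonneg_right (hstep s) hL.le
    simp only [blockStart]
    linarith
  -- The time `ℓ (s + 1) L` lies after the end of the previous good block and, by `hσr`, no later
  -- than `b - σ` for the current one. It thus separates past statistics from the preparation
  -- window.
  have hw : Monotone fun s => (ℓ (s + 1) : ℝ) * L := by
    refine monotone_nat_of_le_succ fun s => mul_le_mul_of_nonneg_right ?_ hL.le
    have := hstep (s + 1)
    have : (0 : ℝ) ≤ r := by positivity
    linarith
  have key := integral_exp_neg_mul_sum_le (μ := μ) ht.toRegular hθ hθ'
    (Z := fun s y => ε * blockStat t i L (blockStart L r (ℓ (s + 1))) y)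
    (w := fun s => (ℓ (s + 1) : ℝ) * L)
    (g := fun s => windowStat G σ L (restrictClocks i j t) (blockStart L r (ℓ (s + 1)))) hw
    (fun s y => ?_) (fun s => ?_) (fun s H hH0 hH => ?_) M
  · simpa only [blockSum, Finset.mul_sum] using key
  · rw [abs_mul]
    have := abs_blockStat_le t i L (blockStart L r (ℓ (s + 1))) y
    have := abs_nonneg (blockStat t i L (blockStart L r (ℓ (s + 1))) y)
    nlinarith
  · have h1 := (ht.goodBlock_blockTimes hr s).upTo_blockStat ht.toRegular hL
    exact fun w hw => ((h1.mono (hend (s + 1))) w hw).comp fun x => ε * x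
  · refine hG t μ ht.toRegular hμ _ (ht.goodBlock_blockTimes hr s) H hH0 (hH.mono ?_)
    simp only [← hℓ, blockStart]
    linarith

/-- The quadratic errors add up: `4θ²` per block from the values given the clocks, and `9θ²` from
the clocks. -/
lemma IsGlauberDynamics.integral_exp_blockSum_le (hX : IsGlauberDynamics P ψ X T) (hij : i ≠ j)
    (hL : 0 < L) (hr : 1 ≤ r) (hσ : 0 ≤ σ) (hσr : σ ≤ ((r : ℝ) - 1) * L) (hε : |ε| ≤ 1)
    (hθ : 0 ≤ θ) (hθ' : 3 * θ ≤ 1) (hG3 : ∀ x x', |G x x'| ≤ 3)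
    (hG : HasBlockBias ψ i j L σ ε G)
    (hm : ∀ b, σ ≤ b → m ≤ ∫ ω, windowStat G σ L (otherClocks T i j ω) b ∂P) (M : ℕ) :
    ∫ ω, Real.exp (-θ * (ε * blockSum L r i j M (clocks T ω) (history X T ω))) ∂P ≤
      Real.exp (M * (-θ * m + 13 * θ ^ 2)) := by
  have hT := hX.indepPoissonClocks
  have hmC := hX.measurable_clocks
  have hmH := hX.measurable_history
  set f : Clocks n × History n → ℝ := fun p => -θ * (ε * blockSum L r i j M p.1 p.2) with hf
  have hfm : Measurable f := ((measurable_blockSum L r i j M).const_mul ε).const_mul _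
  have hfb : ∀ p, |f p| ≤ θ * (M * 2) := fun p => abs_neg_mul_blockSum_le hε hθ M p.1 p.2
  have : IsProbabilityMeasure (P.map (clocks T)) := Measure.isProbabilityMeasure_map hmC.aemeasurable
  set K := condDistrib (history X T) (clocks T) P with hK
  have hint : Integrable (fun p => Real.exp (f p)) ((P.map (clocks T)) ⊗ₘ K) :=
    integrable_exp_of_abs_le hfm hfb
  have hsm : StronglyMeasurable fun t => ∫ y, Real.exp (f (t, y)) ∂(K t) :=
    hfm.exp.stronglyMeasurable.integral_condDistrib
  -- Disintegration over the clocks, so that the bound for fixed update times applies inside.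
  have h1 : ∫ ω, Real.exp (f (clocks T ω, history X T ω)) ∂P =
      ∫ ω, ∫ y, Real.exp (f (clocks T ω, y)) ∂(K (clocks T ω)) ∂P := by
    rw [← integral_map (f := fun p => Real.exp (f p)) (hmC.prodMk hmH).aemeasurable
      hfm.exp.aestronglyMeasurable, ← compProd_map_condDistrib hmH.aemeasurable,
      Measure.integral_compProd hint, integral_map hmC.aemeasurable hsm.aestronglyMeasurable]
  change ∫ ω, Real.exp (f (clocks T ω, history X T ω)) ∂P ≤ _
  rw [h1]
  have hlaw := ae_of_ae_map hmC.aemeasurable (hX.ae_isGlauberLaw_condDistrib hT.ae_regular)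
  set g : Ω → ℝ := fun ω => -θ * ∑ s ∈ Finset.range M, windowStat G σ L (otherClocks T i j ω)
    (blockStart L r (blockTimes L r (clocks T ω i) (clocks T ω j) (s + 1))) with hg
  have hgm : Measurable g :=
    (Finset.measurable_sum _ fun s _ => measurable_windowStat (hT.measurable_otherClocks i j)
      ((Measurable.of_discrete (f := blockStart L r)).comp
        (measurable_blockTimes hmC.eval hmC.eval L r (s + 1)))).const_mul _
  have hgb : ∀ ω, |g ω| ≤ θ * (M * 3) := fun ω => abs_neg_mul_sum_le hθ (fun s => hG3 _ _) M
  have h2 : ∫ ω, ∫ y, Real.exp (f (clocks T ω, y)) ∂(K (clocks T ω)) ∂P ≤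
      ∫ ω, Real.exp (4 * M * θ ^ 2) * Real.exp (g ω) ∂P := by
    refine integral_mono_ae ?_ ((integrable_exp_of_abs_le hgm hgb).const_mul _) ?_
    · refine Integrable.of_bound (hsm.comp_measurable hmC).aestronglyMeasurable
        (Real.exp (θ * (M * 2))) (ae_of_all _ fun ω => ?_)
      refine (norm_integral_le_of_norm_le_const (C := Real.exp (θ * (M * 2)))
        (ae_of_all _ fun y => ?_)).trans_eq (by simp)
      rw [Real.norm_eq_abs, Real.abs_exp]
      exact Real.exp_le_exp.2 ((le_abs_self _).trans (hfb _))
    · filter_upwards [hlaw, hT.ae_generic hL hij] with ω h3 h4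
      rw [← Real.exp_add, add_comm]
      exact h4.integral_exp_blockSum_le (h3 h4.toRegular) hL hr hσr hε hθ (by linarith) hG M
  refine h2.trans ?_
  rw [integral_const_mul]
  refine (mul_le_mul_of_nonneg_left (hT.integral_exp_windowStat_blockTimes_le hG3 hθ hθ' hσ hL.le
    hσr hm M) (Real.exp_pos _).le).trans_eq ?_
  rw [← Real.exp_add]
  ring_nf

/-- Chernoff bound for the average of the statistic. -/
lemma IsGlauberDynamics.measureReal_averageZ_le (hX : IsGlauberDynamics P ψ X T) (hij : i ≠ j)
    (hL : 0 < L) (hr : 1 ≤ r) (hσ : 0 ≤ σ) (hσr : σ ≤ ((r : ℝ) - 1) * L) (hε : |ε| ≤ 1)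
    (hθ : 0 ≤ θ) (hθ' : 3 * θ ≤ 1) (hG3 : ∀ x x', |G x x'| ≤ 3)
    (hG : HasBlockBias ψ i j L σ ε G)
    (hm : ∀ b, σ ≤ b → m ≤ ∫ ω, windowStat G σ L (otherClocks T i j ω) b ∂P) {M : ℕ}
    (hM : 0 < M) (z : ℝ) :
    P.real {ω | ε * averageZ L r M (fun t => X t ω) (fun a m => T a m ω) i j ≤ z} ≤
      Real.exp (M * (-θ * (m - z) + 13 * θ ^ 2)) := by
  have hM' : (0 : ℝ) < M := by exact_mod_cast hM
  set S : Ω → ℝ := fun ω => ε * blockSum L r i j M (clocks T ω) (history X T ω) with hS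
  have hSm : Measurable S :=
    ((measurable_blockSum L r i j M).comp (hX.measurable_clocks.prodMk hX.measurable_history)).const_mul
      ε
  have hSb : ∀ ω, |-θ * S ω| ≤ θ * (M * 2) := fun ω =>
    abs_neg_mul_blockSum_le hε hθ M (clocks T ω) (history X T ω)
  have h1 : P.real {ω | ε * averageZ L r M (fun t => X t ω) (fun a m => T a m ω) i j ≤ z} ≤
      P.real {ω | S ω ≤ M * z} := by
    refine ENNReal.toReal_mono (measure_ne_top _ _) (measure_mono_ae ?_)
    filter_upwards [hX.indepPoissonClocks.ae_generic hL hij] with ω hω h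
    have h : ε * averageZ L r M (fun t => X t ω) (clocks T ω) i j ≤ z := h
    have h2 : averageZ L r M (fun t => X t ω) (clocks T ω) i j =
        1 / M * blockSum L r i j M (clocks T ω) (history X T ω) := by
      rw [averageZ, blockSum]
      congr 1
      refine Finset.sum_nbij' (fun s => s - 1) (fun s => s + 1) ?_ ?_ ?_ ?_ ?_
      · intro s hs
        have := Finset.mem_Icc.1 hs
        exact Finset.mem_range.2 (by omega)
      · intro s hs
        have := Finset.mem_range.1 hs
        exact Finset.mem_Icc.2 (by omega)
      · intro s hs
        have := Finset.mem_Icc.1 hs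
        omega
      · intro s _
        rfl
      · intro s hs
        have := Finset.mem_Icc.1 hs
        obtain ⟨s, rfl⟩ : ∃ s', s = s' + 1 := ⟨s - 1, by omega⟩
        simp only [Nat.add_sub_cancel]
        rw [hω.tau_eq_blockTimes hr hL]
        exact hω.statZ_eq_blockStat hr (fun u => X u ω) (history X T ω) (fun m => rfl)
          (hω.goodBlock_blockTimes hr s)
    rw [h2] at h
    change ε * blockSum L r i j M (clocks T ω) (history X T ω) ≤ M * z
    have h3 := mul_le_mul_of_nonneg_left h hM'.le
    have h4 : (M : ℝ) * (ε * (1 / M * blockSum L r i j M (clocks T ω) (history X T ω))) =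
        ε * blockSum L r i j M (clocks T ω) (history X T ω) := by field_simp
    linarith
  refine h1.trans ((measure_le_le_exp_mul_mgf (X := S) (t := -θ) (M * z) (by linarith)
    (integrable_exp_of_abs_le (hSm.const_mul _) hSb)).trans ?_)
  refine (mul_le_mul_of_nonneg_left (hX.integral_exp_blockSum_le hij hL hr hσ hσr hε hθ hθ' hG3 hG
    hm M) (Real.exp_pos _).le).trans_eq ?_
  rw [← Real.exp_add]
  ring_nf

end

end

section

variable {n : ℕ}

/-! ### Probabilities of the events at the other sites -/

section window

variable {Ω : Type*} [MeasurableSpace Ω] {P : Measure Ω}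
  {T : Fin n → ℕ → Ω → ℝ} {i j : Fin n} {L σ b : ℝ}

open Classical in
/-- The penalty `1` if one of the sites in `N` updates. -/
def busy (N : Finset (Fin n)) (x : (({i, j}ᶜ : Finset (Fin n))) → ℕ) : ℝ :=
  if ∀ v : (({i, j}ᶜ : Finset (Fin n))), (v : Fin n) ∈ N → x v = 0 then 0 else 1

open Classical in
/-- The indicator that all sites in `R` update and no other site in `N` does. -/
def primed (R N : Finset (Fin n)) (x : (({i, j}ᶜ : Finset (Fin n))) → ℕ) : ℝ :=
  if ∀ v : (({i, j}ᶜ : Finset (Fin n))), (v : Fin n) ∈ N →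
      if (v : Fin n) ∈ R then 1 ≤ x v else x v = 0 then 1 else 0

lemma busy_of_forall {N : Finset (Fin n)} {x : (({i, j}ᶜ : Finset (Fin n))) → ℕ}
    (h : ∀ v : (({i, j}ᶜ : Finset (Fin n))), (v : Fin n) ∈ N → x v = 0) : busy N x = 0 := if_pos h

lemma busy_of_not {N : Finset (Fin n)} {x : (({i, j}ᶜ : Finset (Fin n))) → ℕ}
    (h : ¬ ∀ v : (({i, j}ᶜ : Finset (Fin n))), (v : Fin n) ∈ N → x v = 0) : busy N x = 1 := if_neg h

lemma busy_nonneg (N : Finset (Fin n)) (x : (({i, j}ᶜ : Finset (Fin n))) → ℕ) : 0 ≤ busy N x := by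
  unfold busy; split_ifs <;> norm_num

lemma busy_le_one (N : Finset (Fin n)) (x : (({i, j}ᶜ : Finset (Fin n))) → ℕ) : busy N x ≤ 1 := by
  unfold busy; split_ifs <;> norm_num

lemma primed_nonneg (R N : Finset (Fin n)) (x : (({i, j}ᶜ : Finset (Fin n))) → ℕ) :
    0 ≤ primed R N x := by
  unfold primed; split_ifs <;> norm_num

lemma primed_le_one (R N : Finset (Fin n)) (x : (({i, j}ᶜ : Finset (Fin n))) → ℕ) :
    primed R N x ≤ 1 := by
  unfold primed; split_ifs <;> norm_num

lemma integrable_comp_increments [IsProbabilityMeasure P] (hT : IndepPoissonClocks P T)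
    {f : ((({i, j}ᶜ : Finset (Fin n))) → ℕ) → ℝ} {C : ℝ} (hf : ∀ x, |f x| ≤ C) (a b : ℝ) :
    Integrable (fun ω => f fun v => increment (otherClocks T i j ω v) a b) P := by
  refine Integrable.of_bound (C := C) (Measurable.aestronglyMeasurable ?_) (ae_of_all _ fun ω => hf _)
  exact (Measurable.of_discrete (f := f)).comp
    (measurable_pi_lambda _ fun v => (hT.poisson v).measurable_increment a b)

/-- Union bound with `1 - exp(-L) ≤ L`. -/
lemma IndepPoissonClocks.integral_busy_le [IsProbabilityMeasure P] (hT : IndepPoissonClocks P T)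
    (N : Finset (Fin n))    (hb : 0 ≤ b) (hL : 0 ≤ L) :
    ∫ ω, busy (i := i) (j := j) N (fun v => increment (otherClocks T i j ω v) b (b + L)) ∂P ≤
      N.card * L := by
  have h1 : ∀ ω, busy (i := i) (j := j) N
      (fun v => increment (otherClocks T i j ω v) b (b + L)) ≤
      ∑ v ∈ N, {ω | 1 ≤ increment (fun m => T v m ω) b (b + L)}.indicator 1 ω := by
    intro ω
    have h0 : ∀ v ∈ N, (0 : ℝ) ≤
        {ω | 1 ≤ increment (fun m => T v m ω) b (b + L)}.indicator 1 ω := fun v _ =>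
      Set.indicator_nonneg (fun _ _ => zero_le_one) _
    unfold busy
    split_ifs with h
    · exact Finset.sum_nonneg h0
    · push Not at h
      obtain ⟨v, hv, hv'⟩ := h
      refine le_trans (le_of_eq ?_) (Finset.single_le_sum h0 hv)
      rw [Set.indicator_of_mem]
      · rfl
      · exact Nat.one_le_iff_ne_zero.2 hv'
  have hm : ∀ v, MeasurableSet {ω | 1 ≤ increment (fun m => T v m ω) b (b + L)} := fun v =>
    measurableSet_le measurable_const ((hT.poisson v).measurable_increment _ _)
  have hint : ∀ v ∈ N, Integrable
      ({ω | 1 ≤ increment (fun m => T v m ω) b (b + L)}.indicator (1 : Ω → ℝ)) P := fun v _ =>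
    (integrable_const (1 : ℝ)).indicator (hm v)
  refine (integral_mono (integrable_comp_increments hT (C := 1)
    (fun x => abs_le.2 ⟨by linarith [busy_nonneg N x], busy_le_one N x⟩) _ _)
    (integrable_finsetSum _ hint) h1).trans ?_
  rw [integral_finsetSum _ hint, ← nsmul_eq_mul]
  refine Finset.sum_le_card_nsmul _ _ _ fun v _ => ?_
  rw [integral_indicator_one (hm v), (hT.poisson v).measureReal_one_le_increment hb (by linarith)]
  linarith [Real.add_one_le_exp (-(b + L - b))]

lemma IndepPoissonClocks.integral_primed (hT : IndepPoissonClocks P T) {R N : Finset (Fin n)}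
    (hRN : R ⊆ N) (hi : i ∉ N) (hj : j ∉ N) (hσ : 0 ≤ σ) (hb : σ ≤ b) :
    ∫ ω, primed (i := i) (j := j) R N (fun v => increment (otherClocks T i j ω v) (b - σ) b) ∂P =
      (1 - Real.exp (-σ)) ^ R.card * Real.exp (-σ) ^ (N \ R).card := by
  classical
  let s : Fin n → Set (ℕ → ℝ) := fun v =>
    {w | if v ∈ R then 1 ≤ increment w (b - σ) b else increment w (b - σ) b = 0}
  have hinc : Measurable fun w : ℕ → ℝ => increment w (b - σ) b :=
    MRF.measurable_increment measurable_id measurable_const measurable_const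
  have hs : ∀ v, MeasurableSet (s v) := by
    intro v
    by_cases hv : v ∈ R
    · simpa only [s, hv, if_true] using measurableSet_le measurable_const hinc
    · simp only [s, hv, if_false]
      exact hinc (measurableSet_singleton 0)
  have hset : MeasurableSet (⋂ v ∈ N, (fun ω m => T v m ω) ⁻¹' s v) :=
    Finset.measurableSet_biInter _ fun v _ => (hT.poisson v).measurable_times (hs v)
  have h1 : ∀ ω, primed (i := i) (j := j) R N
      (fun v => increment (otherClocks T i j ω v) (b - σ) b) =
      (⋂ v ∈ N, (fun ω m => T v m ω) ⁻¹' s v).indicator 1 ω := by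
    intro ω
    have h : (∀ v : (({i, j}ᶜ : Finset (Fin n))), (v : Fin n) ∈ N → if (v : Fin n) ∈ R then
        1 ≤ increment (otherClocks T i j ω v) (b - σ) b
        else increment (otherClocks T i j ω v) (b - σ) b = 0) ↔
        ω ∈ ⋂ v ∈ N, (fun ω m => T v m ω) ⁻¹' s v := by
      rw [Set.mem_iInter₂]
      refine ⟨fun h v hv => h ⟨v, ?_⟩ hv, fun h v hv => h v hv⟩
      simp only [Finset.mem_compl, Finset.mem_insert, Finset.mem_singleton]
      rintro (rfl | rfl)
      exacts [hi hv, hj hv]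
    unfold primed
    by_cases hω : ω ∈ ⋂ v ∈ N, (fun ω m => T v m ω) ⁻¹' s v
    · rw [if_pos (h.2 hω), Set.indicator_of_mem hω]
      rfl
    · rw [if_neg (h.not.2 hω), Set.indicator_of_notMem hω]
  simp_rw [h1]
  rw [integral_indicator_one hset, measureReal_def,
    hT.indep.measure_inter_preimage_eq_mul N fun v _ => hs v, ENNReal.toReal_prod]
  have h2 : ∀ v ∈ N, (P ((fun ω m => T v m ω) ⁻¹' s v)).toReal =
      if v ∈ R then 1 - Real.exp (-σ) else Real.exp (-σ) := by
    intro v _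
    have e1 := (hT.poisson v).measureReal_one_le_increment (sub_nonneg.2 hb)
      (sub_le_self b hσ)
    have e2 := (hT.poisson v).measureReal_increment_eq_zero (sub_nonneg.2 hb)
      (sub_le_self b hσ)
    rw [sub_sub_cancel] at e1 e2
    by_cases hv : v ∈ R
    · rw [if_pos hv, ← e1, measureReal_def]
      simp only [s, hv, if_true]
      rfl
    · rw [if_neg hv, ← e2, measureReal_def]
      simp only [s, hv, if_false]
      rfl
  rw [Finset.prod_congr rfl h2, Finset.prod_ite, Finset.prod_const, Finset.prod_const,
    Finset.filter_mem_eq_inter, Finset.inter_eq_right.2 hRN, Finset.filter_notMem_eq_sdiff]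

end window

/-! ### The bias of the statistic of a block -/

lemma numUpdates_eq_of_increment_eq_zero {t : Clocks n} (ht : Regular t) {v : Fin n} {a b : ℝ}
    (hab : a ≤ b) (h : increment (t v) a b = 0) : numUpdates (t v) a = numUpdates (t v) b :=
  le_antisymm (ht.numUpdates_mono v hab) (Nat.sub_eq_zero_iff_le.1 h)

/-- Neither `i` nor `j` enters `∂_i ψ`, so if its sites are quiet the mean is zero. Otherwise `Z ≤
1` gives `-Z ≥ -1`, and no preparation window is needed. -/
lemma hasBlockBias_of_not_adj {ψ : Config n → ℝ} {i j : Fin n} (h : ¬ Adj ψ i j) {L : ℝ}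
    (hL : 0 < L) :
    HasBlockBias ψ i j L 0 (-1) fun _ x' => -busy (support (partialDeriv i ψ)) x' := by
  intro t μ _ ht hμ b hb H hH0 hH
  rw [sub_zero] at hH
  by_cases hU : ∀ v : (({i, j}ᶜ : Finset (Fin n))), (v : Fin n) ∈ support (partialDeriv i ψ) →
      increment (restrictClocks i j t v) b (b + L) = 0
  · rw [windowStat, busy_of_forall hU]
    have h0 := hb.integral_mul_blockStat_eq_zero ht hμ (fun v hv => ?_) hH
    · have : ∫ y, H y * (-1 * blockStat t i L b y) ∂μ = -∫ y, H y * blockStat t i L b y ∂μ := by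
        rw [← integral_neg]
        exact integral_congr_ae (ae_of_all _ fun y => by ring)
      rw [this, h0]
      simp
    · refine numUpdates_eq_of_increment_eq_zero ht (by linarith) (hU ⟨v, ?_⟩ hv)
      simp only [Finset.mem_compl, Finset.mem_insert, Finset.mem_singleton]
      rintro (rfl | rfl)
      exacts [notMem_support_partialDeriv_self _ _ hv, h hv]
  · rw [windowStat, busy_of_not hU, ← integral_const_mul]
    have hZ : UpTo t (b + L) fun y => H y * (-1 * blockStat t i L b y) :=
      fun w hw y y' h1 h2 => by
        simp only [hH.mono (by linarith : b ≤ b + L) w hw y y' h1 h2,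
          hb.upTo_blockStat ht hL w hw y y' h1 h2]
    refine integral_mono ((hH.integrable ht μ).const_mul _) (hZ.integrable ht μ) fun y => ?_
    have h1 : blockStat t i L b y ≤ 1 := pairStat_le_one _ _ _
    have h2 := hH0 y
    simp only
    nlinarith

lemma primed_of_forall {i j : Fin n} {R N : Finset (Fin n)} {x : (({i, j}ᶜ : Finset (Fin n))) → ℕ}
    (h : ∀ v : (({i, j}ᶜ : Finset (Fin n))), (v : Fin n) ∈ N →
      if (v : Fin n) ∈ R then 1 ≤ x v else x v = 0) : primed R N x = 1 := by
  unfold primed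
  convert if_pos h

lemma primed_of_not {i j : Fin n} {R N : Finset (Fin n)} {x : (({i, j}ᶜ : Finset (Fin n))) → ℕ}
    (h : ¬ ∀ v : (({i, j}ᶜ : Finset (Fin n))), (v : Fin n) ∈ N →
      if (v : Fin n) ∈ R then 1 ≤ x v else x v = 0) : primed R N x = 0 := by
  unfold primed
  convert if_neg h

/-- The argument `2 ∂_i ψ` moves by at least `4α` inside `[-2λ, 2λ]`, where the slope of `σ` is at
least `exp(-2λ)/4`. -/
lemma le_sq_flipProb_sub {ψ : Config n → ℝ} {i j : Fin n} {α lam : ℝ} (hα : 0 ≤ α)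
    (hw : ∀ x, |partialDeriv i ψ x| ≤ lam) (x : Config n)
    (h : 2 * α ≤ |partialDeriv i ψ (Function.update x j true) -
      partialDeriv i ψ (Function.update x j false)|) :
    (α * Real.exp (-(2 * lam))) ^ 2 ≤ (flipProb ψ i j x true - flipProb ψ i j x false) ^ 2 := by
  have hB : ∀ x, |2 * partialDeriv i ψ x| ≤ 2 * lam := fun x => by
    rw [abs_mul, abs_two]
    linarith [hw x]
  have h1 := mul_abs_sub_le_abs_sigmoid_sub (hB (Function.update x j true))
    (hB (Function.update x j false))
  rw [← mul_sub, abs_mul, abs_two] at h1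
  have h2 := mul_le_mul_of_nonneg_left h (Real.exp_pos (-(2 * lam))).le
  rw [← sq_abs (flipProb ψ i j x true - flipProb ψ i j x false)]
  refine pow_le_pow_left₀ (by positivity) (le_trans ?_ h1) 2
  linarith

/-- `c₀` collects the probability `c` that `j` flips, the squared influence and the probability
`c^|R|` of the favourable values on `R`. Without a primed window the mean is still nonnegative,
being that of a square. -/
lemma hasBlockBias_of_maximal {ψ : Config n → ℝ} {i j : Fin n} (hij : i ≠ j) {S : Finset (Fin n)}
    (hS : IsMaximalMonomial ψ S) (hi : i ∈ S) (hj : j ∈ S) {α lam c c₀ : ℝ} (hα : 0 ≤ α)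
    (hαS : α ≤ |coeff ψ S|) (hlam : 0 ≤ lam) (hw : ∀ v x, |partialDeriv v ψ x| ≤ lam)
    (hc : c = Real.exp (-(2 * lam)) / 2)
    (hc₀ : c₀ = c * (α * Real.exp (-(2 * lam))) ^ 2 * c ^ ((S.erase i).erase j).card)
    (hc₀' : c₀ ≤ 1) {L σ : ℝ} (hL : 0 < L) (hσ : 0 ≤ σ) :
    HasBlockBias ψ i j L σ 1 fun x x' =>
      c₀ * primed ((S.erase i).erase j) ((support (partialDeriv i ψ)).erase j) x -
        3 * busy (support (partialDeriv i ψ) ∪ support (partialDeriv j ψ)) x' := by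
  intro t μ _ ht hμ b hb H hH0 hH
  have hc0 : 0 < c := by rw [hc]; positivity
  have hB : ∀ v x, |2 * partialDeriv v ψ x| ≤ 2 * lam := fun v x => by
    rw [abs_mul, abs_two]
    linarith [hw v x]
  have hlo : ∀ v x, c ≤ (2 * partialDeriv v ψ x).sigmoid := fun v x =>
    hc ▸ exp_neg_div_two_le_sigmoid (by linarith) (hB v x)
  have hhi : ∀ v x, (2 * partialDeriv v ψ x).sigmoid ≤ 1 - c := fun v x =>
    hc ▸ sigmoid_le_one_sub (by linarith) (hB v x)
  have hHb : UpTo t b H := hH.mono (by linarith)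
  have hmem : ∀ v, v ≠ i → v ≠ j → v ∈ ({i, j}ᶜ : Finset (Fin n)) := fun v h1 h2 => by
    simp [h1, h2]
  simp only [one_mul]
  have hZ : UpTo t (b + L) fun y => H y * blockStat t i L b y := fun w hw y y' h1 h2 => by
    simp only [hHb.mono (by linarith : b ≤ b + L) w hw y y' h1 h2,
      hb.upTo_blockStat ht hL w hw y y' h1 h2]
  by_cases hU : ∀ v : (({i, j}ᶜ : Finset (Fin n))),
      (v : Fin n) ∈ support (partialDeriv i ψ) ∪ support (partialDeriv j ψ) →
      increment (restrictClocks i j t v) b (b + L) = 0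
  · have hmain := hb.le_integral_mul_blockStat ht hμ hlo hhi hL
      (fun v hv hvj => numUpdates_eq_of_increment_eq_zero ht (by linarith)
        (hU ⟨v, hmem v (fun h => notMem_support_partialDeriv_self i ψ (h ▸ hv)) hvj⟩
          (Finset.mem_union_left _ hv)))
      (fun v hv hvi => numUpdates_eq_of_increment_eq_zero ht (by linarith)
        (hU ⟨v, hmem v hvi (fun h => notMem_support_partialDeriv_self j ψ (h ▸ hv))⟩
          (Finset.mem_union_right _ hv))) hH0 hHb
    refine le_trans ?_ hmain
    by_cases hW : ∀ v : (({i, j}ᶜ : Finset (Fin n))),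
        (v : Fin n) ∈ (support (partialDeriv i ψ)).erase j →
        if (v : Fin n) ∈ (S.erase i).erase j then
          1 ≤ increment (restrictClocks i j t v) (b - σ) b
        else increment (restrictClocks i j t v) (b - σ) b = 0
    · rw [windowStat, busy_of_forall hU, primed_of_forall hW, hc₀, mul_zero, sub_zero, mul_one]
      have hRN : ∀ v ∈ (S.erase i).erase j, v ∈ (support (partialDeriv i ψ)).erase j := by
        intro v hv
        simp only [Finset.mem_erase] at hv ⊢
        exact ⟨hv.1, adj_of_coeff_ne_zero hv.2.1.symm hi hv.2.2 hS.1⟩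
      have hcS : coeff (partialDeriv i ψ) (S.erase i) = coeff ψ S := by
        rw [coeff_partialDeriv, if_neg (Finset.notMem_erase i S), Finset.insert_erase hi]
      have hlarge := hμ.pow_mul_integral_le_of_large ht hc0.le hlo hhi
        (f := partialDeriv i ψ) (j := j) (R := (S.erase i).erase j) (B := 2 * α) (u := b - σ)
        (b := b) (fun z => ?_) (fun v hv => ?_) (fun v hv hvj hvR => ?_) hH0 hH (by linarith)
      · rw [mul_assoc, mul_assoc]
        refine mul_le_mul_of_nonneg_left ?_ hc0.le
        refine (mul_le_mul_of_nonneg_left hlarge (sq_nonneg _)).trans ?_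
        rw [← integral_const_mul]
        refine integral_mono_of_nonneg (ae_of_all _ fun y => ?_) ?_ (ae_of_all _ fun y => ?_)
        · have := hH0 y
          simp only [Pi.zero_apply]
          split_ifs <;> positivity
        · refine UpTo.integrable (u := b) ht (fun w hw y y' h1 h2 => ?_) μ
          have e : state t y b = state t y' b := Before.state ht hw y y' h1 h2
          simp only [hHb w hw y y' h1 h2, e]
        · simp only
          rw [mul_left_comm]
          refine mul_le_mul_of_nonneg_left ?_ (hH0 y)
          split_ifs with h
          · rw [mul_one]
            exact le_sq_flipProb_sub hα (hw i) _ h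
          · rw [mul_zero]
            positivity
      · have htop : ∀ U : Finset (Fin n), S.erase i ⊂ U → coeff (partialDeriv i ψ) U = 0 := by
          intro U hU
          rw [coeff_partialDeriv]
          split_ifs with hiU
          · rfl
          · refine hS.2 _ ?_
            rw [← Finset.insert_erase hi]
            exact ⟨Finset.insert_subset_insert _ hU.1, fun h => hU.2 fun v hv =>
              (Finset.mem_insert.1 (h (Finset.mem_insert_of_mem hv))).resolve_left
                fun e => hiU (e ▸ hv)⟩
        obtain ⟨A, hA, hA'⟩ := exists_flipOn_large_difference (partialDeriv i ψ)
          (Finset.mem_erase.2 ⟨hij.symm, hj⟩) htop z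
        refine ⟨A, hA, le_trans ?_ hA'⟩
        rw [hcS]
        linarith
      · have hvN := hRN v hv
        have hv' := hv
        simp only [Finset.mem_erase] at hv'
        have := hW ⟨v, hmem v hv'.2.1 hv'.1⟩ hvN
        rw [if_pos hv] at this
        exact Nat.sub_pos_iff_lt.1 this
      · have := hW ⟨v, hmem v (fun h => notMem_support_partialDeriv_self i ψ (h ▸ hv)) hvj⟩
          (Finset.mem_erase.2 ⟨hvj, hv⟩)
        rw [if_neg hvR] at this
        exact numUpdates_eq_of_increment_eq_zero ht (by linarith) this
    · rw [windowStat, busy_of_forall hU, primed_of_not hW]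
      simp only [mul_zero, sub_zero, zero_mul]
      exact mul_nonneg hc0.le (integral_nonneg fun y => mul_nonneg (hH0 y) (sq_nonneg _))
  · rw [windowStat, busy_of_not hU, ← integral_const_mul]
    refine integral_mono (((hHb.integrable ht μ)).const_mul _) (hZ.integrable ht μ) fun y => ?_
    have h1 : -2 ≤ blockStat t i L b y := (abs_le.1 (abs_blockStat_le t i L b y)).1
    have h2 := hH0 y
    have hc00 : 0 ≤ c₀ := by rw [hc₀]; positivity
    -- The weight `3` of the penalty is forced here: `c₀ · primed - 3 ≤ 1 - 3 = -2 ≤ Z`.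
    have h3 : c₀ * primed ((S.erase i).erase j) ((support (partialDeriv i ψ)).erase j)
        (fun v => increment (restrictClocks i j t v) (b - σ) b) ≤ 1 :=
      mul_le_one₀ hc₀' (primed_nonneg _ _ _) (primed_le_one _ _ _)
    simp only
    nlinarith

end

section

variable {n : ℕ}

/-! ### The parameters -/

section parameters

variable {k d : ℕ} {α lam : ℝ}

lemma qParam_pos (hd : 1 ≤ d) : 0 < qParam k d lam := by
  have : (0 : ℝ) < d := by exact_mod_cast hd
  unfold qParam
  positivity

lemma blockLength_pos (hd : 1 ≤ d) (hα : 0 < α) : 0 < blockLength k d α lam := by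
  have : (0 : ℝ) < d := by exact_mod_cast hd
  have := qParam_pos (k := k) (lam := lam) hd
  unfold blockLength
  positivity

lemma kappa_pos (hd : 1 ≤ d) (hα : 0 < α) : 0 < kappa k d α lam := by
  have := qParam_pos (k := k) (lam := lam) hd
  unfold kappa
  positivity

lemma mul_blockLength (hd : 1 ≤ d) : d * blockLength k d α lam = kappa k d α lam / 5 := by
  have : (d : ℝ) ≠ 0 := by positivity
  unfold blockLength kappa
  field_simp

lemma one_le_numBlocks (hd : 1 ≤ d) (hα : 0 < α) : 1 ≤ numBlocks k d α lam := by
  refine Nat.one_le_ceil_iff.2 (div_pos (Real.log_pos ?_) (blockLength_pos hd hα))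
  have := le_max_left (1 : ℝ) (2 * ((k : ℝ) - 2))
  linarith

/-- For `k ≥ 3` the definition gives `r L ≥ log 4`, and `log 2 > 1/64 ≥ L` leaves room to drop one
block. A preparation window of length up to `log 2` then fits into the gap. -/
lemma log_two_le_numBlocks_sub_one_mul (hd : 1 ≤ d) (hα : 0 < α) (hk : 3 ≤ k)
    (hL : blockLength k d α lam ≤ 1 / 64) :
    Real.log 2 ≤ ((numBlocks k d α lam : ℝ) - 1) * blockLength k d α lam := by
  have hL0 := blockLength_pos (k := k) (lam := lam) hd hα
  have h1 : Real.log (2 * max 1 (2 * ((k : ℝ) - 2))) ≤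
      numBlocks k d α lam * blockLength k d α lam := (div_le_iff₀ hL0).1 (Nat.le_ceil _)
  have h2 : (3 : ℝ) ≤ k := by exact_mod_cast hk
  have h3 : Real.log (2 * 2) ≤ Real.log (2 * max 1 (2 * ((k : ℝ) - 2))) := by
    refine Real.log_le_log (by norm_num) ?_
    have := le_max_right (1 : ℝ) (2 * ((k : ℝ) - 2))
    linarith
  rw [Real.log_mul two_ne_zero two_ne_zero] at h3
  have := Real.log_two_gt_d9
  linarith

/-- Follows from `α ≤ λ ≤ exp λ`. -/
lemma sq_mul_exp_le_one (hα : 0 ≤ α) (h : α ≤ lam) : α ^ 2 * Real.exp (-6 * lam) ≤ 1 := by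
  have h1 : α ≤ Real.exp lam := by linarith [Real.add_one_le_exp lam]
  have h2 : α ^ 2 ≤ Real.exp lam ^ 2 := pow_le_pow_left₀ hα h1 2
  calc α ^ 2 * Real.exp (-6 * lam) ≤ Real.exp lam ^ 2 * Real.exp (-6 * lam) := by gcongr
    _ = Real.exp (2 * lam + -6 * lam) := by rw [Real.exp_add, ← Real.exp_nat_mul]; norm_num
    _ ≤ 1 := Real.exp_le_one_iff.2 (by linarith)

lemma qParam_eq (hk : 2 ≤ k) :
    qParam k d lam = 1 / 2 * (Real.exp (-2 * lam) / (2 * d)) ^ (k - 2) := by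
  rw [qParam, ← Int.toNat_of_nonneg (show (0 : ℤ) ≤ (k : ℤ) - 2 by omega), zpow_natCast]
  congr 2
  omega

lemma qParam_le_half (hd : 1 ≤ d) (hk : 2 ≤ k) (hlam : 0 ≤ lam) : qParam k d lam ≤ 1 / 2 := by
  have hd' : (1 : ℝ) ≤ d := by exact_mod_cast hd
  rw [qParam_eq hk]
  have h1 : Real.exp (-2 * lam) / (2 * d) ≤ 1 := by
    rw [div_le_one (by positivity)]
    have : Real.exp (-2 * lam) ≤ 1 := Real.exp_le_one_iff.2 (by linarith)
    linarith
  have := pow_le_one₀ (n := k - 2) (by positivity) h1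
  linarith

lemma kappa_le (hα : 0 ≤ α) (h : α ≤ lam) (hd : 1 ≤ d) (hk : 2 ≤ k) :
    kappa k d α lam ≤ 5 / 128 := by
  have h1 := sq_mul_exp_le_one hα h
  have h2 := qParam_le_half hd hk (hα.trans h)
  have h3 := qParam_pos (k := k) (lam := lam) hd
  have : kappa k d α lam = 5 / 64 * (α ^ 2 * Real.exp (-6 * lam) * qParam k d lam) := by
    unfold kappa; ring
  rw [this]
  have := mul_le_mul h1 h2 h3.le zero_le_one
  linarith

lemma blockLength_le (hα : 0 ≤ α) (h : α ≤ lam) (hd : 1 ≤ d) (hk : 2 ≤ k) :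
    blockLength k d α lam ≤ 1 / 64 := by
  have h1 := kappa_le hα h hd hk
  have h2 := mul_blockLength (k := k) (α := α) (lam := lam) hd
  have h3 : (1 : ℝ) ≤ d := by exact_mod_cast hd
  have h4 : 0 ≤ blockLength k d α lam := by
    have := qParam_pos (k := k) (lam := lam) hd
    unfold blockLength
    positivity
  nlinarith

/-- There is a window in which each of at most `d - 1` sites updates or stays quiet as prescribed
with the right probability. -/
lemma exists_window_length (hd : 1 ≤ d) {a m : ℕ} (had : a + m + 1 ≤ d) :
    ∃ σ : ℝ, 0 ≤ σ ∧ σ ≤ Real.log 2 ∧ (a = 0 → σ = 0) ∧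
      (1 / (d : ℝ)) ^ a / 3 ≤ (1 - Real.exp (-σ)) ^ a * Real.exp (-σ) ^ m := by
  rcases Nat.eq_zero_or_pos a with rfl | ha
  · exact ⟨0, le_rfl, (Real.log_pos one_lt_two).le, fun _ => rfl, by norm_num⟩
  have hd2 : (2 : ℝ) ≤ d := by exact_mod_cast (by omega : 2 ≤ d)
  have hd1 : (0 : ℝ) < d - 1 := by linarith
  have h1 : 1 ≤ (d : ℝ) / (d - 1) := (one_le_div hd1).2 (by linarith)
  have hexp : Real.exp (-Real.log (d / (d - 1))) = 1 - 1 / d := by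
    rw [Real.exp_neg, Real.exp_log (by positivity)]
    field_simp
  -- This `σ` solves `1 - exp(-σ) = 1/d`. As `σ ≤ 1/(d - 1)` and `m ≤ d - 1`, the quiet sites cost
  -- at most `exp(-1) ≥ 1/3`.
  refine ⟨Real.log (d / (d - 1)), Real.log_nonneg h1, Real.log_le_log (by positivity) ?_,
    fun h => absurd h ha.ne', ?_⟩
  · rw [div_le_iff₀ hd1]
    linarith
  · have h2 : Real.log (d / (d - 1)) * m ≤ 1 := by
      have h3 : Real.log (d / (d - 1)) ≤ 1 / (d - 1) := by
        refine (Real.log_le_sub_one_of_pos (by positivity)).trans_eq ?_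
        field_simp
        ring
      have h4 : (m : ℝ) ≤ d - 1 := by
        have : (a : ℝ) + m + 1 ≤ d := by exact_mod_cast had
        have : (0 : ℝ) ≤ a := Nat.cast_nonneg a
        linarith
      calc Real.log (d / (d - 1)) * m ≤ 1 / (d - 1) * (d - 1) := by gcongr
        _ = 1 := by field_simp
    have h5 : 1 / 3 ≤ Real.exp (-Real.log (d / (d - 1))) ^ m := by
      rw [← Real.exp_nat_mul]
      have h6 : Real.exp (-1) ≤ Real.exp (m * -Real.log (d / (d - 1))) :=
        Real.exp_le_exp.2 (by linarith)
      refine le_trans ?_ h6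
      rw [Real.exp_neg, one_div]
      exact inv_anti₀ (Real.exp_pos 1) (by linarith [Real.exp_one_lt_d9])
    have h7 : 1 - Real.exp (-Real.log (d / (d - 1))) = 1 / d := by rw [hexp]; ring
    rw [h7, div_eq_mul_one_div]
    exact mul_le_mul_of_nonneg_left h5 (by positivity)

/-- The right side is `α² exp(-6λ)/6` times the `a`-th power of `exp(-2λ)/(2d) ≤ 1`. The left side
has the constant `5/32 ≤ 1/6` and the larger exponent `k - 2`. -/
lemma four_mul_kappa_le (hd : 1 ≤ d) (hk : 2 ≤ k) (hlam : 0 ≤ lam) {a : ℕ} (ha : a + 2 ≤ k) :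
    4 * kappa k d α lam ≤
      Real.exp (-(2 * lam)) / 2 * (α * Real.exp (-(2 * lam))) ^ 2 *
        (Real.exp (-(2 * lam)) / 2) ^ a * ((1 / (d : ℝ)) ^ a / 3) := by
  have hd' : (1 : ℝ) ≤ d := by exact_mod_cast hd
  have h1 : Real.exp (-2 * lam) / (2 * d) ≤ 1 := by
    rw [div_le_one (by positivity)]
    have : Real.exp (-2 * lam) ≤ 1 := Real.exp_le_one_iff.2 (by linarith)
    linarith
  have h2 := pow_le_pow_of_le_one (by positivity) h1 (show a ≤ k - 2 by omega)
  have h3 : Real.exp (-(2 * lam)) / 2 * (α * Real.exp (-(2 * lam))) ^ 2 *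
        (Real.exp (-(2 * lam)) / 2) ^ a * ((1 / (d : ℝ)) ^ a / 3) =
      α ^ 2 * Real.exp (-6 * lam) / 6 * (Real.exp (-2 * lam) / (2 * d)) ^ a := by
    have e1 : Real.exp (-6 * lam) = Real.exp (-(2 * lam)) ^ 3 := by
      rw [← Real.exp_nat_mul]
      ring_nf
    rw [e1, show Real.exp (-2 * lam) / (2 * d) = Real.exp (-(2 * lam)) / 2 * (1 / d) by
      rw [show -2 * lam = -(2 * lam) by ring]; field_simp, mul_pow]
    ring
  rw [h3, kappa, qParam_eq hk]
  have h4 : 0 ≤ α ^ 2 * Real.exp (-6 * lam) := by positivity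
  have h5 : 0 ≤ (Real.exp (-2 * lam) / (2 * d)) ^ (k - 2) := by positivity
  have h6 := mul_le_mul_of_nonneg_left h2 h4
  have h7 := mul_nonneg h4 h5
  linarith

/-- The concentration bound at the chosen sample size. -/
lemma exp_sample_bound {κ A x : ℝ} (hκ : 0 < κ) (hA : 0 < A) {M : ℕ}
    (hM : 2000 * Real.log A / κ ^ 2 ≤ M) (hx : 4 / 5 * κ ≤ x) :
    Real.exp (M * (-(κ / 40) * x + 13 * (κ / 40) ^ 2)) ≤ 1 / A := by
  have h1 : 2000 * Real.log A ≤ M * κ ^ 2 := (div_le_iff₀ (by positivity)).1 hM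
  have h2 : 0 ≤ (M : ℝ) * κ ^ 2 := by positivity
  rw [one_div, ← Real.exp_log (inv_pos.2 hA), Real.log_inv]
  refine Real.exp_le_exp.2 ?_
  have h3 : (M : ℝ) * (-(κ / 40) * x + 13 * (κ / 40) ^ 2) ≤
      M * (-(κ / 40) * (4 / 5 * κ) + 13 * (κ / 40) ^ 2) := by
    refine mul_le_mul_of_nonneg_left ?_ (Nat.cast_nonneg M)
    nlinarith
  refine h3.trans ?_
  -- The exponent is `-(19/1600) M κ²`, and `2000 · 19/1600 = 23.75 > 1`. When `log A ≤ 0`,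
  -- nonpositivity of the exponent suffices.
  rcases le_or_gt (Real.log A) 0 with h | h <;> nlinarith

end parameters

end

section

/-! ### The error probabilities of the test -/

variable {n k d : ℕ} {α lam : ℝ}

lemma statZ_le_one (L : ℝ) (r : ℕ) (x : ℝ → Bool) (ti : ℕ → ℝ) (l : ℕ) : statZ L r x ti l ≤ 1 := by
  unfold statZ updateIndicator
  split_ifs <;> norm_num

lemma averageZ_le_one (L : ℝ) (r M : ℕ) (x : ℝ → Config n) (t : Fin n → ℕ → ℝ) (i j : Fin n) :
    averageZ L r M x t i j ≤ 1 := by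
  rcases Nat.eq_zero_or_pos M with rfl | hM
  · simp [averageZ]
  · have hM' : (0 : ℝ) < M := by exact_mod_cast hM
    rw [averageZ, one_div, inv_mul_le_iff₀ hM', mul_one]
    refine (Finset.sum_le_card_nsmul _ _ 1 fun s _ => statZ_le_one _ _ _ _ _).trans_eq ?_
    simp

section sample

variable {Ω : Type*} [MeasurableSpace Ω] {P : Measure Ω} [IsProbabilityMeasure P]

/-- A bound that holds for the sample size when it is positive holds in all cases. -/
lemma measureReal_le_of_sample_pos {δ : ℝ} (hδ : 0 < δ) (hn : 0 < n) (hκ : 0 < kappa k d α lam)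
    {s : Set Ω} (h : 0 < numSamples n k d α lam δ → P.real s ≤ 1 / (2 * (n : ℝ) ^ 2 / δ)) :
    P.real s ≤ δ / (2 * (n : ℝ) ^ 2) := by
  have hn' : (0 : ℝ) < n := by exact_mod_cast hn
  rcases Nat.eq_zero_or_pos (numSamples n k d α lam δ) with h0 | h0
  · refine measureReal_le_one.trans ?_
    have h1 := Nat.ceil_eq_zero.1 h0
    rw [div_le_iff₀ (by positivity), zero_mul] at h1
    -- An empty sample means that the claimed bound is at least `1`.
    have h2 : 2 * (n : ℝ) ^ 2 / δ ≤ 1 := by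
      rw [← Real.log_nonpos_iff (by positivity)]
      linarith
    rw [div_le_one hδ] at h2
    rwa [one_le_div (by positivity)]
  · simpa [one_div_div] using h h0

variable {ψ : Config n → ℝ} {X : ℝ → Ω → Config n} {T : Fin n → ℕ → Ω → ℝ}

theorem IsGlauberDynamics.measureReal_kappa_le_averageZ (hd : 1 ≤ d) (hα : 0 < α)
    (hψ : IsMRF ψ k d α lam) (hX : IsGlauberDynamics P ψ X T) {δ : ℝ} (hδ : 0 < δ) {i j : Fin n}
    (hij : i ≠ j) (h : ¬ Adj ψ i j) :
    P.real {ω | kappa k d α lam ≤ averageZ (blockLength k d α lam) (numBlocks k d α lam)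
        (numSamples n k d α lam δ) (fun t => X t ω) (fun a m => T a m ω) i j} ≤
      δ / (2 * (n : ℝ) ^ 2) := by
  have hn : 0 < n := i.pos
  have hn' : (0 : ℝ) < n := by exact_mod_cast hn
  have hκ := kappa_pos (k := k) (lam := lam) hd hα
  have hL := blockLength_pos (k := k) (lam := lam) hd hα
  have hr := one_le_numBlocks (k := k) (lam := lam) hd hα
  have hr' : (1 : ℝ) ≤ numBlocks k d α lam := by exact_mod_cast hr
  have hT := hX.indepPoissonClocks
  refine measureReal_le_of_sample_pos hδ hn hκ fun hM => ?_
  -- Without an edge nothing forces `k ≥ 2` or `α ≤ λ`, so `κ` may be too large for `θ = κ/40` to be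
  -- admissible. For `κ > 1` the event is empty, as `Z ≤ 1`.
  rcases lt_or_ge 1 (kappa k d α lam) with hκ1 | hκ1
  · have : {ω | kappa k d α lam ≤ averageZ (blockLength k d α lam) (numBlocks k d α lam)
        (numSamples n k d α lam δ) (fun t => X t ω) (fun a m => T a m ω) i j} = ∅ :=
      Set.eq_empty_of_forall_notMem fun ω hω =>
        absurd ((show _ ≤ _ from hω).trans (averageZ_le_one _ _ _ _ _ _ _)) (not_le.2 hκ1)
    rw [this, measureReal_empty]
    positivity
  have hmean : ∀ b : ℝ, 0 ≤ b → -(kappa k d α lam / 5) ≤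
      ∫ ω, windowStat (i := i) (j := j) (fun _ x' => -busy (support (partialDeriv i ψ)) x') 0
        (blockLength k d α lam) (otherClocks T i j ω) b ∂P := by
    intro b hb
    simp only [windowStat]
    rw [integral_neg, neg_le_neg_iff, ← mul_blockLength hd]
    refine (hT.integral_busy_le _ hb hL.le).trans (mul_le_mul_of_nonneg_right ?_ hL.le)
    exact_mod_cast hψ.junta i
  have key := hX.measureReal_averageZ_le (θ := kappa k d α lam / 40) hij hL hr le_rfl
    (mul_nonneg (sub_nonneg.2 hr') hL.le) (by norm_num : |(-1 : ℝ)| ≤ 1) (by positivity)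
    (by linarith) (fun x x' => ?_) (hasBlockBias_of_not_adj h hL) hmean hM (-kappa k d α lam)
  · refine le_trans (le_of_eq ?_) (key.trans (exp_sample_bound hκ (by positivity)
      (Nat.le_ceil _) (by linarith)))
    simp only [neg_one_mul, neg_le_neg_iff]
  · have h1 := busy_nonneg (support (partialDeriv i ψ)) x'
    have h2 := busy_le_one (support (partialDeriv i ψ)) x'
    rw [abs_neg, abs_of_nonneg h1]
    linarith

theorem IsGlauberDynamics.measureReal_averageZ_le_kappa (hd : 1 ≤ d) (hα : 0 < α)
    (hψ : IsMRF ψ k d α lam) (hX : IsGlauberDynamics P ψ X T) {δ : ℝ} (hδ : 0 < δ) {i j : Fin n}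
    (hij : i ≠ j) (h : Adj ψ i j) :
    P.real {ω | averageZ (blockLength k d α lam) (numBlocks k d α lam)
        (numSamples n k d α lam δ) (fun t => X t ω) (fun a m => T a m ω) i j ≤ kappa k d α lam} ≤
      δ / (2 * (n : ℝ) ^ 2) := by
  have hn : 0 < n := i.pos
  have hn' : (0 : ℝ) < n := by exact_mod_cast hn
  have hκ := kappa_pos (k := k) (lam := lam) hd hα
  have hL := blockLength_pos (k := k) (lam := lam) hd hα
  have hr := one_le_numBlocks (k := k) (lam := lam) hd hα
  have hr' : (1 : ℝ) ≤ numBlocks k d α lam := by exact_mod_cast hr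
  have hT := hX.indepPoissonClocks
  obtain ⟨S, hS, hi, hj, hαS⟩ := hψ.nontrivial_edges i j h
  have hw : ∀ v x, |partialDeriv v ψ x| ≤ lam := fun v x =>
    (abs_le_fourierNormOne _ x).trans (hψ.width_le v)
  -- The edge supplies a coefficient between `α` and `λ` and a monomial of size at least `2`. These
  -- give `λ ≥ 0` and `k ≥ 2`, whence `κ` and `L` are small.
  have hαlam : α ≤ lam := by
    refine hαS.trans (le_trans ?_ ((abs_coeff_le_fourierNormOne _ (S.erase i)).trans
      (hψ.width_le i)))
    rw [coeff_partialDeriv, if_neg (Finset.notMem_erase i S), Finset.insert_erase hi]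
  have hlam : 0 ≤ lam := hα.le.trans hαlam
  have hji : j ∈ S.erase i := Finset.mem_erase.2 ⟨hij.symm, hj⟩
  have hcard : ((S.erase i).erase j).card + 2 = S.card := by
    have h1 := Finset.card_erase_add_one hi
    have h2 := Finset.card_erase_add_one hji
    omega
  have hcardk : ((S.erase i).erase j).card + 2 ≤ k := hcard.trans_le (hψ.degree_le S hS.1)
  have hk : 2 ≤ k := by omega
  have hκ1 := kappa_le hα.le hαlam hd hk
  have hRN : (S.erase i).erase j ⊆ (support (partialDeriv i ψ)).erase j := by
    intro v hv
    simp only [Finset.mem_erase] at hv ⊢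
    exact ⟨hv.1, adj_of_coeff_ne_zero hv.2.1.symm hi hv.2.2 hS.1⟩
  obtain ⟨σ, hσ, hσlog, hσ0, hσP⟩ := exists_window_length (a := ((S.erase i).erase j).card)
    (m := ((support (partialDeriv i ψ)).erase j \ (S.erase i).erase j).card) hd (by
      have h1 := Finset.card_sdiff_add_card_eq_card hRN
      have h2 := Finset.card_erase_add_one h
      have h3 := hψ.junta i
      omega)
  have hσr : σ ≤ ((numBlocks k d α lam : ℝ) - 1) * blockLength k d α lam := by
    rcases Nat.eq_zero_or_pos ((S.erase i).erase j).card with h0 | h0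
    · rw [hσ0 h0]
      exact mul_nonneg (sub_nonneg.2 hr') hL.le
    · exact hσlog.trans (log_two_le_numBlocks_sub_one_mul hd hα (by omega)
        (blockLength_le hα.le hαlam hd hk))
  have hc : Real.exp (-(2 * lam)) ≤ 1 := Real.exp_le_one_iff.2 (by linarith)
  have hαe : α * Real.exp (-(2 * lam)) ≤ 1 := by
    rw [Real.exp_neg, ← div_eq_mul_inv, div_le_one (Real.exp_pos _)]
    linarith [Real.add_one_le_exp (2 * lam)]
  obtain ⟨c₀, hc₀⟩ : ∃ c₀, c₀ = Real.exp (-(2 * lam)) / 2 * (α * Real.exp (-(2 * lam))) ^ 2 *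
    (Real.exp (-(2 * lam)) / 2) ^ ((S.erase i).erase j).card := ⟨_, rfl⟩
  have hc₀0 : 0 ≤ c₀ := by rw [hc₀]; positivity
  have hc₀1 : c₀ ≤ 1 := by
    rw [hc₀]
    have hp := Real.exp_pos (-(2 * lam))
    exact mul_le_one₀ (mul_le_one₀ (by linarith) (by positivity)
      (pow_le_one₀ (by positivity) hαe)) (by positivity) (pow_le_one₀ (by positivity) (by linarith))
  -- The gain `4κ` minus the penalty `3 · 2d · L = 6κ/5` leaves `14κ/5`.
  have hmean : ∀ b : ℝ, σ ≤ b → 2 * kappa k d α lam ≤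
      ∫ ω, windowStat (i := i) (j := j) (fun x x' =>
        c₀ * primed ((S.erase i).erase j) ((support (partialDeriv i ψ)).erase j) x -
        3 * busy (support (partialDeriv i ψ) ∪ support (partialDeriv j ψ)) x') σ
        (blockLength k d α lam) (otherClocks T i j ω) b ∂P := by
    intro b hb
    simp only [windowStat]
    rw [integral_sub, integral_const_mul, integral_const_mul,
      hT.integral_primed hRN (fun hh => notMem_support_partialDeriv_self i ψ
        (Finset.mem_of_mem_erase hh)) (Finset.notMem_erase _ _) hσ hb]
    · have h1 := (four_mul_kappa_le (α := α) hd hk hlam hcardk).trans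
        (mul_le_mul_of_nonneg_left hσP (hc₀ ▸ hc₀0))
      rw [← hc₀] at h1
      have h2 := hT.integral_busy_le (i := i) (j := j)
        (support (partialDeriv i ψ) ∪ support (partialDeriv j ψ)) (hσ.trans hb) hL.le
      have h3 : ((support (partialDeriv i ψ) ∪ support (partialDeriv j ψ)).card : ℝ) ≤
          2 * d := by
        have := Finset.card_union_le (support (partialDeriv i ψ)) (support (partialDeriv j ψ))
        have := hψ.junta i
        have := hψ.junta j
        exact_mod_cast (by omega :
          (support (partialDeriv i ψ) ∪ support (partialDeriv j ψ)).card ≤ 2 * d)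
      have h4 := mul_le_mul_of_nonneg_right h3 hL.le
      have h5 := mul_blockLength (k := k) (α := α) (lam := lam) hd
      linarith
    · exact (integrable_comp_increments hT (C := 1) (fun x => abs_le.2
        ⟨by linarith [primed_nonneg ((S.erase i).erase j) ((support (partialDeriv i ψ)).erase j) x],
          primed_le_one _ _ x⟩) _ _).const_mul _
    · exact (integrable_comp_increments hT (C := 1) (fun x => abs_le.2
        ⟨by linarith [busy_nonneg (support (partialDeriv i ψ) ∪ support (partialDeriv j ψ)) x],
          busy_le_one _ x⟩) _ _).const_mul _
  refine measureReal_le_of_sample_pos hδ hn hκ fun hM => ?_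
  have key := hX.measureReal_averageZ_le (θ := kappa k d α lam / 40) hij hL hr hσ
    hσr (by norm_num : |(1 : ℝ)| ≤ 1) (by positivity)
    (by linarith) (fun x x' => ?_) (hasBlockBias_of_maximal hij hS hi hj hα.le hαS hlam hw rfl
      hc₀ hc₀1 hL hσ) hmean hM (kappa k d α lam)
  · refine le_trans (le_of_eq ?_) (key.trans (exp_sample_bound hκ (by positivity)
      (Nat.le_ceil _) (by linarith)))
    simp only [one_mul]
  · have h1 := busy_nonneg (support (partialDeriv i ψ) ∪ support (partialDeriv j ψ)) x'
    have h2 := busy_le_one (support (partialDeriv i ψ) ∪ support (partialDeriv j ψ)) x'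
    have h3 := mul_nonneg hc₀0
      (primed_nonneg ((S.erase i).erase j) ((support (partialDeriv i ψ)).erase j) x)
    have h4 := mul_le_one₀ hc₀1
      (primed_nonneg ((S.erase i).erase j) ((support (partialDeriv i ψ)).erase j) x)
      (primed_le_one _ _ x)
    exact abs_le.2 ⟨by linarith, by linarith⟩

end sample

end

end

end MRF

theorem mainTheorem8 {n k d : ℕ} {α lam : ℝ} (hd : 1 ≤ d) (hα : 0 < α)
    (ψ : MRF.Config n → ℝ) (hψ : MRF.IsMRF ψ k d α lam)
    {Ω : Type*} [MeasurableSpace Ω] (P : Measure Ω) [IsProbabilityMeasure P]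
    (X : ℝ → Ω → MRF.Config n) (T : Fin n → ℕ → Ω → ℝ)
    (hX : MRF.IsGlauberDynamics P ψ X T)
    (δ : ℝ) (hδ : 0 < δ) (i j : Fin n) (hij : i ≠ j) :
    (MRF.Adj ψ i j →
      P.real {ω | MRF.averageZ (MRF.blockLength k d α lam) (MRF.numBlocks k d α lam)
          (MRF.numSamples n k d α lam δ) (fun t => X t ω) (fun a m => T a m ω) i j
          ≤ MRF.kappa k d α lam} ≤ δ / (2 * (n : ℝ) ^ 2)) ∧
    (¬ MRF.Adj ψ i j →
      P.real {ω | MRF.kappa k d α lam ≤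
          MRF.averageZ (MRF.blockLength k d α lam) (MRF.numBlocks k d α lam)
          (MRF.numSamples n k d α lam δ) (fun t => X t ω) (fun a m => T a m ω) i j}
        ≤ δ / (2 * (n : ℝ) ^ 2)) := by
  exact ⟨hX.measureReal_averageZ_le_kappa hd hα hψ hδ hij,
    hX.measureReal_kappa_le_averageZ hd hα hψ hδ hij⟩
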